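/- **Theorem (pointwise kernel estimates).** Let $n\in\mathbb N$, $m\in\mathbb R$, $0<\rho\le 1$, $0\le\delta<1$, and let $p\in BS^m_{\rho,\delta}(\mathbb R^n)$, that is, $p$ is a smooth function on $\mathbb R^n\times\mathbb R^n\times\mathbb R^n$ such that for all multi-indices $\alpha,\beta,\gamma$ there is a constant $C_{\alpha\beta\gamma}>0$ with $$|\partial_x^\alpha\partial_\xi^\beta\partial_\eta^\gamma p(x,\xi,\eta)|\le C_{\alpha\beta\gamma}\,(1+|\xi|+|\eta|)^{m+\delta|\alpha|-\rho(|\beta|+|\gamma|)}\qquad\text{for all }x,\xi,\eta\in\mathbb R^n.$$ Let $$T_p(f,g)(x)=\int_{\mathbb R^n}\int_{\mathbb R^n}p(x,\xi,\eta)\,\widehat f(\xi)\,\widehat g(\eta)\,e^{ix\cdot(\xi+\eta)}\,d\xi\,d\eta,\qquad f,g\in\mathcal S(\mathbb R^n),$$ where $\widehat f(\xi)=(2\pi)^{-n}\int_{\mathbb R^n}e^{-ix\cdot\xi}f(x)\,dx$. Then $T_p$ has exactly one distributional kernel $k=k(x,y,z)$, that is, there is exactly one tempered distribution $k$ on $\mathbb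 R^{3n}$ with $\langle k,h\otimes f\otimes g\rangle=\int_{\mathbb R^n}T_p(f,g)(x)\,h(x)\,dx$ for all $f,g,h\in\mathcal S(\mathbb R^n)$. Put $S(x,y,z)=|x-y|+|x-z|+|y-z|$. On the open set $\{S>0\}$ the distribution $k$ is a smooth function, and the following hold. 1. Given multi-indices $\alpha,\beta,\gamma$, there is an integer $N_0\ge 0$ such that for each integer $N\ge N_0$, $$\sup_{(x,y,z):\,S(x,y,z)>0}S(x,y,z)^N\,|\partial_x^\alpha\partial_y^\beta\partial_z^\gamma k(x,y,z)|<\infty.$$ 2. Suppose that $p$ has compact support in $(\xi,\eta)$ uniformly in $x$, that is, there is a compact $K\subset\mathbb R^{2n}$ with $p(x,\xi,\eta)=0$ whenever $(\xi,\eta)\notin K$. Then $k$ is a smooth function on $\mathbb R^{3n}$ and, given multi-indices $\alpha,\beta,\gamma$ and an integer $N\ge 0$, there is $C>0$ such that for all $x,y,z\in\mathbb R^n$ with $S(x,y,z)>0$, $$|\partial_x^\alpha\partial_y^\beta\partial_z^\gamma k(x,y,z)|\le C\,(1+S(x,y,z))^{-N}.$$ 3. If $M\ge 0$ is an integer with $m+M+2n<0$,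 then $k$ is a bounded continuous function on $\mathbb R^{3n}$ with bounded continuous derivatives of order $\le M$. 4. If $M\ge 0$ is an integer with $m+M+2n=0$, then there is $C>0$ such that for all $x,y,z\in\mathbb R^n$ with $S(x,y,z)>0$, $$\sup_{|\alpha|+|\beta|+|\gamma|=M}|\partial_x^\alpha\partial_y^\beta\partial_z^\gamma k(x,y,z)|\le C\,\bigl(1+|\log S(x,y,z)|\bigr).$$ 5. If $M\ge 0$ is an integer with $m+M+2n>0$, then there is $C>0$ such that for all $x,y,z\in\mathbb R^n$ with $S(x,y,z)>0$, $$\sup_{|\alpha|+|\beta|+|\gamma|=M}|\partial_x^\alpha\partial_y^\beta\partial_z^\gamma k(x,y,z)|\le C\,S(x,y,z)^{-(m+M+2n)/\rho}.$$ -/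

import Mathlib

open MeasureTheory
open scoped SchwartzMap ContDiff

namespace BilinearPDO

/-- The space `ℝⁿ` with its Euclidean norm. -/
abbrev Rn (n : ℕ) : Type := EuclideanSpace ℝ (Fin n)

/-- The space `ℝⁿ × ℝⁿ × ℝⁿ`, in which the arguments `(x, ξ, η)` of a bilinear symbol and the
arguments `(x, y, z)` of a bilinear kernel live. -/
abbrev Rn3 (n : ℕ) : Type := Rn n × Rn n × Rn n

/-! ### Partial derivatives -/

section Derivatives

variable {V : Type*} [NormedAddCommGroup V] [NormedSpace ℝ V]

/-- The classical directional derivative `w ↦ d/dt F(w + t v) |_{t = 0}` of a function `F`. -/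
noncomputable def dirDeriv (v : V) (F : V → ℂ) : V → ℂ := fun w => lineDeriv ℝ F w v

/-- `∂_{v 0}^{α 0} ⋯ ∂_{v (n-1)}^{α (n-1)} F` for a list of directions `v` and a multi-index `α`. -/
noncomputable def multiDeriv {n : ℕ} (v : Fin n → V) (α : Fin n → ℕ) (F : V → ℂ) : V → ℂ :=
  (List.finRange n).foldr (fun i G => (dirDeriv (v i))^[α i] G) F

end Derivatives

/-- The length `|α| = α_1 + ⋯ + α_n` of a multi-index. -/
def len {n : ℕ} (α : Fin n → ℕ) : ℕ := ∑ i, α i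

/-- The `i`-th standard unit vector of `ℝⁿ`. -/
noncomputable def unitVec {n : ℕ} (i : Fin n) : Rn n := EuclideanSpace.single i (1 : ℝ)

/-- The mixed partial derivative `∂₁^α ∂₂^β ∂₃^γ F`, the `j`-th operator acting in the
`j`-th of the three `ℝⁿ`-variables of `F`. -/
noncomputable def mixedDeriv {n : ℕ} (α β γ : Fin n → ℕ) (F : Rn3 n → ℂ) : Rn3 n → ℂ :=
  multiDeriv (fun i => ((unitVec i, 0, 0) : Rn3 n)) α
    (multiDeriv (fun i => ((0, unitVec i, 0) : Rn3 n)) β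
      (multiDeriv (fun i => ((0, 0, unitVec i) : Rn3 n)) γ F))

/-! ### Bilinear symbols and operators -/

/-- The bilinear Hörmander class `BS^m_{ρ,δ}(ℝⁿ)`: smooth functions `p(x, ξ, η)` with
`|∂_x^α ∂_ξ^β ∂_η^γ p| ≤ C_{αβγ} (1 + |ξ| + |η|)^{m + δ|α| - ρ(|β| + |γ|)}`. -/
def IsBSSymbol {n : ℕ} (m ρ δ : ℝ) (p : Rn3 n → ℂ) : Prop :=
  ContDiff ℝ ∞ p ∧
    ∀ α β γ : Fin n → ℕ, ∃ C : ℝ, 0 < C ∧ ∀ x ξ η : Rn n,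
      ‖mixedDeriv α β γ p (x, ξ, η)‖ ≤
        C * (1 + ‖ξ‖ + ‖η‖) ^ (m + δ * (len α : ℝ) - ρ * ((len β : ℝ) + (len γ : ℝ)))

/-- `p(x, ξ, η)` has compact support in `(ξ, η)`, uniformly in `x`. -/
def HasUniformCompactFreqSupport {n : ℕ} (p : Rn3 n → ℂ) : Prop :=
  ∃ K : Set (Rn n × Rn n), IsCompact K ∧ ∀ x ξ η : Rn n, (ξ, η) ∉ K → p (x, ξ, η) = 0

/-- The Fourier transform `f̂(ξ) = (2π)^{-n} ∫ e^{-i x·ξ} f(x) dx`, normalised so that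
`f(x) = ∫ f̂(ξ) e^{i x·ξ} dξ`. -/
noncomputable def fhat {n : ℕ} (f : Rn n → ℂ) (ξ : Rn n) : ℂ :=
  (((2 * Real.pi) ^ n : ℝ) : ℂ)⁻¹ *
    ∫ x : Rn n, Complex.exp (-(Complex.I * ((inner ℝ x ξ : ℝ) : ℂ))) * f x

/-- The bilinear pseudodifferential operator
`T_p(f, g)(x) = ∫∫ p(x, ξ, η) f̂(ξ) ĝ(η) e^{i x·(ξ + η)} dξ dη`. -/
noncomputable def bilinearOp {n : ℕ} (p : Rn3 n → ℂ) (f g : Rn n → ℂ) (x : Rn n) : ℂ :=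
  ∫ ξ : Rn n, ∫ η : Rn n,
    p (x, ξ, η) * fhat f ξ * fhat g η * Complex.exp (Complex.I * ((inner ℝ x (ξ + η) : ℝ) : ℂ))

/-! ### Tensor products of Schwartz functions -/

section Tensor

variable {D E : Type*} [NormedAddCommGroup D] [NormedSpace ℝ D]
  [NormedAddCommGroup E] [NormedSpace ℝ E]

theorem norm_iteratedFDeriv_fst_le (f : 𝓢(D, ℂ)) (i : ℕ) (w : D × E) :
    ‖iteratedFDeriv ℝ i (fun w : D × E => f w.1) w‖ ≤ ‖iteratedFDeriv ℝ i f w.1‖ := by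
  have h := ContinuousLinearMap.iteratedFDeriv_comp_right (𝕜 := ℝ)
    (ContinuousLinearMap.fst ℝ D E) (f.smooth ⊤) w (i := i) (by exact_mod_cast le_top)
  change ‖iteratedFDeriv ℝ i (f ∘ (ContinuousLinearMap.fst ℝ D E)) w‖ ≤ _
  rw [h]
  refine (ContinuousMultilinearMap.norm_compContinuousLinearMap_le _ _).trans ?_
  refine mul_le_of_le_one_right (norm_nonneg _) ?_
  exact Finset.prod_le_one (fun _ _ => norm_nonneg _)
    (fun _ _ => ContinuousLinearMap.norm_fst_le ℝ D E)

theorem norm_iteratedFDeriv_snd_le (g : 𝓢(E, ℂ)) (i : ℕ) (w : D × E) :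
    ‖iteratedFDeriv ℝ i (fun w : D × E => g w.2) w‖ ≤ ‖iteratedFDeriv ℝ i g w.2‖ := by
  have h := ContinuousLinearMap.iteratedFDeriv_comp_right (𝕜 := ℝ)
    (ContinuousLinearMap.snd ℝ D E) (g.smooth ⊤) w (i := i) (by exact_mod_cast le_top)
  change ‖iteratedFDeriv ℝ i (g ∘ (ContinuousLinearMap.snd ℝ D E)) w‖ ≤ _
  rw [h]
  refine (ContinuousMultilinearMap.norm_compContinuousLinearMap_le _ _).trans ?_
  refine mul_le_of_le_one_right (norm_nonneg _) ?_
  exact Finset.prod_le_one (fun _ _ => norm_nonneg _)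
    (fun _ _ => ContinuousLinearMap.norm_snd_le ℝ D E)

theorem contDiff_tensor (f : 𝓢(D, ℂ)) (g : 𝓢(E, ℂ)) :
    ContDiff ℝ ∞ (fun w : D × E => f w.1 * g w.2) :=
  ((f.smooth ⊤).comp contDiff_fst).mul ((g.smooth ⊤).comp contDiff_snd)

theorem decay_tensor (f : 𝓢(D, ℂ)) (g : 𝓢(E, ℂ)) (k l : ℕ) : ∃ C : ℝ, ∀ w : D × E,
    ‖w‖ ^ k * ‖iteratedFDeriv ℝ l (fun w : D × E => f w.1 * g w.2) w‖ ≤ C := by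
  choose A hA0 hA using fun i => f.decay k i
  choose A' hA0' hA' using fun i => f.decay 0 i
  choose B hB0 hB using fun i => g.decay k i
  choose B' hB0' hB' using fun i => g.decay 0 i
  refine ⟨∑ i ∈ Finset.range (l + 1),
    (l.choose i : ℝ) * (A i * B' (l - i) + A' i * B (l - i)), fun w => ?_⟩
  have h1 := norm_iteratedFDeriv_mul_le (𝕜 := ℝ) (N := ∞)
    ((f.smooth ⊤).comp (contDiff_fst (E := D) (F := E)))
    ((g.smooth ⊤).comp (contDiff_snd (E := D) (F := E))) w (n := l) (by exact_mod_cast le_top)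
  have hk : ‖w‖ ^ k ≤ ‖w.1‖ ^ k + ‖w.2‖ ^ k := by
    rcases max_cases ‖w.1‖ ‖w.2‖ with h | h
    · rw [Prod.norm_def, h.1]; exact le_add_of_nonneg_right (by positivity)
    · rw [Prod.norm_def, h.1]; exact le_add_of_nonneg_left (by positivity)
  refine (mul_le_mul_of_nonneg_left h1 (by positivity)).trans ?_
  rw [Finset.mul_sum]
  refine Finset.sum_le_sum fun i _ => ?_
  have a := norm_iteratedFDeriv_fst_le f i w
  have b := norm_iteratedFDeriv_snd_le g (l - i) w
  have e1 := hA i w.1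
  have e2 := hB (l - i) w.2
  have e3 := hA' i w.1
  have e4 := hB' (l - i) w.2
  rw [pow_zero, one_mul] at e3 e4
  calc ‖w‖ ^ k * ((l.choose i : ℝ) * ‖iteratedFDeriv ℝ i (f ∘ Prod.fst) w‖ *
        ‖iteratedFDeriv ℝ (l - i) (g ∘ Prod.snd) w‖)
      ≤ (‖w.1‖ ^ k + ‖w.2‖ ^ k) * ((l.choose i : ℝ) * ‖iteratedFDeriv ℝ i f w.1‖ *
        ‖iteratedFDeriv ℝ (l - i) g w.2‖) := by
        gcongr
        · exact a
        · exact b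
    _ = (l.choose i : ℝ) *
        ((‖w.1‖ ^ k * ‖iteratedFDeriv ℝ i f w.1‖) * ‖iteratedFDeriv ℝ (l - i) g w.2‖ +
          ‖iteratedFDeriv ℝ i f w.1‖ * (‖w.2‖ ^ k * ‖iteratedFDeriv ℝ (l - i) g w.2‖)) := by
        ring
    _ ≤ (l.choose i : ℝ) * (A i * B' (l - i) + A' i * B (l - i)) := by
        have := (hA0 i).le
        have := (hA0' i).le
        gcongr

/-- The tensor product `(f ⊗ g)(x, y) = f(x) g(y)` of two Schwartz functions. -/
noncomputable def tensor (f : 𝓢(D, ℂ)) (g : 𝓢(E, ℂ)) : 𝓢(D × E, ℂ) where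
  toFun w := f w.1 * g w.2
  smooth' := contDiff_tensor f g
  decay' := decay_tensor f g

end Tensor

/-! ### Distributional kernels -/

/-- The tempered distribution `k(x, y, z)` on `ℝ³ⁿ` is a distributional kernel of `T_p`:
`⟨k, h ⊗ f ⊗ g⟩ = ∫ T_p(f, g)(x) h(x) dx` for all Schwartz functions `f, g, h`, that is,
`T_p(f, g)(x) = ∫∫ k(x, y, z) f(y) g(z) dy dz` in the sense of distributions. -/
def IsDistribKernel {n : ℕ} (p : Rn3 n → ℂ) (k : 𝓢'(Rn3 n, ℂ)) : Prop :=
  ∀ f g h : 𝓢(Rn n, ℂ), k (tensor h (tensor f g)) = ∫ x : Rn n, bilinearOp p f g x * h x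

/-- The restriction of the distribution `k` to the open set `U` is the function `κ`:
`⟨k, Φ⟩ = ∫ κ Φ` for all test functions `Φ ∈ C_c^∞(U)`. -/
def IsGivenOn {n : ℕ} (k : 𝓢'(Rn3 n, ℂ)) (U : Set (Rn3 n)) (κ : Rn3 n → ℂ) : Prop :=
  LocallyIntegrableOn κ U ∧
    ∀ Φ : 𝓢(Rn3 n, ℂ), HasCompactSupport Φ → tsupport Φ ⊆ U → k Φ = ∫ w : Rn3 n, κ w * Φ w

/-- `S(x, y, z) = |x - y| + |x - z| + |y - z|`. -/
noncomputable def sumDist {n : ℕ} (x y z : Rn n) : ℝ := ‖x - y‖ + ‖x - z‖ + ‖y - z‖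

/-- The complement `{(x, y, z) : S(x, y, z) > 0}` of the diagonal `x = y = z`. -/
def offDiag (n : ℕ) : Set (Rn3 n) := {w | 0 < sumDist w.1 w.2.1 w.2.2}

end BilinearPDO

open BilinearPDO

namespace BilinearPDO

/-! ### Directional derivatives of smooth functions -/

section DirDeriv

variable {V : Type*} [NormedAddCommGroup V] [NormedSpace ℝ V]

theorem dirDeriv_eq_fderiv {F : V → ℂ} {w : V} (h : DifferentiableAt ℝ F w) (v : V) :
    dirDeriv v F w = fderiv ℝ F w v :=
  h.lineDeriv_eq_fderiv

theorem dirDeriv_eq_fderiv_fun {F : V → ℂ} (hF : ContDiff ℝ ∞ F) (v : V) :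
    dirDeriv v F = fun w => fderiv ℝ F w v :=
  funext fun w => dirDeriv_eq_fderiv (hF.differentiable (by simp) w) v

theorem contDiff_dirDeriv {F : V → ℂ} (hF : ContDiff ℝ ∞ F) (v : V) :
    ContDiff ℝ ∞ (dirDeriv v F) := by
  rw [dirDeriv_eq_fderiv_fun hF]
  exact (hF.fderiv_right (m := ∞) (by simp)).clm_apply contDiff_const

theorem dirDeriv_const (c : ℂ) (v : V) : dirDeriv v (fun _ : V => c) = fun _ => 0 := by
  funext w
  rw [dirDeriv_eq_fderiv (differentiableAt_const c)]
  simp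

theorem dirDeriv_add {F G : V → ℂ} (hF : ContDiff ℝ ∞ F) (hG : ContDiff ℝ ∞ G) (v : V) :
    dirDeriv v (fun w => F w + G w) = fun w => dirDeriv v F w + dirDeriv v G w := by
  funext w
  have h1 := hF.differentiable (by simp) w
  have h2 := hG.differentiable (by simp) w
  change dirDeriv v (F + G) w = _
  rw [dirDeriv_eq_fderiv (h1.add h2), dirDeriv_eq_fderiv h1, dirDeriv_eq_fderiv h2,
    fderiv_add h1 h2]
  rfl

theorem dirDeriv_mul {F G : V → ℂ} (hF : ContDiff ℝ ∞ F) (hG : ContDiff ℝ ∞ G) (v : V) :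
    dirDeriv v (fun w => F w * G w) = fun w => dirDeriv v F w * G w + F w * dirDeriv v G w := by
  funext w
  have h1 := hF.differentiable (by simp) w
  have h2 := hG.differentiable (by simp) w
  change dirDeriv v (F * G) w = _
  rw [dirDeriv_eq_fderiv (h1.mul h2), dirDeriv_eq_fderiv h1, dirDeriv_eq_fderiv h2,
    fderiv_mul h1 h2]
  simp only [add_apply, smul_apply, smul_eq_mul]
  ring

theorem dirDeriv_const_mul {F : V → ℂ} (c : ℂ) (hF : ContDiff ℝ ∞ F) (v : V) :
    dirDeriv v (fun w => c * F w) = fun w => c * dirDeriv v F w := by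
  funext w
  have h1 := hF.differentiable (by simp) w
  rw [dirDeriv_eq_fderiv (h1.const_mul c), dirDeriv_eq_fderiv h1, fderiv_const_mul h1]
  rfl

theorem dirDeriv_comm {F : V → ℂ} (hF : ContDiff ℝ ∞ F) (u v : V) :
    dirDeriv u (dirDeriv v F) = dirDeriv v (dirDeriv u F) := by
  have h2 : ContDiff ℝ ∞ (fderiv ℝ F) := hF.fderiv_right (m := ∞) (by simp)
  funext w
  have hd := h2.differentiable (by simp) w
  have key : ∀ a b : V, dirDeriv a (dirDeriv b F) w = fderiv ℝ (fderiv ℝ F) w a b := by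
    intro a b
    rw [dirDeriv_eq_fderiv ((contDiff_dirDeriv hF b).differentiable (by simp) w),
      dirDeriv_eq_fderiv_fun hF, fderiv_clm_apply hd (differentiableAt_const _)]
    simp
  rw [key, key]
  exact (hF.contDiffAt.isSymmSndFDerivAt (by
    rw [minSmoothness_of_isRCLikeNormedField]; exact WithTop.coe_le_coe.2 le_top)).eq u v

theorem dirDeriv_sum_smul {J : Type*} (s : Finset J) (c : J → ℝ) (v : J → V) {F : V → ℂ}
    (hF : ContDiff ℝ ∞ F) :
    dirDeriv (∑ j ∈ s, c j • v j) F = fun w => ∑ j ∈ s, (c j : ℂ) * dirDeriv (v j) F w := by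
  simp only [dirDeriv_eq_fderiv_fun hF]
  funext w
  simp [map_sum]

theorem dirDeriv_congr_of_isOpen {U : Set V} (hU : IsOpen U) {F G : V → ℂ}
    (h : ∀ w ∈ U, F w = G w) (v : V) : ∀ w ∈ U, dirDeriv v F w = dirDeriv v G w := by
  intro w hw
  exact Filter.EventuallyEq.lineDeriv_eq (Filter.eventually_of_mem (hU.mem_nhds hw) h)

theorem dirDeriv_eq_zero_of_isOpen {U : Set V} (hU : IsOpen U) {F : V → ℂ}
    (h : ∀ w ∈ U, F w = 0) (v : V) : ∀ w ∈ U, dirDeriv v F w = 0 := by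
  intro w hw
  rw [dirDeriv_congr_of_isOpen hU (G := fun _ => 0) h v w hw, dirDeriv_const]

end DirDeriv

/-! ### Uniform families of symbols -/

section SymbolCalculus

variable {ι ι' X E : Type*} [NormedAddCommGroup X] [NormedSpace ℝ X]
  [NormedAddCommGroup E] [NormedSpace ℝ E]

/-- The estimates of order at most `L` which define symbols of order `m` and type `(ρ, δ)`,
uniformly over a family `a` of functions of `(x, Ξ)`. -/
def SymBound (ρ δ : ℝ) : ℕ → ℝ → (ι → X × E → ℂ) → Prop
  | 0, m, a => ∃ C : ℝ, ∀ i v, ‖a i v‖ ≤ C * (1 + ‖v.2‖) ^ m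
  | L + 1, m, a => (∃ C : ℝ, ∀ i v, ‖a i v‖ ≤ C * (1 + ‖v.2‖) ^ m) ∧
      (∀ e : X, SymBound ρ δ L (m + δ) fun i => dirDeriv (e, 0) (a i)) ∧
      ∀ u : E, SymBound ρ δ L (m - ρ) fun i => dirDeriv (0, u) (a i)

/-- A family of smooth functions of `(x, Ξ)` which are symbols of order `m` and type `(ρ, δ)`,
uniformly over the family. -/
structure IsSymFamily (ρ δ m : ℝ) (a : ι → X × E → ℂ) : Prop where
  smooth : ∀ i, ContDiff ℝ ∞ (a i)
  bound : ∀ L, SymBound ρ δ L m a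

variable {ρ δ m m' : ℝ} {a b : ι → X × E → ℂ}

theorem SymBound.base {L : ℕ} (h : SymBound ρ δ L m a) :
    ∃ C : ℝ, 0 ≤ C ∧ ∀ i v, ‖a i v‖ ≤ C * (1 + ‖v.2‖) ^ m := by
  obtain ⟨C, hC⟩ : ∃ C : ℝ, ∀ i v, ‖a i v‖ ≤ C * (1 + ‖v.2‖) ^ m := by
    cases L with
    | zero => exact h
    | succ L => exact h.1
  refine ⟨|C|, abs_nonneg C, fun i v => (hC i v).trans ?_⟩
  gcongr
  exact le_abs_self C

theorem SymBound.comp {L : ℕ} (h : SymBound ρ δ L m a) (σ : ι' → ι) :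
    SymBound ρ δ L m fun i => a (σ i) := by
  induction L generalizing m a with
  | zero => obtain ⟨C, hC⟩ := h; exact ⟨C, fun i v => hC _ v⟩
  | succ L ih =>
    obtain ⟨⟨C, hC⟩, h1, h2⟩ := h
    exact ⟨⟨C, fun i v => hC _ v⟩, fun e => ih (h1 e), fun u => ih (h2 u)⟩

theorem SymBound.of_succ {L : ℕ} (h : SymBound ρ δ (L + 1) m a) : SymBound ρ δ L m a := by
  induction L generalizing m a with
  | zero => exact h.1
  | succ L ih => exact ⟨h.1, fun e => ih (h.2.1 e), fun u => ih (h.2.2 u)⟩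

theorem SymBound.mono {L : ℕ} (h : SymBound ρ δ L m a) (hm : m ≤ m') : SymBound ρ δ L m' a := by
  have key : ∀ {m m' : ℝ} {a : ι → X × E → ℂ}, m ≤ m' →
      (∃ C : ℝ, 0 ≤ C ∧ ∀ i v, ‖a i v‖ ≤ C * (1 + ‖v.2‖) ^ m) →
      ∃ C : ℝ, ∀ i v, ‖a i v‖ ≤ C * (1 + ‖v.2‖) ^ m' := by
    rintro m m' a hm ⟨C, hC0, hC⟩
    refine ⟨C, fun i v => (hC i v).trans ?_⟩
    gcongr
    linarith [norm_nonneg v.2]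
  induction L generalizing m m' a with
  | zero => exact key hm h.base
  | succ L ih =>
    exact ⟨key hm h.base, fun e => ih (h.2.1 e) (by linarith), fun u => ih (h.2.2 u) (by linarith)⟩

theorem SymBound.add {L : ℕ} (h : SymBound ρ δ L m a) (h' : SymBound ρ δ L m b)
    (ha : ∀ i, ContDiff ℝ ∞ (a i)) (hb : ∀ i, ContDiff ℝ ∞ (b i)) :
    SymBound ρ δ L m fun i v => a i v + b i v := by
  have key : ∀ {m : ℝ} {a b : ι → X × E → ℂ},
      (∃ C : ℝ, 0 ≤ C ∧ ∀ i v, ‖a i v‖ ≤ C * (1 + ‖v.2‖) ^ m) →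
      (∃ C : ℝ, 0 ≤ C ∧ ∀ i v, ‖b i v‖ ≤ C * (1 + ‖v.2‖) ^ m) →
      ∃ C : ℝ, ∀ i v, ‖a i v + b i v‖ ≤ C * (1 + ‖v.2‖) ^ m := by
    rintro m a b ⟨C, -, hC⟩ ⟨C', -, hC'⟩
    refine ⟨C + C', fun i v => (norm_add_le _ _).trans ?_⟩
    rw [add_mul]
    exact add_le_add (hC i v) (hC' i v)
  induction L generalizing m a b with
  | zero => exact key h.base h'.base
  | succ L ih =>
    refine ⟨key h.base h'.base, fun e => ?_, fun u => ?_⟩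
    · simp only [dirDeriv_add (ha _) (hb _)]
      exact ih (h.2.1 e) (h'.2.1 e) (fun i => contDiff_dirDeriv (ha i) _)
        (fun i => contDiff_dirDeriv (hb i) _)
    · simp only [dirDeriv_add (ha _) (hb _)]
      exact ih (h.2.2 u) (h'.2.2 u) (fun i => contDiff_dirDeriv (ha i) _)
        (fun i => contDiff_dirDeriv (hb i) _)

theorem SymBound.mul {L : ℕ} (h : SymBound ρ δ L m a) (h' : SymBound ρ δ L m' b)
    (ha : ∀ i, ContDiff ℝ ∞ (a i)) (hb : ∀ i, ContDiff ℝ ∞ (b i)) :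
    SymBound ρ δ L (m + m') fun i v => a i v * b i v := by
  have key : ∀ {m m' : ℝ} {a b : ι → X × E → ℂ},
      (∃ C : ℝ, 0 ≤ C ∧ ∀ i v, ‖a i v‖ ≤ C * (1 + ‖v.2‖) ^ m) →
      (∃ C : ℝ, 0 ≤ C ∧ ∀ i v, ‖b i v‖ ≤ C * (1 + ‖v.2‖) ^ m') →
      ∃ C : ℝ, ∀ i v, ‖a i v * b i v‖ ≤ C * (1 + ‖v.2‖) ^ (m + m') := by
    rintro m m' a b ⟨C, hC0, hC⟩ ⟨C', -, hC'⟩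
    refine ⟨C * C', fun i v => ?_⟩
    have hpos : 0 < 1 + ‖v.2‖ := by positivity
    rw [norm_mul, Real.rpow_add hpos]
    calc ‖a i v‖ * ‖b i v‖ ≤ (C * (1 + ‖v.2‖) ^ m) * (C' * (1 + ‖v.2‖) ^ m') := by
          gcongr
          · exact hC i v
          · exact hC' i v
      _ = _ := by ring
  induction L generalizing m m' a b with
  | zero => exact key h.base h'.base
  | succ L ih =>
    refine ⟨key h.base h'.base, fun e => ?_, fun u => ?_⟩
    · simp only [dirDeriv_mul (ha _) (hb _)]
      refine SymBound.add ?_ ?_ (fun i => (contDiff_dirDeriv (ha i) _).mul (hb i))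
        (fun i => (ha i).mul (contDiff_dirDeriv (hb i) _))
      · exact (ih (h.2.1 e) h'.of_succ (fun i => contDiff_dirDeriv (ha i) _) hb).mono
          (by linarith)
      · exact (ih h.of_succ (h'.2.1 e) ha (fun i => contDiff_dirDeriv (hb i) _)).mono
          (by linarith)
    · simp only [dirDeriv_mul (ha _) (hb _)]
      refine SymBound.add ?_ ?_ (fun i => (contDiff_dirDeriv (ha i) _).mul (hb i))
        (fun i => (ha i).mul (contDiff_dirDeriv (hb i) _))
      · exact (ih (h.2.2 u) h'.of_succ (fun i => contDiff_dirDeriv (ha i) _) hb).mono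
          (by linarith)
      · exact (ih h.of_succ (h'.2.2 u) ha (fun i => contDiff_dirDeriv (hb i) _)).mono
          (by linarith)

theorem SymBound.zero (L : ℕ) (m : ℝ) : SymBound ρ δ L m fun (_ : ι) (_ : X × E) => (0 : ℂ) := by
  induction L generalizing m with
  | zero => exact ⟨0, fun _ v => by simp⟩
  | succ L ih =>
    refine ⟨⟨0, fun i v => by simp⟩, fun e => ?_, fun u => ?_⟩ <;>
    · simp only [dirDeriv_const]
      exact ih _

theorem IsSymFamily.comp (h : IsSymFamily ρ δ m a) (σ : ι' → ι) :
    IsSymFamily ρ δ m fun i => a (σ i) :=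
  ⟨fun _ => h.smooth _, fun L => (h.bound L).comp σ⟩

theorem IsSymFamily.mono (h : IsSymFamily ρ δ m a) (hm : m ≤ m') : IsSymFamily ρ δ m' a :=
  ⟨h.smooth, fun L => (h.bound L).mono hm⟩

theorem IsSymFamily.add (h : IsSymFamily ρ δ m a) (h' : IsSymFamily ρ δ m b) :
    IsSymFamily ρ δ m fun i v => a i v + b i v :=
  ⟨fun i => (h.smooth i).add (h'.smooth i),
    fun L => (h.bound L).add (h'.bound L) h.smooth h'.smooth⟩

theorem IsSymFamily.mul (h : IsSymFamily ρ δ m a) (h' : IsSymFamily ρ δ m' b) :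
    IsSymFamily ρ δ (m + m') fun i v => a i v * b i v :=
  ⟨fun i => (h.smooth i).mul (h'.smooth i),
    fun L => (h.bound L).mul (h'.bound L) h.smooth h'.smooth⟩

theorem IsSymFamily.dirDeriv_fst (h : IsSymFamily ρ δ m a) (e : X) :
    IsSymFamily ρ δ (m + δ) fun i => dirDeriv (e, 0) (a i) :=
  ⟨fun i => contDiff_dirDeriv (h.smooth i) _, fun L => (h.bound (L + 1)).2.1 e⟩

theorem IsSymFamily.dirDeriv_snd (h : IsSymFamily ρ δ m a) (u : E) :
    IsSymFamily ρ δ (m - ρ) fun i => dirDeriv (0, u) (a i) :=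
  ⟨fun i => contDiff_dirDeriv (h.smooth i) _, fun L => (h.bound (L + 1)).2.2 u⟩

theorem IsSymFamily.const (c : ℂ) :
    IsSymFamily ρ δ 0 fun (_ : ι) (_ : X × E) => c := by
  refine ⟨fun _ => contDiff_const, fun L => ?_⟩
  cases L with
  | zero => exact ⟨‖c‖, fun _ v => by simp⟩
  | succ L =>
    refine ⟨⟨‖c‖, fun i v => by simp⟩, fun e => ?_, fun u => ?_⟩ <;>
    · simp only [dirDeriv_const]
      exact SymBound.zero _ _

theorem IsSymFamily.const_mul (c : ℂ) (h : IsSymFamily ρ δ m a) :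
    IsSymFamily ρ δ m fun i v => c * a i v := by
  simpa using (IsSymFamily.const (ι := ι) (X := X) (E := E) (ρ := ρ) (δ := δ) c).mul h

theorem IsSymFamily.sub (h : IsSymFamily ρ δ m a) (h' : IsSymFamily ρ δ m b) :
    IsSymFamily ρ δ m fun i v => a i v - b i v := by
  simpa [sub_eq_add_neg] using h.add (h'.const_mul (-1))

/-- A linear function of the frequency variable is a symbol of order one. -/
theorem IsSymFamily.linear (hρ1 : ρ ≤ 1) (l : E →L[ℝ] ℝ) :
    IsSymFamily ρ δ 1 fun (_ : ι) (v : X × E) => ((l v.2 : ℝ) : ℂ) := by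
  have hsm : ContDiff ℝ ∞ fun v : X × E => ((l v.2 : ℝ) : ℂ) :=
    Complex.ofRealCLM.contDiff.comp (l.contDiff.comp contDiff_snd)
  have hd : ∀ e : X × E, dirDeriv e (fun v : X × E => ((l v.2 : ℝ) : ℂ)) =
      fun _ => ((l e.2 : ℝ) : ℂ) := by
    intro e
    funext w
    rw [dirDeriv_eq_fderiv (hsm.differentiable (by simp) w)]
    have : HasFDerivAt (fun v : X × E => ((l v.2 : ℝ) : ℂ))
        (Complex.ofRealCLM.comp (l.comp (ContinuousLinearMap.snd ℝ X E))) w :=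
      (Complex.ofRealCLM.comp (l.comp (ContinuousLinearMap.snd ℝ X E))).hasFDerivAt
    rw [this.fderiv]
    rfl
  have hb : ∃ C : ℝ, ∀ (i : ι) (v : X × E), ‖((l v.2 : ℝ) : ℂ)‖ ≤ C * (1 + ‖v.2‖) ^ (1 : ℝ) := by
    refine ⟨‖l‖, fun i v => ?_⟩
    rw [Complex.norm_real, Real.rpow_one]
    refine (l.le_opNorm _).trans ?_
    gcongr
    linarith
  refine ⟨fun _ => hsm, fun L => ?_⟩
  cases L with
  | zero => exact hb
  | succ L =>
    refine ⟨hb, fun e => ?_, fun u => ?_⟩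
    · simp only [hd, map_zero, Complex.ofReal_zero]
      exact SymBound.zero _ _
    · simp only [hd]
      exact ((IsSymFamily.const _).bound L).mono (by linarith)

end SymbolCalculus

/-! ### Cutoffs in the frequency variable -/

theorem exists_bound_one_add_norm_pow_mul {E : Type*} [NormedAddCommGroup E] (j : ℕ)
    {ψ : E → ℂ} (hψ : Continuous ψ) (hs : HasCompactSupport ψ) :
    ∃ C : ℝ, ∀ Ξ, (1 + ‖Ξ‖) ^ j * ‖ψ Ξ‖ ≤ C := by
  have hc : Continuous fun Ξ : E => (1 + ‖Ξ‖) ^ j * ‖ψ Ξ‖ :=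
    ((continuous_const.add continuous_norm).pow j).mul hψ.norm
  obtain ⟨C, hC⟩ := hc.bounded_above_of_compact_support hs.norm.mul_left
  exact ⟨C, fun Ξ => (le_abs_self _).trans (hC Ξ)⟩

section Cutoff

variable {ρ δ : ℝ} {X E : Type*} [NormedAddCommGroup X] [NormedSpace ℝ X]
  [NormedAddCommGroup E] [NormedSpace ℝ E]

/-- Rescalings `ψ(Ξ / R) / R ^ j`, `R ≥ 1`, of a test function `ψ` are symbols of order `-j ρ`. -/
theorem symBound_rescale (hρ1 : ρ ≤ 1) (L j : ℕ) {ψ : E → ℂ} (hψ : ContDiff ℝ ∞ ψ)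
    (hs : HasCompactSupport ψ) :
    SymBound ρ δ L (-(j * ρ)) fun (R : {R : ℝ // 1 ≤ R}) (v : X × E) =>
      ((R : ℝ) : ℂ)⁻¹ ^ j * ψ ((R : ℝ)⁻¹ • v.2) := by
  have hb : ∀ (j : ℕ) {ψ : E → ℂ}, ContDiff ℝ ∞ ψ → HasCompactSupport ψ →
      ∃ C : ℝ, ∀ (R : {R : ℝ // 1 ≤ R}) (v : X × E),
        ‖((R : ℝ) : ℂ)⁻¹ ^ j * ψ ((R : ℝ)⁻¹ • v.2)‖ ≤ C * (1 + ‖v.2‖) ^ (-(j * ρ)) := by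
    intro j ψ hψ hs
    obtain ⟨C, hC⟩ := exists_bound_one_add_norm_pow_mul j hψ.continuous hs
    refine ⟨C, fun R v => ?_⟩
    obtain ⟨R, hR⟩ := R
    have hR0 : 0 < R := by linarith
    have h1 := hC (R⁻¹ • v.2)
    have hC0 : 0 ≤ C := le_trans (by positivity) h1
    rw [norm_smul, norm_inv, Real.norm_of_nonneg hR0.le] at h1
    simp only [norm_mul, norm_pow, norm_inv, Complex.norm_real, Real.norm_of_nonneg hR0.le]
    have hle : (1 + ‖v.2‖) ≤ R * (1 + R⁻¹ * ‖v.2‖) := by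
      rw [mul_add, ← mul_assoc, mul_inv_cancel₀ hR0.ne']; linarith
    have hp : (1 + ‖v.2‖) ^ ((j : ℝ) * ρ) ≤ (R * (1 + R⁻¹ * ‖v.2‖)) ^ j := by
      calc (1 + ‖v.2‖) ^ ((j : ℝ) * ρ) ≤ (1 + ‖v.2‖) ^ (j : ℝ) := by
            apply Real.rpow_le_rpow_of_exponent_le (by linarith [norm_nonneg v.2])
            exact mul_le_of_le_one_right (Nat.cast_nonneg j) hρ1
        _ = (1 + ‖v.2‖) ^ j := Real.rpow_natCast _ _
        _ ≤ _ := by gcongr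
    rw [Real.rpow_neg (by positivity), ← div_eq_mul_inv, le_div_iff₀ (by positivity)]
    calc R⁻¹ ^ j * ‖ψ (R⁻¹ • v.2)‖ * (1 + ‖v.2‖) ^ ((j : ℝ) * ρ)
        ≤ R⁻¹ ^ j * ‖ψ (R⁻¹ • v.2)‖ * (R * (1 + R⁻¹ * ‖v.2‖)) ^ j := by gcongr
      _ = (R⁻¹ * R) ^ j * ((1 + R⁻¹ * ‖v.2‖) ^ j * ‖ψ (R⁻¹ • v.2)‖) := by
          rw [mul_pow, mul_pow]; ring
      _ ≤ C := by rw [inv_mul_cancel₀ hR0.ne', one_pow, one_mul]; exact h1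
  induction L generalizing j ψ with
  | zero => exact hb j hψ hs
  | succ L ih =>
    have hd : ∀ (R : {R : ℝ // 1 ≤ R}) (e : X × E),
        dirDeriv e (fun v : X × E => ((R : ℝ) : ℂ)⁻¹ ^ j * ψ ((R : ℝ)⁻¹ • v.2)) =
          fun v => ((R : ℝ) : ℂ)⁻¹ ^ (j + 1) * dirDeriv e.2 ψ ((R : ℝ)⁻¹ • v.2) := by
      intro R e
      have hsm : ContDiff ℝ ∞ fun v : X × E => ψ ((R : ℝ)⁻¹ • v.2) :=
        hψ.comp (contDiff_snd.const_smul _)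
      rw [dirDeriv_const_mul _ hsm]
      funext v
      rw [dirDeriv_eq_fderiv (hsm.differentiable (by simp) v),
        dirDeriv_eq_fderiv (hψ.differentiable (by simp) _)]
      have h1 : HasFDerivAt (fun v : X × E => ψ ((R : ℝ)⁻¹ • v.2))
          ((fderiv ℝ ψ ((R : ℝ)⁻¹ • v.2)).comp ((R : ℝ)⁻¹ • ContinuousLinearMap.snd ℝ X E)) v :=
        (hψ.differentiable (by simp) _).hasFDerivAt.comp v
          ((R : ℝ)⁻¹ • ContinuousLinearMap.snd ℝ X E).hasFDerivAt
      rw [h1.fderiv]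
      simp only [ContinuousLinearMap.comp_apply, smul_apply,
        ContinuousLinearMap.coe_snd', map_smul, Complex.real_smul, Complex.ofReal_inv]
      ring
    refine ⟨hb j hψ hs, fun e => ?_, fun u => ?_⟩
    · have h0 : dirDeriv (0 : E) ψ = fun _ => 0 := by
        rw [dirDeriv_eq_fderiv_fun hψ]; simp
      simp only [hd, h0, mul_zero]
      exact SymBound.zero _ _
    · simp only [hd]
      have hcs : HasCompactSupport (dirDeriv u ψ) := by
        rw [dirDeriv_eq_fderiv_fun hψ]
        exact hs.fderiv_apply ℝ u
      have := ih (j + 1) (contDiff_dirDeriv hψ u) hcs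
      refine this.mono ?_
      push_cast
      linarith

variable [FiniteDimensional ℝ E]

/-- A fixed smooth bump function on the frequency space. -/
noncomputable def freqBump (E : Type*) [NormedAddCommGroup E] [NormedSpace ℝ E]
    [FiniteDimensional ℝ E] : ContDiffBump (0 : E) :=
  ⟨1, 2, one_pos, one_lt_two⟩

/-- A smooth cutoff equal to `1` for `‖Ξ‖ ≤ R` and to `0` for `‖Ξ‖ ≥ 2 R`. -/
noncomputable def freqCutoff (R : ℝ) (Ξ : E) : ℂ := ((freqBump E (R⁻¹ • Ξ) : ℝ) : ℂ)

theorem contDiff_freqCutoff (R : ℝ) : ContDiff ℝ ∞ (freqCutoff (E := E) R) :=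
  Complex.ofRealCLM.contDiff.comp
    (((freqBump E).contDiff (n := ⊤)).comp (contDiff_id.const_smul R⁻¹))

theorem norm_freqCutoff_le_one (R : ℝ) (Ξ : E) : ‖freqCutoff R Ξ‖ ≤ 1 := by
  rw [freqCutoff, Complex.norm_real, Real.norm_of_nonneg (freqBump E).nonneg]
  exact (freqBump E).le_one

theorem freqCutoff_eq_one {R : ℝ} (hR : 0 < R) {Ξ : E} (h : ‖Ξ‖ ≤ R) : freqCutoff R Ξ = 1 := by
  rw [freqCutoff, (freqBump E).one_of_mem_closedBall]
  · simp
  · rw [mem_closedBall_zero_iff, norm_smul, norm_inv, Real.norm_of_nonneg hR.le]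
    change R⁻¹ * ‖Ξ‖ ≤ 1
    rw [inv_mul_le_iff₀ hR]
    linarith

theorem freqCutoff_eq_zero {R : ℝ} (hR : 0 < R) {Ξ : E} (h : 2 * R ≤ ‖Ξ‖) :
    freqCutoff R Ξ = 0 := by
  rw [freqCutoff, (freqBump E).zero_of_le_dist]
  · simp
  · rw [dist_zero_right, norm_smul, norm_inv, Real.norm_of_nonneg hR.le]
    change 2 ≤ R⁻¹ * ‖Ξ‖
    rw [le_inv_mul_iff₀ hR]
    linarith

/-- The cutoffs `freqCutoff R`, `R ≥ 1`, are uniformly symbols of order zero. -/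
theorem isSymFamily_freqCutoff (hρ1 : ρ ≤ 1) :
    IsSymFamily ρ δ 0 fun (R : {R : ℝ // 1 ≤ R}) (v : X × E) => freqCutoff (R : ℝ) v.2 := by
  refine ⟨fun R => (contDiff_freqCutoff _).comp contDiff_snd, fun L => ?_⟩
  have hcs : HasCompactSupport fun Ξ : E => ((freqBump E Ξ : ℝ) : ℂ) :=
    (freqBump E).hasCompactSupport.comp_left Complex.ofReal_zero
  have := symBound_rescale (X := X) (δ := δ) hρ1 L 0
    (ψ := fun Ξ : E => ((freqBump E Ξ : ℝ) : ℂ))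
    (Complex.ofRealCLM.contDiff.comp (freqBump E).contDiff) hcs
  simpa [freqCutoff] using this

end Cutoff


/-! ### From bilinear symbols to symbol families -/

section Bridge

theorem contDiff_dirDeriv_iterate {V : Type*} [NormedAddCommGroup V] [NormedSpace ℝ V]
    {F : V → ℂ} (hF : ContDiff ℝ ∞ F) (v : V) (k : ℕ) : ContDiff ℝ ∞ ((dirDeriv v)^[k] F) := by
  induction k with
  | zero => exact hF
  | succ k ih => rw [Function.iterate_succ_apply']; exact contDiff_dirDeriv ih v

theorem dirDeriv_iterate_comm {V : Type*} [NormedAddCommGroup V] [NormedSpace ℝ V]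
    {F : V → ℂ} (hF : ContDiff ℝ ∞ F) (u v : V) (k : ℕ) :
    (dirDeriv v)^[k] (dirDeriv u F) = dirDeriv u ((dirDeriv v)^[k] F) := by
  induction k with
  | zero => rfl
  | succ k ih =>
    rw [Function.iterate_succ_apply', Function.iterate_succ_apply', ih,
      dirDeriv_comm (contDiff_dirDeriv_iterate hF v k)]

variable {V : Type*} [NormedAddCommGroup V] [NormedSpace ℝ V] {n : ℕ}

theorem contDiff_foldr_dirDeriv (v : Fin n → V) (α : Fin n → ℕ) {F : V → ℂ}
    (hF : ContDiff ℝ ∞ F) (l : List (Fin n)) :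
    ContDiff ℝ ∞ (l.foldr (fun i G => (dirDeriv (v i))^[α i] G) F) := by
  induction l with
  | nil => exact hF
  | cons i l ih => exact contDiff_dirDeriv_iterate ih _ _

theorem contDiff_multiDeriv (v : Fin n → V) (α : Fin n → ℕ) {F : V → ℂ} (hF : ContDiff ℝ ∞ F) :
    ContDiff ℝ ∞ (multiDeriv v α F) :=
  contDiff_foldr_dirDeriv v α hF _

theorem multiDeriv_dirDeriv (v : Fin n → V) (α : Fin n → ℕ) {F : V → ℂ} (hF : ContDiff ℝ ∞ F)
    (u : V) : multiDeriv v α (dirDeriv u F) = dirDeriv u (multiDeriv v α F) := by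
  unfold multiDeriv
  induction List.finRange n with
  | nil => rfl
  | cons i l ih =>
    rw [List.foldr_cons, List.foldr_cons, ih,
      dirDeriv_iterate_comm (contDiff_foldr_dirDeriv v α hF l)]

theorem foldr_dirDeriv_add_single (v : Fin n → V) (α : Fin n → ℕ) {F : V → ℂ}
    (hF : ContDiff ℝ ∞ F) (i : Fin n) (l : List (Fin n)) (hl : l.Nodup) (hi : i ∈ l) :
    l.foldr (fun j G => (dirDeriv (v j))^[(α + Pi.single i 1 : Fin n → ℕ) j] G) F =
      dirDeriv (v i) (l.foldr (fun j G => (dirDeriv (v j))^[α j] G) F) := by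
  induction l with
  | nil => simp at hi
  | cons j l ih =>
    rw [List.nodup_cons] at hl
    rw [List.foldr_cons, List.foldr_cons]
    have hsm := contDiff_foldr_dirDeriv v α hF l
    by_cases hij : i = j
    · subst hij
      have hcongr : l.foldr (fun j G => (dirDeriv (v j))^[(α + Pi.single i 1 : Fin n → ℕ) j] G) F =
          l.foldr (fun j G => (dirDeriv (v j))^[α j] G) F := by
        apply List.foldr_ext
        intro j hj G
        have : j ≠ i := fun h => hl.1 (h ▸ hj)
        simp [this]
      rw [hcongr]
      simp only [Pi.add_apply, Pi.single_eq_same]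
      rw [Function.iterate_succ_apply']
    · rw [ih hl.2 (List.mem_of_ne_of_mem hij hi)]
      have : j ≠ i := fun h => hij h.symm
      simp only [Pi.add_apply, Pi.single_eq_of_ne this, add_zero]
      rw [dirDeriv_iterate_comm hsm]

theorem multiDeriv_add_single (v : Fin n → V) (α : Fin n → ℕ) {F : V → ℂ} (hF : ContDiff ℝ ∞ F)
    (i : Fin n) :
    multiDeriv v (α + Pi.single i 1) F = dirDeriv (v i) (multiDeriv v α F) :=
  foldr_dirDeriv_add_single v α hF i _ (List.nodup_finRange n) (List.mem_finRange i)

theorem multiDeriv_zero (v : Fin n → V) (F : V → ℂ) : multiDeriv v 0 F = F := by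
  unfold multiDeriv
  induction List.finRange n with
  | nil => rfl
  | cons i l ih => rw [List.foldr_cons, ih]; rfl

theorem len_add_single (α : Fin n → ℕ) (i : Fin n) : len (α + Pi.single i 1) = len α + 1 := by
  simp [len, Finset.sum_add_distrib]

variable {m ρ δ : ℝ} {p : Rn3 n → ℂ}

theorem IsBSSymbol.dirDeriv_one (hp : IsBSSymbol m ρ δ p) (i : Fin n) :
    IsBSSymbol (m + δ) ρ δ (dirDeriv ((unitVec i, 0, 0) : Rn3 n) p) := by
  refine ⟨contDiff_dirDeriv hp.1 _, fun α β γ => ?_⟩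
  obtain ⟨C, hC0, hC⟩ := hp.2 (α + Pi.single i 1) β γ
  refine ⟨C, hC0, fun x ξ η => ?_⟩
  have h := hC x ξ η
  rw [mixedDeriv,
    multiDeriv_add_single _ _ (contDiff_multiDeriv _ _ (contDiff_multiDeriv _ _ hp.1)),
    len_add_single] at h
  rw [mixedDeriv, multiDeriv_dirDeriv _ _ hp.1,
    multiDeriv_dirDeriv _ _ (contDiff_multiDeriv _ _ hp.1),
    multiDeriv_dirDeriv _ _ (contDiff_multiDeriv _ _ (contDiff_multiDeriv _ _ hp.1))]
  refine h.trans_eq ?_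
  congr 2
  push_cast
  ring

theorem IsBSSymbol.dirDeriv_two (hp : IsBSSymbol m ρ δ p) (i : Fin n) :
    IsBSSymbol (m - ρ) ρ δ (dirDeriv ((0, unitVec i, 0) : Rn3 n) p) := by
  refine ⟨contDiff_dirDeriv hp.1 _, fun α β γ => ?_⟩
  obtain ⟨C, hC0, hC⟩ := hp.2 α (β + Pi.single i 1) γ
  refine ⟨C, hC0, fun x ξ η => ?_⟩
  have h := hC x ξ η
  rw [mixedDeriv, multiDeriv_add_single _ _ (contDiff_multiDeriv _ _ hp.1),
    len_add_single] at h
  rw [mixedDeriv, multiDeriv_dirDeriv _ _ hp.1]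
  rw [multiDeriv_dirDeriv _ _ (contDiff_multiDeriv _ _ hp.1)]
  refine h.trans_eq ?_
  congr 2
  push_cast
  ring

theorem IsBSSymbol.dirDeriv_three (hp : IsBSSymbol m ρ δ p) (i : Fin n) :
    IsBSSymbol (m - ρ) ρ δ (dirDeriv ((0, 0, unitVec i) : Rn3 n) p) := by
  refine ⟨contDiff_dirDeriv hp.1 _, fun α β γ => ?_⟩
  obtain ⟨C, hC0, hC⟩ := hp.2 α β (γ + Pi.single i 1)
  refine ⟨C, hC0, fun x ξ η => ?_⟩
  have h := hC x ξ η
  rw [mixedDeriv, multiDeriv_add_single _ _ hp.1, len_add_single] at h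
  rw [mixedDeriv, multiDeriv_dirDeriv _ _ hp.1]
  refine h.trans_eq ?_
  congr 2
  push_cast
  ring

theorem eq_sum_smul_unitVec (x : Rn n) : x = ∑ i, x i • unitVec i := by
  have h := (EuclideanSpace.basisFun (Fin n) ℝ).sum_repr x
  simpa [unitVec] using h.symm

theorem rpow_one_add_add_le (r s t : ℝ) (hs : 0 ≤ s) (ht : 0 ≤ t) :
    (1 + s + t) ^ r ≤ 2 ^ |r| * (1 + max s t) ^ r := by
  have h1 : 1 + max s t ≤ 1 + s + t := by
    rcases max_cases s t with h | h <;> rw [h.1] <;> linarith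
  have h2 : 1 + s + t ≤ 2 * (1 + max s t) := by
    linarith [le_max_left s t, le_max_right s t]
  have h0 : 0 < 1 + max s t := by linarith [le_max_left s t]
  rcases le_total 0 r with hr | hr
  · rw [abs_of_nonneg hr, ← Real.mul_rpow (by norm_num) h0.le]
    exact Real.rpow_le_rpow (by positivity) h2 hr
  · calc (1 + s + t) ^ r ≤ (1 + max s t) ^ r := Real.rpow_le_rpow_of_nonpos h0 h1 hr
      _ ≤ 2 ^ |r| * (1 + max s t) ^ r :=
        le_mul_of_one_le_left (by positivity) (Real.one_le_rpow (by norm_num) (abs_nonneg r))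

theorem SymBound.finset_sum {ι X E J : Type*} [NormedAddCommGroup X] [NormedSpace ℝ X]
    [NormedAddCommGroup E] [NormedSpace ℝ E] {L : ℕ} (s : Finset J) {a : J → ι → X × E → ℂ}
    (ha : ∀ j i, ContDiff ℝ ∞ (a j i)) (h : ∀ j, SymBound ρ δ L m (a j)) :
    SymBound ρ δ L m fun i v => ∑ j ∈ s, a j i v := by
  classical
  induction s using Finset.induction_on with
  | empty => simpa using SymBound.zero L m
  | insert j s hj ih =>
    simp only [Finset.sum_insert hj]
    exact (h j).add ih (ha j) fun i => ContDiff.sum fun k _ => ha k i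

/-- A bilinear symbol obeys the symbol estimates with respect to `x` and `(ξ, η)`. -/
theorem IsBSSymbol.symBound (L : ℕ) (hp : IsBSSymbol m ρ δ p) :
    SymBound ρ δ L m fun (_ : Unit) (v : Rn n × (Rn n × Rn n)) => p v := by
  have hb : ∀ {m : ℝ} {p : Rn3 n → ℂ}, IsBSSymbol m ρ δ p →
      ∃ C : ℝ, ∀ (_ : Unit) (v : Rn n × (Rn n × Rn n)), ‖p v‖ ≤ C * (1 + ‖v.2‖) ^ m := by
    intro m p hp
    obtain ⟨C, hC0, hC⟩ := hp.2 0 0 0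
    refine ⟨C * 2 ^ |m|, fun _ v => ?_⟩
    obtain ⟨x, ξ, η⟩ := v
    have h := hC x ξ η
    simp only [mixedDeriv, multiDeriv_zero] at h
    have e : m + δ * ((len (0 : Fin n → ℕ) : ℕ) : ℝ) -
        ρ * (((len (0 : Fin n → ℕ) : ℕ) : ℝ) + ((len (0 : Fin n → ℕ) : ℕ) : ℝ)) = m := by
      simp [len]
    rw [e] at h
    refine h.trans ?_
    rw [mul_assoc]
    gcongr
    exact rpow_one_add_add_le m _ _ (norm_nonneg _) (norm_nonneg _)
  induction L generalizing m p with
  | zero => exact hb hp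
  | succ L ih =>
    refine ⟨hb hp, fun e => ?_, fun u => ?_⟩
    · have he : ((e, 0) : Rn n × (Rn n × Rn n)) =
          ∑ i, e i • ((unitVec i, 0, 0) : Rn n × (Rn n × Rn n)) := by
        conv_lhs => rw [eq_sum_smul_unitVec e]
        ext <;> simp [Prod.fst_sum, Prod.snd_sum]
      rw [he]
      simp only [dirDeriv_sum_smul _ _ _ hp.1]
      refine SymBound.finset_sum _ (fun i _ => contDiff_const.mul (contDiff_dirDeriv hp.1 _))
        fun i => ?_
      have := (IsSymFamily.const (ι := Unit) (X := Rn n) (E := Rn n × Rn n) (ρ := ρ) (δ := δ)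
        (e i : ℂ)).bound L |>.mul (ih (hp.dirDeriv_one i)) (fun _ => contDiff_const)
        (fun _ => contDiff_dirDeriv hp.1 _)
      simpa using this
    · have he : ((0, u) : Rn n × (Rn n × Rn n)) =
          ∑ i, u.1 i • ((0, unitVec i, 0) : Rn n × (Rn n × Rn n)) +
          ∑ i, u.2 i • ((0, 0, unitVec i) : Rn n × (Rn n × Rn n)) := by
        obtain ⟨u1, u2⟩ := u
        conv_lhs => rw [eq_sum_smul_unitVec u1, eq_sum_smul_unitVec u2]
        ext <;> simp [Prod.fst_sum, Prod.snd_sum]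
      have hadd : dirDeriv ((0, u) : Rn n × (Rn n × Rn n)) p = fun v =>
          ∑ i, (u.1 i : ℂ) * dirDeriv ((0, unitVec i, 0) : Rn n × (Rn n × Rn n)) p v +
          ∑ i, (u.2 i : ℂ) * dirDeriv ((0, 0, unitVec i) : Rn n × (Rn n × Rn n)) p v := by
        rw [he]
        simp only [dirDeriv_eq_fderiv_fun hp.1, map_add]
        funext w
        simp only [map_sum, map_smul, Complex.real_smul]
      simp only [hadd]
      have hsm : ∀ (c : ℂ) (v : Rn n × (Rn n × Rn n)),
          ContDiff ℝ ∞ fun w => c * dirDeriv v p w :=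
        fun c v => contDiff_const.mul (contDiff_dirDeriv hp.1 _)
      refine SymBound.add ?_ ?_ (fun _ => ContDiff.sum fun i _ => hsm _ _)
        (fun _ => ContDiff.sum fun i _ => hsm _ _)
      · refine SymBound.finset_sum _ (fun i _ => hsm _ _) fun i => ?_
        have := (IsSymFamily.const (ι := Unit) (X := Rn n) (E := Rn n × Rn n) (ρ := ρ) (δ := δ)
          (u.1 i : ℂ)).bound L |>.mul (ih (hp.dirDeriv_two i)) (fun _ => contDiff_const)
          (fun _ => contDiff_dirDeriv hp.1 _)
        simpa using this
      · refine SymBound.finset_sum _ (fun i _ => hsm _ _) fun i => ?_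
        have := (IsSymFamily.const (ι := Unit) (X := Rn n) (E := Rn n × Rn n) (ρ := ρ) (δ := δ)
          (u.2 i : ℂ)).bound L |>.mul (ih (hp.dirDeriv_three i)) (fun _ => contDiff_const)
          (fun _ => contDiff_dirDeriv hp.1 _)
        simpa using this

theorem IsBSSymbol.isSymFamily (hp : IsBSSymbol m ρ δ p) :
    IsSymFamily ρ δ m fun (_ : Unit) (v : Rn n × (Rn n × Rn n)) => p v :=
  ⟨fun _ => hp.1, fun L => hp.symBound L⟩

end Bridge


/-! ### Integrals of powers of `1 + ‖Ξ‖` -/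

section PowerIntegrals

open Set

variable {E : Type*} [NormedAddCommGroup E] [NormedSpace ℝ E] [FiniteDimensional ℝ E]
  [MeasureSpace E] [BorelSpace E] [(volume : Measure E).IsAddHaarMeasure]

theorem hasDerivAt_one_add_rpow {p t : ℝ} (hp : p ≠ 0) (ht : 0 ≤ t) :
    HasDerivAt (fun t : ℝ => (1 + t) ^ p / p) ((1 + t) ^ (p - 1)) t := by
  have h1 : HasDerivAt (fun t : ℝ => 1 + t) 1 t := (hasDerivAt_id t).const_add 1
  have h := (h1.rpow_const (p := p) (Or.inl (by linarith))).div_const p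
  refine h.congr_deriv ?_
  rw [one_mul, mul_div_cancel_left₀ _ hp]

theorem rpow_mul_one_add_rpow_le {d : ℕ} (hd : 0 < d) (r : ℝ) {t : ℝ} (ht : 0 ≤ t) :
    t ^ (d - 1) * (1 + t) ^ r ≤ (1 + t) ^ (r + d - 1) := by
  have h : (1 + t) ^ (r + d - 1) = (1 + t) ^ (d - 1) * (1 + t) ^ r := by
    rw [← Real.rpow_natCast, ← Real.rpow_add (by linarith)]
    congr 1
    push_cast [Nat.cast_sub (Nat.one_le_of_lt hd)]
    ring
  rw [h]
  gcongr
  linarith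

/-- Polar coordinates for a truncated power of `1 + ‖Ξ‖`. -/
theorem setIntegral_one_add_norm_le [Nontrivial E] (r : ℝ) {s : Set ℝ} (hs : MeasurableSet s)
    (hint : IntegrableOn (fun t : ℝ => (1 + t) ^ (r + Module.finrank ℝ E - 1)) (Ioi 0 ∩ s)) :
    ∫ Ξ in {Ξ : E | ‖Ξ‖ ∈ s}, (1 + ‖Ξ‖) ^ r ≤
      Module.finrank ℝ E * (volume.real (Metric.ball (0 : E) 1) *
        ∫ t in Ioi 0 ∩ s, (1 + t) ^ (r + Module.finrank ℝ E - 1)) := by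
  have hms : MeasurableSet {Ξ : E | ‖Ξ‖ ∈ s} := measurable_norm hs
  rw [← integral_indicator hms]
  have e : (fun Ξ : E => indicator {Ξ : E | ‖Ξ‖ ∈ s} (fun Ξ => (1 + ‖Ξ‖) ^ r) Ξ) =
      fun Ξ => (indicator s fun t : ℝ => (1 + t) ^ r) ‖Ξ‖ := by
    funext Ξ
    by_cases h : ‖Ξ‖ ∈ s
    · rw [indicator_of_mem h, indicator_of_mem (by exact h)]
    · rw [indicator_of_notMem h, indicator_of_notMem (by exact h)]
  rw [e, integral_fun_norm_addHaar, nsmul_eq_mul, smul_eq_mul]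
  gcongr
  rw [← integral_indicator measurableSet_Ioi, ← integral_indicator (measurableSet_Ioi.inter hs)]
  refine integral_mono_of_nonneg (Filter.Eventually.of_forall fun t => ?_)
    (hint.integrable_indicator (measurableSet_Ioi.inter hs))
    (Filter.Eventually.of_forall fun t => ?_)
  · refine indicator_nonneg (fun t (ht : 0 < t) => ?_) t
    refine smul_nonneg (by positivity) ?_
    by_cases hts : t ∈ s
    · rw [indicator_of_mem hts]; positivity
    · rw [indicator_of_notMem hts]
  · by_cases ht : 0 < t
    · by_cases hts : t ∈ s
      · simp only [indicator_of_mem (show t ∈ Ioi (0 : ℝ) from ht), indicator_of_mem hts,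
          indicator_of_mem (show t ∈ Ioi (0 : ℝ) ∩ s from ⟨ht, hts⟩), smul_eq_mul]
        exact rpow_mul_one_add_rpow_le Module.finrank_pos r (le_of_lt ht)
      · simp [indicator_apply, hts]
    · simp [indicator_of_notMem (show t ∉ Ioi (0 : ℝ) from ht),
        indicator_of_notMem (show t ∉ Ioi (0 : ℝ) ∩ s from fun h => ht h.1)]

theorem integrable_one_add_norm_rpow {r : ℝ} (hr : r + Module.finrank ℝ E < 0) :
    Integrable fun Ξ : E => (1 + ‖Ξ‖) ^ r := by
  simpa using integrable_one_add_norm (E := E) (μ := volume) (r := -r) (by linarith)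

theorem tendsto_one_add_rpow_div {p : ℝ} (hp : p < 0) :
    Filter.Tendsto (fun t : ℝ => (1 + t) ^ p / p) Filter.atTop (nhds 0) := by
  have h : Filter.Tendsto (fun t : ℝ => (1 + t) ^ (-(-p))) Filter.atTop (nhds 0) :=
    (tendsto_rpow_neg_atTop (y := -p) (by linarith)).comp
      (Filter.tendsto_atTop_add_const_left _ 1 Filter.tendsto_id)
  simpa using h.div_const p

/-- The tail of a convergent power integral. -/
theorem exists_integral_tail_le [Nontrivial E] {r : ℝ} (hr : r + Module.finrank ℝ E < 0) :
    ∃ C : ℝ, 0 ≤ C ∧ ∀ R : ℝ, 1 ≤ R →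
      ∫ Ξ in {Ξ : E | R ≤ ‖Ξ‖}, (1 + ‖Ξ‖) ^ r ≤ C * R ^ (r + Module.finrank ℝ E) := by
  set d : ℝ := ((Module.finrank ℝ E : ℕ) : ℝ) with hd
  refine ⟨d * (volume.real (Metric.ball (0 : E) 1) * (-(r + d))⁻¹), ?_, fun R hR => ?_⟩
  · have : 0 ≤ (-(r + d))⁻¹ := inv_nonneg.2 (by linarith)
    positivity
  have hset : Ioi (0 : ℝ) ∩ Ici R = Ici R := by
    apply inter_eq_right.2
    intro t ht
    exact lt_of_lt_of_le (show (0 : ℝ) < R by linarith) ht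
  have hderiv : ∀ t ∈ Ici R, HasDerivAt (fun t : ℝ => (1 + t) ^ (r + d) / (r + d))
      ((1 + t) ^ (r + d - 1)) t := fun t ht =>
    hasDerivAt_one_add_rpow hr.ne (le_trans (by linarith) (show R ≤ t from ht))
  have hpos : ∀ t ∈ Ioi R, 0 ≤ (1 + t) ^ (r + d - 1) := fun t ht =>
    Real.rpow_nonneg (by linarith [show R < t from ht]) _
  have hint := integrableOn_Ioi_deriv_of_nonneg' hderiv hpos (tendsto_one_add_rpow_div hr)
  have hval := integral_Ioi_of_hasDerivAt_of_nonneg' hderiv hpos (tendsto_one_add_rpow_div hr)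
  have h := setIntegral_one_add_norm_le (E := E) r (s := Ici R) measurableSet_Ici (by
    rw [hset, ← hd, integrableOn_Ici_iff_integrableOn_Ioi]
    exact hint)
  rw [hset, ← hd, integral_Ici_eq_integral_Ioi, hval] at h
  refine h.trans ?_
  rw [mul_assoc, mul_assoc]
  have h1 : (1 + R) ^ (r + d) ≤ R ^ (r + d) :=
    Real.rpow_le_rpow_of_nonpos (by linarith) (by linarith) hr.le
  have h2 : 0 - (1 + R) ^ (r + d) / (r + d) = (-(r + d))⁻¹ * (1 + R) ^ (r + d) := by
    rw [inv_neg]; ring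
  rw [h2]
  gcongr
  exact inv_nonneg.2 (by linarith)

theorem setIntegral_ball_one_add_norm_le [Nontrivial E] (r R : ℝ) :
    ∫ Ξ in {Ξ : E | ‖Ξ‖ ≤ 2 * R}, (1 + ‖Ξ‖) ^ r ≤
      Module.finrank ℝ E * (volume.real (Metric.ball (0 : E) 1) *
        ∫ t in Ioc 0 (2 * R), (1 + t) ^ (r + Module.finrank ℝ E - 1)) := by
  have hset : Ioi (0 : ℝ) ∩ Iic (2 * R) = Ioc 0 (2 * R) := rfl
  have hc : ContinuousOn (fun t : ℝ => (1 + t) ^ (r + Module.finrank ℝ E - 1)) (Icc 0 (2 * R)) := by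
    refine ContinuousOn.rpow_const (by fun_prop) fun t ht => Or.inl ?_
    linarith [ht.1]
  have h := setIntegral_one_add_norm_le (E := E) r (s := Iic (2 * R)) measurableSet_Iic (by
    rw [hset]
    exact (hc.integrableOn_compact isCompact_Icc).mono_set Ioc_subset_Icc_self)
  exact h

theorem exists_integral_ball_le [Nontrivial E] {r : ℝ} (hr : 0 < r + Module.finrank ℝ E) :
    ∃ C : ℝ, 0 ≤ C ∧ ∀ R : ℝ, 1 ≤ R →
      ∫ Ξ in {Ξ : E | ‖Ξ‖ ≤ 2 * R}, (1 + ‖Ξ‖) ^ r ≤ C * R ^ (r + Module.finrank ℝ E) := by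
  set d : ℝ := ((Module.finrank ℝ E : ℕ) : ℝ) with hd
  refine ⟨d * (volume.real (Metric.ball (0 : E) 1) * (3 ^ (r + d) * (r + d)⁻¹)), by positivity,
    fun R hR => (setIntegral_ball_one_add_norm_le r R).trans ?_⟩
  rw [← hd, ← intervalIntegral.integral_of_le (by linarith),
    intervalIntegral.integral_eq_sub_of_hasDerivAt
      (f := fun t : ℝ => (1 + t) ^ (r + d) / (r + d))]
  · rw [mul_assoc, mul_assoc]
    gcongr
    have h1 : (1 + 2 * R) ^ (r + d) ≤ 3 ^ (r + d) * R ^ (r + d) := by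
      rw [← Real.mul_rpow (by norm_num) (by linarith)]
      exact Real.rpow_le_rpow (by linarith) (by linarith) hr.le
    have h2 : 0 ≤ (1 + (0 : ℝ)) ^ (r + d) / (r + d) := by positivity
    calc (1 + 2 * R) ^ (r + d) / (r + d) - (1 + 0) ^ (r + d) / (r + d)
        ≤ (1 + 2 * R) ^ (r + d) / (r + d) := by linarith
      _ ≤ 3 ^ (r + d) * R ^ (r + d) / (r + d) := by gcongr
      _ = _ := by ring
  · intro t ht
    rw [uIcc_of_le (by linarith)] at ht
    exact hasDerivAt_one_add_rpow hr.ne' ht.1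
  · refine ContinuousOn.intervalIntegrable ?_
    refine ContinuousOn.rpow_const (by fun_prop) fun t ht => Or.inl ?_
    rw [uIcc_of_le (by linarith)] at ht
    linarith [ht.1]

theorem exists_integral_ball_le_log [Nontrivial E] {r : ℝ} (hr : r + Module.finrank ℝ E = 0) :
    ∃ C : ℝ, 0 ≤ C ∧ ∀ R : ℝ, 1 ≤ R →
      ∫ Ξ in {Ξ : E | ‖Ξ‖ ≤ 2 * R}, (1 + ‖Ξ‖) ^ r ≤ C * (1 + Real.log R) := by
  set d : ℝ := ((Module.finrank ℝ E : ℕ) : ℝ) with hd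
  refine ⟨d * (volume.real (Metric.ball (0 : E) 1) * 2), by positivity,
    fun R hR => (setIntegral_ball_one_add_norm_le r R).trans ?_⟩
  rw [← hd, ← intervalIntegral.integral_of_le (by linarith), hr,
    intervalIntegral.integral_eq_sub_of_hasDerivAt (f := fun t : ℝ => Real.log (1 + t))]
  · rw [mul_assoc, mul_assoc]
    gcongr
    have h1 : Real.log (1 + 2 * R) ≤ Real.log 3 + Real.log R := by
      rw [← Real.log_mul (by norm_num) (by linarith)]
      exact Real.log_le_log (by linarith) (by linarith)
    have h3 : Real.log 3 ≤ 2 := by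
      have := Real.log_le_sub_one_of_pos (show (0 : ℝ) < 3 by norm_num)
      linarith
    have h4 := Real.log_nonneg hR
    simp only [add_zero, Real.log_one, sub_zero]
    linarith
  · intro t ht
    rw [uIcc_of_le (by linarith)] at ht
    have h1 : HasDerivAt (fun t : ℝ => 1 + t) 1 t := (hasDerivAt_id t).const_add 1
    have := h1.log (by linarith [ht.1])
    simpa [Real.rpow_neg_one] using this
  · refine ContinuousOn.intervalIntegrable ?_
    refine ContinuousOn.rpow_const (by fun_prop) fun t ht => Or.inl ?_
    rw [uIcc_of_le (by linarith)] at ht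
    linarith [ht.1]

end PowerIntegrals


/-! ### Oscillatory integrals -/

theorem isOpen_lt_norm {E : Type*} [NormedAddCommGroup E] (r : ℝ) : IsOpen {Ξ : E | r < ‖Ξ‖} :=
  isOpen_lt continuous_const continuous_norm

section Oscillatory

variable {X E : Type*} [NormedAddCommGroup X] [NormedSpace ℝ X]
  [NormedAddCommGroup E] [NormedSpace ℝ E]

/-- The oscillating factor `exp (i L(w, Ξ))`. -/
noncomputable def phase (L : X × E →L[ℝ] E →L[ℝ] ℝ) (w : X × E) (Ξ : E) : ℂ :=
  Complex.exp (Complex.I * ((L w Ξ : ℝ) : ℂ))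

/-- The oscillatory integral `∫ b(x, Ξ) exp (i L(w, Ξ)) dΞ`, `w = (x, Y)`. -/
noncomputable def osc [MeasureSpace E] (L : X × E →L[ℝ] E →L[ℝ] ℝ) (b : X × E → ℂ)
    (w : X × E) : ℂ :=
  ∫ Ξ, b (w.1, Ξ) * phase L w Ξ

/-- The amplitude of the derivative of an oscillatory integral in the direction `e`. -/
noncomputable def ampDeriv (L : X × E →L[ℝ] E →L[ℝ] ℝ) (e : X × E) (b : X × E → ℂ) : X × E → ℂ :=
  fun v => dirDeriv (e.1, 0) b v + Complex.I * ((L e v.2 : ℝ) : ℂ) * b v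

variable {L : X × E →L[ℝ] E →L[ℝ] ℝ} {b : X × E → ℂ}

theorem norm_phase (w : X × E) (Ξ : E) : ‖phase L w Ξ‖ = 1 := by
  rw [phase, mul_comm, Complex.norm_exp_ofReal_mul_I]

theorem contDiff_phase : ContDiff ℝ ∞ fun q : (X × E) × E => phase L q.1 q.2 := by
  refine Complex.contDiff_exp.comp (contDiff_const.mul (Complex.ofRealCLM.contDiff.comp ?_))
  exact (L.contDiff.comp contDiff_fst).clm_apply contDiff_snd

theorem continuous_phase (w : X × E) : Continuous (phase L w) :=
  contDiff_phase.continuous.comp (Continuous.prodMk_right w)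

theorem hasFDerivAt_phase_left (w : X × E) (Ξ : E) :
    HasFDerivAt (fun w => phase L w Ξ)
      (phase L w Ξ • (Complex.I • Complex.ofRealCLM.comp (L.flip Ξ))) w := by
  have h : HasFDerivAt (fun w => Complex.I * ((L w Ξ : ℝ) : ℂ))
      (Complex.I • Complex.ofRealCLM.comp (L.flip Ξ)) w :=
    (Complex.ofRealCLM.comp (L.flip Ξ)).hasFDerivAt.const_mul Complex.I
  exact h.cexp

theorem hasFDerivAt_phase_right (w : X × E) (Ξ : E) :
    HasFDerivAt (fun Ξ => phase L w Ξ)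
      (phase L w Ξ • (Complex.I • Complex.ofRealCLM.comp (L w))) Ξ := by
  have h : HasFDerivAt (fun Ξ => Complex.I * ((L w Ξ : ℝ) : ℂ))
      (Complex.I • Complex.ofRealCLM.comp (L w)) Ξ :=
    (Complex.ofRealCLM.comp (L w)).hasFDerivAt.const_mul Complex.I
  exact h.cexp

theorem contDiff_ampDeriv (hb : ContDiff ℝ ∞ b) (e : X × E) : ContDiff ℝ ∞ (ampDeriv L e b) :=
  (contDiff_dirDeriv hb _).add ((contDiff_const.mul (Complex.ofRealCLM.contDiff.comp
    ((L e).contDiff.comp contDiff_snd))).mul hb)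

theorem dirDeriv_vanish {O : Set E} (hO : IsOpen O) (h : ∀ v : X × E, v.2 ∈ O → b v = 0)
    (e : X × E) : ∀ v : X × E, v.2 ∈ O → dirDeriv e b v = 0 :=
  dirDeriv_eq_zero_of_isOpen (U := Prod.snd ⁻¹' O) (hO.preimage continuous_snd) h e

theorem ampDeriv_vanish {O : Set E} (hO : IsOpen O) (h : ∀ v : X × E, v.2 ∈ O → b v = 0)
    (e : X × E) : ∀ v : X × E, v.2 ∈ O → ampDeriv L e b v = 0 := by
  intro v hv
  rw [ampDeriv, dirDeriv_vanish hO h _ v hv, h v hv]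
  simp

theorem continuous_osc [MeasureSpace E] [BorelSpace E] [SecondCountableTopology E]
    {g : E → ℝ} (hb : Continuous b) (hg : Integrable g) (h : ∀ v : X × E, ‖b v‖ ≤ g v.2) :
    Continuous (osc L b) := by
  refine continuous_of_dominated (fun w => ?_) (fun w => Filter.Eventually.of_forall fun Ξ => ?_)
    hg (Filter.Eventually.of_forall fun Ξ => ?_)
  · exact ((hb.comp (Continuous.prodMk_right w.1)).mul
      (continuous_phase w)).aestronglyMeasurable
  · rw [norm_mul, norm_phase, mul_one]
    exact h (w.1, Ξ)
  · exact (hb.comp (continuous_fst.prodMk continuous_const)).mul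
      (contDiff_phase.continuous.comp (continuous_id.prodMk continuous_const))

variable [FiniteDimensional ℝ E]

theorem hasCompactSupport_slice {r : ℝ} (h : ∀ v : X × E, r < ‖v.2‖ → b v = 0) (w : X × E) :
    HasCompactSupport fun Ξ => b (w.1, Ξ) * phase L w Ξ := by
  refine HasCompactSupport.intro (isCompact_closedBall (0 : E) r) fun Ξ hΞ => ?_
  rw [h _ (by simpa using hΞ), zero_mul]

variable [MeasureSpace E] [BorelSpace E] [(volume : Measure E).IsAddHaarMeasure]

theorem integrable_slice {r : ℝ} (hb : Continuous b) (h : ∀ v : X × E, r < ‖v.2‖ → b v = 0)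
    (w : X × E) : Integrable fun Ξ => b (w.1, Ξ) * phase L w Ξ :=
  ((hb.comp (Continuous.prodMk_right w.1)).mul
    (continuous_phase w)).integrable_of_hasCompactSupport (hasCompactSupport_slice h w)

theorem norm_osc_le {C r : ℝ} {O : Set E} (hO : MeasurableSet O)
    (hb : ∀ v : X × E, ‖b v‖ ≤ C * (1 + ‖v.2‖) ^ r) (h : ∀ v : X × E, v.2 ∈ O → b v = 0)
    (hint : IntegrableOn (fun Ξ : E => (1 + ‖Ξ‖) ^ r) Oᶜ) (w : X × E) :
    ‖osc L b w‖ ≤ C * ∫ Ξ in Oᶜ, (1 + ‖Ξ‖) ^ r := by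
  rw [← integral_const_mul, ← integral_indicator hO.compl]
  refine norm_integral_le_of_norm_le
    ((show IntegrableOn (fun Ξ : E => C * (1 + ‖Ξ‖) ^ r) Oᶜ volume from
      hint.const_mul C).integrable_indicator hO.compl)
    (Filter.Eventually.of_forall fun Ξ => ?_)
  rw [norm_mul, norm_phase, mul_one]
  by_cases hΞ : Ξ ∈ O
  · rw [h _ hΞ, Set.indicator_of_notMem (by simpa using hΞ), norm_zero]
  · rw [Set.indicator_of_mem (show Ξ ∈ Oᶜ from hΞ)]
    exact hb (w.1, Ξ)

theorem hasFDerivAt_osc [FiniteDimensional ℝ X] {r : ℝ} (hb : ContDiff ℝ ∞ b)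
    (h : ∀ v : X × E, r < ‖v.2‖ → b v = 0) (w : X × E) :
    ∃ D : X × E →L[ℝ] ℂ, HasFDerivAt (osc L b) D w ∧ ∀ e, D e = osc L (ampDeriv L e b) w := by
  set G : X × E → E → ℂ := fun w Ξ => b (w.1, Ξ) * phase L w Ξ with hG
  have hGsm : ContDiff ℝ ∞ fun q : (X × E) × E => G q.1 q.2 :=
    (hb.comp ((contDiff_fst.comp contDiff_fst).prodMk contDiff_snd)).mul contDiff_phase
  have hGd : ∀ w Ξ, HasFDerivAt (fun w => G w Ξ) (fderiv ℝ (fun w => G w Ξ) w) w := by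
    intro w Ξ
    have : ContDiff ℝ ∞ fun w => G w Ξ := hGsm.comp (contDiff_id.prodMk contDiff_const)
    exact (this.differentiable (by simp) w).hasFDerivAt
  have hFc : Continuous fun q : (X × E) × E => fderiv ℝ (fun w => G w q.2) q.1 := by
    have h1 : ContDiff ℝ ∞ (Function.uncurry fun (q : (X × E) × E) (w : X × E) => G w q.2) :=
      hGsm.comp (contDiff_snd.prodMk (contDiff_snd.comp contDiff_fst))
    exact (ContDiff.fderiv h1 (contDiff_fst : ContDiff ℝ ∞ Prod.fst) (by simp)).continuous
  have hF0 : ∀ w Ξ, r < ‖Ξ‖ → fderiv ℝ (fun w => G w Ξ) w = 0 := by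
    intro w Ξ hΞ
    have : (fun w => G w Ξ) = fun _ => 0 := by
      funext w; simp only [hG]; rw [h _ hΞ, zero_mul]
    rw [this]; simp
  obtain ⟨C, hC⟩ := ((isCompact_closedBall w 1).prod
    (isCompact_closedBall (0 : E) r)).exists_bound_of_continuousOn hFc.continuousOn
  have hD : HasFDerivAt (osc L b) (∫ Ξ, fderiv ℝ (fun w => G w Ξ) w) w := by
    refine hasFDerivAt_integral_of_dominated_of_fderiv_le
      (F := G) (F' := fun w Ξ => fderiv ℝ (fun w => G w Ξ) w)
      (bound := Set.indicator (Metric.closedBall (0 : E) r) fun _ => C)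
      (Metric.closedBall_mem_nhds w one_pos) (Filter.Eventually.of_forall fun w => ?_)
      (integrable_slice hb.continuous h w) ?_ (Filter.Eventually.of_forall fun Ξ w' hw' => ?_) ?_
      (Filter.Eventually.of_forall fun Ξ w' _ => hGd w' Ξ)
    · exact (integrable_slice hb.continuous h w).aestronglyMeasurable
    · exact (hFc.comp (Continuous.prodMk_right w)).aestronglyMeasurable
    · by_cases hΞ : Ξ ∈ Metric.closedBall (0 : E) r
      · rw [Set.indicator_of_mem hΞ]
        exact hC (w', Ξ) ⟨hw', hΞ⟩
      · rw [Set.indicator_of_notMem hΞ, hF0 _ _ (by simpa using hΞ), norm_zero]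
    · exact (integrableOn_const (by
        exact (isCompact_closedBall (0 : E) r).measure_lt_top.ne)).integrable_indicator
          measurableSet_closedBall
  refine ⟨_, hD, fun e => ?_⟩
  have hFint : Integrable fun Ξ => fderiv ℝ (fun w => G w Ξ) w := by
    refine (hFc.comp (Continuous.prodMk_right w)).integrable_of_hasCompactSupport ?_
    exact HasCompactSupport.intro (isCompact_closedBall (0 : E) r) fun Ξ hΞ =>
      hF0 _ _ (by simpa using hΞ)
  rw [ContinuousLinearMap.integral_apply hFint]
  refine integral_congr_ae (Filter.Eventually.of_forall fun Ξ => ?_)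
  have hb1 : HasFDerivAt (fun w : X × E => b (w.1, Ξ))
      ((fderiv ℝ b (w.1, Ξ)).comp ((ContinuousLinearMap.fst ℝ X E).prod 0)) w :=
    HasFDerivAt.comp w (hb.differentiable (by simp) (w.1, Ξ)).hasFDerivAt
      (hasFDerivAt_fst.prodMk (hasFDerivAt_const Ξ w))
  have hprod := hb1.mul (hasFDerivAt_phase_left (L := L) w Ξ)
  have e1 : fderiv ℝ (fun w => G w Ξ) w = _ := hprod.fderiv
  simp only [e1, ampDeriv]
  rw [dirDeriv_eq_fderiv (hb.differentiable (by simp) _)]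
  simp
  ring

theorem continuous_osc_of_vanish [FiniteDimensional ℝ X] {r : ℝ} (hb : ContDiff ℝ ∞ b)
    (h : ∀ v : X × E, r < ‖v.2‖ → b v = 0) : Continuous (osc L b) :=
  continuous_iff_continuousAt.2 fun w => by
    obtain ⟨D, hD, -⟩ := hasFDerivAt_osc (L := L) hb h w
    exact hD.continuousAt

/-- Integration by parts in the frequency variable. -/
theorem mul_osc {r : ℝ} (hb : ContDiff ℝ ∞ b) (h : ∀ v : X × E, r < ‖v.2‖ → b v = 0) (u : E)
    (w : X × E) :
    ((L w u : ℝ) : ℂ) * osc L b w = Complex.I * osc L (dirDeriv (0, u) b) w := by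
  have hd := dirDeriv_vanish (isOpen_lt_norm r) h ((0, u) : X × E)
  have hI := integrable_slice (L := L) hb.continuous h w
  have key := integral_bilinear_hasLineDerivAt_right_eq_neg_left_of_integrable
    (μ := (volume : Measure E)) (B := ContinuousLinearMap.mul ℝ ℂ) (v := u)
    (f := fun Ξ => b (w.1, Ξ)) (f' := fun Ξ => dirDeriv (0, u) b (w.1, Ξ))
    (g := phase L w) (g' := fun Ξ => (Complex.I * ((L w u : ℝ) : ℂ)) * phase L w Ξ)
    (integrable_slice (contDiff_dirDeriv hb _).continuous hd w)
    (by
      refine (hI.const_mul (Complex.I * ((L w u : ℝ) : ℂ))).congr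
        (Filter.Eventually.of_forall fun Ξ => ?_)
      simp only [ContinuousLinearMap.mul_apply']
      ring)
    hI
    (fun Ξ _ => by
      have h1 : HasFDerivAt (fun Ξ : E => b (w.1, Ξ))
          ((fderiv ℝ b (w.1, Ξ)).comp (ContinuousLinearMap.prod 0 (.id ℝ E))) Ξ :=
        HasFDerivAt.comp Ξ (hb.differentiable (by simp) (w.1, Ξ)).hasFDerivAt
          ((hasFDerivAt_const w.1 Ξ).prodMk (hasFDerivAt_id Ξ))
      have h2 := h1.hasLineDerivAt u
      simp only [dirDeriv_eq_fderiv (hb.differentiable (by simp) _)]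
      simpa using h2)
    (fun Ξ _ => by
      have h2 := (hasFDerivAt_phase_right (L := L) w Ξ).hasLineDerivAt u
      convert h2 using 1
      simp
      ring)
  simp only [ContinuousLinearMap.mul_apply'] at key
  have e1 : ∫ Ξ, b (w.1, Ξ) * (Complex.I * ((L w u : ℝ) : ℂ) * phase L w Ξ) =
      (Complex.I * ((L w u : ℝ) : ℂ)) * osc L b w := by
    rw [osc, ← integral_const_mul]
    congr 1
    funext Ξ
    ring
  rw [e1] at key
  change _ = -osc L (dirDeriv (0, u) b) w at key
  calc ((L w u : ℝ) : ℂ) * osc L b w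
      = -Complex.I * (Complex.I * ((L w u : ℝ) : ℂ) * osc L b w) := by
        linear_combination (((L w u : ℝ) : ℂ) * osc L b w) * Complex.I_sq
    _ = _ := by rw [key]; ring

theorem norm_pow_mul_osc {r : ℝ} (hb : ContDiff ℝ ∞ b) (h : ∀ v : X × E, r < ‖v.2‖ → b v = 0)
    (u : E) (w : X × E) (N : ℕ) :
    |L w u| ^ N * ‖osc L b w‖ = ‖osc L ((dirDeriv (0, u))^[N] b) w‖ := by
  induction N generalizing b with
  | zero => simp
  | succ N ih =>
    rw [Function.iterate_succ_apply, ← ih (contDiff_dirDeriv hb _)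
      (dirDeriv_vanish (isOpen_lt_norm r) h _), pow_succ, mul_assoc]
    congr 1
    have := congrArg norm (mul_osc (L := L) hb h u w)
    simpa using this

end Oscillatory


/-! ### Estimates for oscillatory integrals of symbols -/

section SymbolEstimates

variable {ι J X E : Type*} [NormedAddCommGroup X] [NormedSpace ℝ X]
  [NormedAddCommGroup E] [NormedSpace ℝ E] {ρ δ m : ℝ} {L : X × E →L[ℝ] E →L[ℝ] ℝ}

theorem IsSymFamily.iterate_dirDeriv_snd {a : ι → X × E → ℂ} (h : IsSymFamily ρ δ m a) (u : E)
    (N : ℕ) : IsSymFamily ρ δ (m - ρ * N) fun i => (dirDeriv (0, u))^[N] (a i) := by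
  induction N with
  | zero => simpa using h
  | succ N ih =>
    simp only [Function.iterate_succ_apply']
    have := ih.dirDeriv_snd u
    refine this.mono (le_of_eq ?_)
    push_cast
    ring

theorem iterate_dirDeriv_vanish {b : X × E → ℂ} {O : Set E} (hO : IsOpen O)
    (h : ∀ v : X × E, v.2 ∈ O → b v = 0) (e : X × E) (N : ℕ) :
    ∀ v : X × E, v.2 ∈ O → (dirDeriv e)^[N] b v = 0 := by
  induction N with
  | zero => exact h
  | succ N ih => rw [Function.iterate_succ_apply']; exact dirDeriv_vanish hO ih e

/-- The size of the phase gradient, measured along the directions `u j`. -/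
noncomputable def phaseSize [Fintype J] (L : X × E →L[ℝ] E →L[ℝ] ℝ) (u : J → E) (w : X × E) : ℝ :=
  ∑ j, |L w (u j)|

theorem continuous_phaseSize [Fintype J] (u : J → E) : Continuous (phaseSize L u) :=
  continuous_finsetSum _ fun _ _ => (L.continuous.clm_apply continuous_const).abs

/-- Multiplication of the symbol by a frequency cutoff. -/
noncomputable def cut [FiniteDimensional ℝ E] (R : ℝ) (a : X × E → ℂ) : X × E → ℂ :=
  fun v => freqCutoff R v.2 * a v

/-- `a` is a symbol of order `m` and type `(ρ, δ)`. -/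
def IsSym (ρ δ m : ℝ) (a : X × E → ℂ) : Prop := IsSymFamily ρ δ m fun _ : Unit => a

theorem IsSym.smooth {a : X × E → ℂ} (h : IsSym ρ δ m a) : ContDiff ℝ ∞ a :=
  IsSymFamily.smooth h ()

theorem IsSym.isSym_ampDeriv {a : X × E → ℂ} (hρ1 : ρ ≤ 1) (hδ1 : δ ≤ 1) (h : IsSym ρ δ m a)
    (e : X × E) : IsSym ρ δ (m + 1) (ampDeriv L e a) := by
  have h1 : IsSym ρ δ (m + 1) (dirDeriv (e.1, 0) a) :=
    (IsSymFamily.dirDeriv_fst h e.1).mono (by linarith)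
  have h2 : IsSym ρ δ (m + 1) fun v => (Complex.I * ((L e v.2 : ℝ) : ℂ)) * a v := by
    have := ((IsSymFamily.linear (ι := Unit) (X := X) (δ := δ) hρ1 (L e)).const_mul
      Complex.I).mul h
    exact this.mono (by linarith)
  exact IsSymFamily.add h1 h2

variable [FiniteDimensional ℝ E]

theorem contDiff_cut {a : X × E → ℂ} (ha : ContDiff ℝ ∞ a) (R : ℝ) : ContDiff ℝ ∞ (cut R a) :=
  ((contDiff_freqCutoff R).comp contDiff_snd).mul ha

theorem cut_vanish (a : X × E → ℂ) {R : ℝ} (hR : 0 < R) :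
    ∀ v : X × E, 2 * R < ‖v.2‖ → cut R a v = 0 := fun v hv => by
  rw [cut, freqCutoff_eq_zero hR hv.le, zero_mul]

theorem norm_cut_le (a : X × E → ℂ) (R : ℝ) (v : X × E) : ‖cut R a v‖ ≤ ‖a v‖ := by
  rw [cut, norm_mul]
  exact mul_le_of_le_one_left (norm_nonneg _) (norm_freqCutoff_le_one R _)

theorem dirDeriv_cut {a : X × E → ℂ} (ha : ContDiff ℝ ∞ a) (R : ℝ) (e : X) :
    dirDeriv (e, 0) (cut R a) = cut R (dirDeriv (e, 0) a) := by
  have h : dirDeriv ((e, 0) : X × E) (fun v => freqCutoff R v.2) = fun _ => 0 := by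
    funext v
    simp [dirDeriv, lineDeriv]
  have h2 := dirDeriv_mul (V := X × E) ((contDiff_freqCutoff R).comp contDiff_snd) ha (e, 0)
  refine h2.trans ?_
  funext v
  have := congrFun h v
  change dirDeriv ((e, 0) : X × E) (fun v => freqCutoff R v.2) v * a v + _ = _
  rw [this, zero_mul, zero_add]
  rfl

theorem ampDeriv_cut {a : X × E → ℂ} (ha : ContDiff ℝ ∞ a) (R : ℝ) (e : X × E) :
    ampDeriv L e (cut R a) = cut R (ampDeriv L e a) := by
  funext v
  simp only [ampDeriv, dirDeriv_cut ha, cut]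
  ring

variable [MeasureSpace E] [BorelSpace E] [(volume : Measure E).IsAddHaarMeasure]

/-- The decay of oscillatory integrals of symbols away from the critical set of the phase. -/
theorem IsSymFamily.exists_bound_osc [Fintype J] {a : ι → X × E → ℂ} (h : IsSymFamily ρ δ m a)
    (u : J → E) (N : ℕ) :
    ∃ C : ℝ, 0 ≤ C ∧ ∀ i w (O : Set E) (r : ℝ), IsOpen O → (∀ v : X × E, v.2 ∈ O → a i v = 0) →
      (∀ v : X × E, r < ‖v.2‖ → a i v = 0) →
      IntegrableOn (fun Ξ : E => (1 + ‖Ξ‖) ^ (m - ρ * N)) Oᶜ →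
      phaseSize L u w ^ N * ‖osc L (a i) w‖ ≤ C * ∫ Ξ in Oᶜ, (1 + ‖Ξ‖) ^ (m - ρ * N) := by
  cases N with
  | zero =>
    obtain ⟨C, hC0, hC⟩ := (h.bound 0).base
    refine ⟨C, hC0, fun i w O r hO hv hr hint => ?_⟩
    simp only [Nat.cast_zero, mul_zero, sub_zero, pow_zero, one_mul] at hint ⊢
    exact norm_osc_le hO.measurableSet (hC i) hv hint w
  | succ N =>
    choose C hC0 hC using fun j => ((h.iterate_dirDeriv_snd (u j) (N + 1)).bound 0).base
    refine ⟨(Fintype.card J : ℝ) ^ N * ∑ j, C j, mul_nonneg (by positivity)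
      (Finset.sum_nonneg fun j _ => hC0 j), fun i w O r hO hv hr hint => ?_⟩
    have h1 : ∀ j, |L w (u j)| ^ (N + 1) * ‖osc L (a i) w‖ ≤
        C j * ∫ Ξ in Oᶜ, (1 + ‖Ξ‖) ^ (m - ρ * ((N + 1 : ℕ) : ℝ)) := by
      intro j
      rw [norm_pow_mul_osc (h.smooth i) hr]
      exact norm_osc_le hO.measurableSet (hC j i) (iterate_dirDeriv_vanish hO hv _ _) hint w
    have h2 : phaseSize L u w ^ (N + 1) ≤
        (Fintype.card J : ℝ) ^ N * ∑ j, |L w (u j)| ^ (N + 1) := by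
      rcases isEmpty_or_nonempty J with hJ | hJ
      · simp [phaseSize]
      · have := pow_sum_div_card_le_sum_pow (s := Finset.univ) (f := fun j => |L w (u j)|)
          (fun j _ => abs_nonneg _) N
        rw [div_le_iff₀ (by
          have : 0 < Fintype.card J := Fintype.card_pos
          rw [Finset.card_univ]
          positivity), Finset.card_univ, mul_comm] at this
        exact this
    calc phaseSize L u w ^ (N + 1) * ‖osc L (a i) w‖
        ≤ ((Fintype.card J : ℝ) ^ N * ∑ j, |L w (u j)| ^ (N + 1)) * ‖osc L (a i) w‖ := by gcongr
      _ = (Fintype.card J : ℝ) ^ N * ∑ j, |L w (u j)| ^ (N + 1) * ‖osc L (a i) w‖ := by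
        rw [mul_assoc, Finset.sum_mul]
      _ ≤ (Fintype.card J : ℝ) ^ N *
          ∑ j, C j * ∫ Ξ in Oᶜ, (1 + ‖Ξ‖) ^ (m - ρ * ((N + 1 : ℕ) : ℝ)) := by
        exact mul_le_mul_of_nonneg_left (Finset.sum_le_sum fun j _ => h1 j) (by positivity)
      _ = _ := by rw [← Finset.sum_mul, mul_assoc]

theorem osc_sub {b b' : X × E → ℂ} {r : ℝ} (hb : Continuous b) (hb' : Continuous b')
    (h : ∀ v : X × E, r < ‖v.2‖ → b v = 0) (h' : ∀ v : X × E, r < ‖v.2‖ → b' v = 0) (w : X × E) :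
    osc L (fun v => b v - b' v) w = osc L b w - osc L b' w := by
  rw [osc, osc, osc, ← integral_sub (integrable_slice hb h w) (integrable_slice hb' h' w)]
  simp only [sub_mul]

theorem exists_integral_tail_le' {r : ℝ} (hr : r + Module.finrank ℝ E < 0) :
    ∃ C : ℝ, 0 ≤ C ∧ ∀ R : ℝ, 1 ≤ R →
      ∫ Ξ in {Ξ : E | R ≤ ‖Ξ‖}, (1 + ‖Ξ‖) ^ r ≤ C * R ^ (r + Module.finrank ℝ E) := by
  rcases subsingleton_or_nontrivial E with hE | hE
  · refine ⟨0, le_rfl, fun R hR => ?_⟩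
    have : {Ξ : E | R ≤ ‖Ξ‖} = ∅ := by
      ext Ξ
      rw [Subsingleton.elim Ξ 0]
      simp
      linarith
    rw [this]
    simp
  · exact exists_integral_tail_le hr

/-- Truncations of the symbol at different heights give nearby oscillatory integrals. -/
theorem IsSym.exists_bound_osc_cut_sub [Fintype J] (hρ1 : ρ ≤ 1) {a : X × E → ℂ}
    (h : IsSym ρ δ m a) (u : J → E) {N : ℕ} (hN : m - ρ * N + Module.finrank ℝ E < 0) :
    ∃ C : ℝ, 0 ≤ C ∧ ∀ R R' : ℝ, 1 ≤ R → R ≤ R' → ∀ w,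
      phaseSize L u w ^ N * ‖osc L (cut R' a) w - osc L (cut R a) w‖ ≤
        C * R ^ (m - ρ * N + Module.finrank ℝ E) := by
  have hcut := isSymFamily_freqCutoff (X := X) (E := E) (δ := δ) hρ1
  have h1 := (hcut.comp fun q : {R : ℝ // 1 ≤ R} × {R : ℝ // 1 ≤ R} => q.2).sub
    (hcut.comp fun q : {R : ℝ // 1 ≤ R} × {R : ℝ // 1 ≤ R} => q.1)
  have h2 := h1.mul (h.comp fun _ => ())
  rw [zero_add] at h2
  obtain ⟨C, hC0, hC⟩ := h2.exists_bound_osc (L := L) u N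
  obtain ⟨C', hC0', hC'⟩ := exists_integral_tail_le' (E := E) hN
  refine ⟨C * C', by positivity, fun R R' hR hRR' w => ?_⟩
  have hR0 : 0 < R := by linarith
  have hc := hC (⟨R, hR⟩, ⟨R', hR.trans hRR'⟩) w {Ξ | ‖Ξ‖ < R} (2 * R')
    (isOpen_lt continuous_norm continuous_const)
    (fun v hv => by
      have hv' : ‖v.2‖ < R := hv
      rw [freqCutoff_eq_one (by linarith) (by linarith), freqCutoff_eq_one hR0 hv'.le]
      simp)
    (fun v hv => by
      rw [freqCutoff_eq_zero (by linarith) hv.le, freqCutoff_eq_zero hR0 (by linarith)]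
      simp)
    (integrable_one_add_norm_rpow hN).integrableOn
  have e : osc L (cut R' a) w - osc L (cut R a) w =
      osc L (fun v => (freqCutoff R' v.2 - freqCutoff R v.2) * a v) w := by
    rw [← osc_sub (contDiff_cut h.smooth R').continuous (contDiff_cut h.smooth R).continuous
      (cut_vanish a (by linarith)) (fun v hv => cut_vanish a hR0 v (by linarith))]
    congr 1
    funext v
    simp only [cut]
    ring
  have hset : {Ξ : E | ‖Ξ‖ < R}ᶜ = {Ξ : E | R ≤ ‖Ξ‖} := by
    ext Ξ
    simp
  rw [hset] at hc
  rw [e]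
  refine hc.trans ?_
  rw [mul_assoc]
  gcongr
  exact hC' R hR

/-- Uniform decay of the truncated oscillatory integrals. -/
theorem IsSym.exists_bound_osc_cut [Fintype J] (hρ1 : ρ ≤ 1) {a : X × E → ℂ}
    (h : IsSym ρ δ m a) (u : J → E) {N : ℕ} (hN : m - ρ * N + Module.finrank ℝ E < 0) :
    ∃ C : ℝ, 0 ≤ C ∧ ∀ R : ℝ, 1 ≤ R → ∀ w,
      phaseSize L u w ^ N * ‖osc L (cut R a) w‖ ≤ C := by
  have h2 := (isSymFamily_freqCutoff (X := X) (E := E) (δ := δ) hρ1).mul (h.comp fun _ => ())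
  rw [zero_add] at h2
  obtain ⟨C, hC0, hC⟩ := h2.exists_bound_osc (L := L) u N
  refine ⟨C * ∫ Ξ in (∅ : Set E)ᶜ, (1 + ‖Ξ‖) ^ (m - ρ * N), by positivity, fun R hR w => ?_⟩
  exact hC ⟨R, hR⟩ w ∅ (2 * R) isOpen_empty (by simp)
    (fun v hv => by rw [freqCutoff_eq_zero (by linarith) hv.le, zero_mul])
    (integrable_one_add_norm_rpow hN).integrableOn

/-- A crude bound for the truncated oscillatory integrals. -/
theorem IsSym.exists_bound_osc_cut_ball {a : X × E → ℂ} (h : IsSym ρ δ m a) :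
    ∃ C : ℝ, 0 ≤ C ∧ ∀ R : ℝ, 1 ≤ R → ∀ w,
      ‖osc L (cut R a) w‖ ≤ C * ∫ Ξ in {Ξ : E | ‖Ξ‖ ≤ 2 * R}, (1 + ‖Ξ‖) ^ m := by
  obtain ⟨C, hC0, hC⟩ := (IsSymFamily.bound h 0).base
  refine ⟨C, hC0, fun R hR w => ?_⟩
  have hset : {Ξ : E | 2 * R < ‖Ξ‖}ᶜ = {Ξ : E | ‖Ξ‖ ≤ 2 * R} := by
    ext Ξ
    simp
  rw [← hset]
  refine norm_osc_le (isOpen_lt_norm _).measurableSet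
    (fun v => (norm_cut_le a R v).trans (hC () v)) (cut_vanish a (by linarith)) ?_ w
  rw [hset]
  have : {Ξ : E | ‖Ξ‖ ≤ 2 * R} = Metric.closedBall 0 (2 * R) := by
    ext Ξ
    simp
  rw [this]
  refine ContinuousOn.integrableOn_compact (isCompact_closedBall _ _) ?_
  refine ContinuousOn.rpow_const (by fun_prop) fun Ξ _ => Or.inl ?_
  positivity

/-- The kernel `∫ a(x, Ξ) exp (i L(w, Ξ)) dΞ` as a limit of truncated integrals. -/
noncomputable def regKernel (L : X × E →L[ℝ] E →L[ℝ] ℝ) (a : X × E → ℂ) (w : X × E) : ℂ :=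
  Filter.limUnder Filter.atTop fun k : ℕ => osc L (cut ((k : ℝ) + 1) a) w

theorem tendsto_natCast_add_one_rpow {q : ℝ} (hq : q < 0) (C : ℝ) :
    Filter.Tendsto (fun k : ℕ => C * ((k : ℝ) + 1) ^ q) Filter.atTop (nhds 0) := by
  have h : Filter.Tendsto (fun k : ℕ => ((k : ℝ) + 1) ^ (-(-q))) Filter.atTop (nhds 0) :=
    (tendsto_rpow_neg_atTop (y := -q) (by linarith)).comp
      (Filter.tendsto_atTop_add_const_right _ 1 tendsto_natCast_atTop_atTop)
  simpa using h.const_mul C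

theorem IsSym.tendsto_regKernel [Fintype J] (hρ1 : ρ ≤ 1) {a : X × E → ℂ}
    (h : IsSym ρ δ m a) (u : J → E) {N : ℕ} (hN : m - ρ * N + Module.finrank ℝ E < 0) {w : X × E}
    (hw : 0 < phaseSize L u w ^ N) :
    Filter.Tendsto (fun k : ℕ => osc L (cut ((k : ℝ) + 1) a) w) Filter.atTop
      (nhds (regKernel L a w)) := by
  obtain ⟨C, hC0, hC⟩ := h.exists_bound_osc_cut_sub (L := L) hρ1 u hN
  refine CauchySeq.tendsto_limUnder (cauchySeq_of_le_tendsto_0' (fun k : ℕ =>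
    (C * (phaseSize L u w ^ N)⁻¹) * ((k : ℝ) + 1) ^ (m - ρ * N + Module.finrank ℝ E))
    (fun k l hkl => ?_) (tendsto_natCast_add_one_rpow hN _))
  have hkl' : (k : ℝ) ≤ l := by exact_mod_cast hkl
  have h1 := hC ((k : ℝ) + 1) ((l : ℝ) + 1) (by linarith [(Nat.cast_nonneg k : (0 : ℝ) ≤ k)])
    (by linarith) w
  rw [dist_comm, dist_eq_norm]
  rw [← le_div_iff₀' hw] at h1
  refine h1.trans_eq ?_
  rw [div_eq_mul_inv]
  ring

/-- The quantitative rate of convergence of the truncated kernels. -/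
theorem IsSym.exists_bound_regKernel_sub [Fintype J] (hρ1 : ρ ≤ 1) {a : X × E → ℂ}
    (h : IsSym ρ δ m a) (u : J → E) {N : ℕ} (hN : m - ρ * N + Module.finrank ℝ E < 0) :
    ∃ C : ℝ, 0 ≤ C ∧ ∀ R : ℝ, 1 ≤ R → ∀ w, 0 < phaseSize L u w ^ N →
      phaseSize L u w ^ N * ‖regKernel L a w - osc L (cut R a) w‖ ≤
        C * R ^ (m - ρ * N + Module.finrank ℝ E) := by
  obtain ⟨C, hC0, hC⟩ := h.exists_bound_osc_cut_sub (L := L) hρ1 u hN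
  refine ⟨C, hC0, fun R hR w hw => ?_⟩
  refine le_of_tendsto ((((h.tendsto_regKernel hρ1 u hN hw).sub_const _).norm).const_mul _) ?_
  filter_upwards [Filter.eventually_ge_atTop ⌈R⌉₊] with k hk
  have hk' : R ≤ k := (Nat.le_ceil R).trans (by exact_mod_cast hk)
  exact hC R _ hR (by linarith) w

theorem IsSym.exists_bound_regKernel [Fintype J] (hρ1 : ρ ≤ 1) {a : X × E → ℂ}
    (h : IsSym ρ δ m a) (u : J → E) {N : ℕ} (hN : m - ρ * N + Module.finrank ℝ E < 0) :
    ∃ C : ℝ, 0 ≤ C ∧ ∀ w, 0 < phaseSize L u w ^ N →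
      phaseSize L u w ^ N * ‖regKernel L a w‖ ≤ C := by
  obtain ⟨C, hC0, hC⟩ := h.exists_bound_osc_cut (L := L) hρ1 u hN
  refine ⟨C, hC0, fun w hw => ?_⟩
  refine le_of_tendsto (((h.tendsto_regKernel hρ1 u hN hw).norm).const_mul _) ?_
  exact Filter.Eventually.of_forall fun k =>
    hC _ (by linarith [(Nat.cast_nonneg k : (0 : ℝ) ≤ k)]) w

end SymbolEstimates


/-! ### Smoothness and size of the kernels -/

section Regularity

variable {J X E : Type*} [NormedAddCommGroup X] [NormedSpace ℝ X]
  [NormedAddCommGroup E] [NormedSpace ℝ E] [FiniteDimensional ℝ E]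
  {ρ δ m : ℝ} {L : X × E →L[ℝ] E →L[ℝ] ℝ} {a : X × E → ℂ} [Fintype J] {u : J → E}

/-- The condition on an open set `U` and an order `r` which ensures that the truncated kernels of
symbols of order `r` converge locally uniformly on `U`. -/
def Admissible (L : X × E →L[ℝ] E →L[ℝ] ℝ) (u : J → E) (ρ : ℝ) (U : Set (X × E)) (r : ℝ) : Prop :=
  ∃ N : ℕ, r - ρ * N + Module.finrank ℝ E < 0 ∧ ∀ w ∈ U, 0 < phaseSize L u w ^ N

omit [FiniteDimensional ℝ E] in
theorem Admissible.mono {U : Set (X × E)} {r r' : ℝ} (h : Admissible L u ρ U r) (hr : r' ≤ r) :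
    Admissible L u ρ U r' := by
  obtain ⟨N, hN, hU⟩ := h
  exact ⟨N, by linarith, hU⟩

omit [FiniteDimensional ℝ E] in
theorem admissible_of_pos (hρ : 0 < ρ) {U : Set (X × E)} (hU : ∀ w ∈ U, 0 < phaseSize L u w)
    (r : ℝ) : Admissible L u ρ U r := by
  obtain ⟨N, hN⟩ := exists_nat_gt ((r + Module.finrank ℝ E) / ρ)
  rw [div_lt_iff₀ hρ] at hN
  exact ⟨N, by linarith, fun w hw => pow_pos (hU w hw) N⟩

omit [FiniteDimensional ℝ E] in
theorem admissible_univ {r : ℝ} (hr : r + Module.finrank ℝ E < 0) (U : Set (X × E)) :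
    Admissible L u ρ U r :=
  ⟨0, by simpa using hr, fun w _ => by simp⟩

variable [MeasureSpace E] [BorelSpace E] [(volume : Measure E).IsAddHaarMeasure]

theorem IsSym.tendstoLocallyUniformlyOn_regKernel (hρ1 : ρ ≤ 1) (h : IsSym ρ δ m a)
    {U : Set (X × E)} (hU : Admissible L u ρ U m) :
    TendstoLocallyUniformlyOn (fun (k : ℕ) w => osc L (cut ((k : ℝ) + 1) a) w) (regKernel L a)
      Filter.atTop U := by
  obtain ⟨N, hN, hpos⟩ := hU
  obtain ⟨C, hC0, hC⟩ := h.exists_bound_regKernel_sub (L := L) hρ1 u hN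
  rw [Metric.tendstoLocallyUniformlyOn_iff]
  intro ε hε w hw
  have hs := hpos w hw
  set s := phaseSize L u w ^ N
  have hopen : IsOpen {w' : X × E | s / 2 < phaseSize L u w' ^ N} :=
    isOpen_lt continuous_const ((continuous_phaseSize u).pow N)
  refine ⟨_, mem_nhdsWithin_of_mem_nhds (hopen.mem_nhds (show s / 2 < s by linarith)), ?_⟩
  filter_upwards [(tendsto_natCast_add_one_rpow hN (C * (s / 2)⁻¹)).eventually_lt_const hε]
    with k hk w' hw'
  have hw1 : s / 2 < phaseSize L u w' ^ N := hw'
  have h1 := hC ((k : ℝ) + 1) (by linarith [(Nat.cast_nonneg k : (0 : ℝ) ≤ k)]) w'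
    (by linarith)
  rw [dist_eq_norm]
  refine lt_of_le_of_lt ?_ hk
  have h2 : s / 2 * ‖regKernel L a w' - osc L (cut ((k : ℝ) + 1) a) w'‖ ≤
      C * ((k : ℝ) + 1) ^ (m - ρ * N + Module.finrank ℝ E) := by
    refine le_trans ?_ h1
    gcongr
  rw [← le_div_iff₀' (by linarith)] at h2
  refine h2.trans_eq ?_
  rw [div_eq_mul_inv]
  ring

variable [FiniteDimensional ℝ X]

theorem IsSym.continuousOn_regKernel (hρ1 : ρ ≤ 1) (h : IsSym ρ δ m a)
    {U : Set (X × E)} (hU : Admissible L u ρ U m) : ContinuousOn (regKernel L a) U := by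
  refine (h.tendstoLocallyUniformlyOn_regKernel hρ1 hU).continuousOn
    (Filter.Eventually.frequently (Filter.Eventually.of_forall fun k => ?_))
  exact (continuous_osc_of_vanish (contDiff_cut h.smooth _)
    (cut_vanish a (by positivity))).continuousOn

/-- The total derivative of a kernel, in terms of the kernels of the symbols `ampDeriv L e a`. -/
noncomputable def regKernelFDeriv (L : X × E →L[ℝ] E →L[ℝ] ℝ) (a : X × E → ℂ) (w : X × E) :
    X × E →L[ℝ] ℂ :=
  ∑ j, ((Module.finBasis ℝ (X × E)).coord j).toContinuousLinearMap.smulRight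
    (regKernel L (ampDeriv L (Module.finBasis ℝ (X × E) j) a) w)

omit [FiniteDimensional ℝ E] [BorelSpace E] [(volume : Measure E).IsAddHaarMeasure]
  [FiniteDimensional ℝ X] in
theorem tendstoLocallyUniformlyOn_finset_sum {ι κ α F : Type*} [TopologicalSpace α]
    [NormedAddCommGroup F] {l : Filter κ} {U : Set α} (s : Finset ι) {f : ι → κ → α → F}
    {g : ι → α → F} (h : ∀ i, TendstoLocallyUniformlyOn (f i) (g i) l U) :
    TendstoLocallyUniformlyOn (fun k w => ∑ i ∈ s, f i k w) (fun w => ∑ i ∈ s, g i w) l U := by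
  classical
  induction s using Finset.induction_on with
  | empty =>
    simp only [Finset.sum_empty]
    exact fun v hv w _ => ⟨Set.univ, Filter.univ_mem,
      Filter.Eventually.of_forall fun k y _ => refl_mem_uniformity hv⟩
  | insert i s hi ih =>
    simp only [Finset.sum_insert hi]
    exact (h i).add ih

theorem IsSym.hasFDerivAt_regKernel (hρ1 : ρ ≤ 1) (hδ1 : δ ≤ 1) (h : IsSym ρ δ m a)
    {U : Set (X × E)} (hUo : IsOpen U) (hU : Admissible L u ρ U (m + 1)) {w : X × E}
    (hw : w ∈ U) : HasFDerivAt (regKernel L a) (regKernelFDeriv L a w) w := by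
  set B := Module.finBasis ℝ (X × E) with hB
  have hder : ∀ (k : ℕ) (w : X × E), HasFDerivAt (osc L (cut ((k : ℝ) + 1) a))
      (∑ j, (B.coord j).toContinuousLinearMap.smulRight
        (osc L (cut ((k : ℝ) + 1) (ampDeriv L (B j) a)) w)) w := by
    intro k w
    obtain ⟨D, hD, hDe⟩ := hasFDerivAt_osc (L := L) (contDiff_cut h.smooth ((k : ℝ) + 1))
      (cut_vanish a (by positivity)) w
    convert hD using 1
    refine ContinuousLinearMap.coe_injective (B.ext fun i => ?_)
    simp only [ContinuousLinearMap.coe_coe, sum_apply,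
      ContinuousLinearMap.smulRight_apply, LinearMap.coe_toContinuousLinearMap', hDe,
      ampDeriv_cut h.smooth, Module.Basis.coord_apply, Module.Basis.repr_self]
    rw [Finset.sum_eq_single i]
    · simp
    · intro j _ hj
      simp [Finsupp.single_eq_of_ne hj]
    · simp
  refine hasFDerivAt_of_tendstoLocallyUniformlyOn hUo (l := Filter.atTop) ?_
    (fun k w _ => hder k w) (fun w hw => ?_) hw
  · refine tendstoLocallyUniformlyOn_finset_sum _ fun j => ?_
    have h1 := (h.isSym_ampDeriv (L := L) hρ1 hδ1 (B j)).tendstoLocallyUniformlyOn_regKernel hρ1 hU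
    exact UniformContinuous.comp_tendstoLocallyUniformlyOn
      (g := fun z => (B.coord j).toContinuousLinearMap.smulRight z)
      (ContinuousLinearMap.smulRightL ℝ (X × E) ℂ
        (B.coord j).toContinuousLinearMap).uniformContinuous h1
  · exact (h.tendstoLocallyUniformlyOn_regKernel hρ1 (hU.mono (by linarith))).tendsto_at hw

theorem IsSym.dirDeriv_regKernel (hρ1 : ρ ≤ 1) (hδ1 : δ ≤ 1) (h : IsSym ρ δ m a)
    {U : Set (X × E)} (hUo : IsOpen U) (hU : Admissible L u ρ U (m + 1)) (e : X × E) {w : X × E}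
    (hw : w ∈ U) : dirDeriv e (regKernel L a) w = regKernel L (ampDeriv L e a) w := by
  have h1 := h.hasFDerivAt_regKernel hρ1 hδ1 hUo hU hw
  rw [dirDeriv_eq_fderiv h1.differentiableAt, h1.fderiv]
  have hlin : ∀ k : ℕ, osc L (cut ((k : ℝ) + 1) (ampDeriv L e a)) w =
      ∑ j, (Module.finBasis ℝ (X × E)).coord j e •
        osc L (cut ((k : ℝ) + 1) (ampDeriv L (Module.finBasis ℝ (X × E) j) a)) w := by
    intro k
    obtain ⟨D, hD, hDe⟩ := hasFDerivAt_osc (L := L) (contDiff_cut h.smooth ((k : ℝ) + 1))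
      (cut_vanish a (by positivity)) w
    simp only [← ampDeriv_cut h.smooth, ← hDe]
    conv_lhs => rw [← (Module.finBasis ℝ (X × E)).sum_repr e, map_sum]
    simp only [map_smul, Module.Basis.coord_apply]
  have t1 := ((h.isSym_ampDeriv (L := L) hρ1 hδ1 e).tendstoLocallyUniformlyOn_regKernel hρ1
    hU).tendsto_at hw
  have t2 : Filter.Tendsto (fun k : ℕ => osc L (cut ((k : ℝ) + 1) (ampDeriv L e a)) w)
      Filter.atTop (nhds (regKernelFDeriv L a w e)) := by
    simp only [hlin]
    have : regKernelFDeriv L a w e = ∑ j, (Module.finBasis ℝ (X × E)).coord j e •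
        regKernel L (ampDeriv L (Module.finBasis ℝ (X × E) j) a) w := by
      simp [regKernelFDeriv]
    rw [this]
    refine tendsto_finsetSum _ fun j _ => Filter.Tendsto.const_smul ?_ _
    exact ((h.isSym_ampDeriv (L := L) hρ1 hδ1 _).tendstoLocallyUniformlyOn_regKernel hρ1
      hU).tendsto_at hw
  exact tendsto_nhds_unique t2 t1

theorem IsSym.contDiffOn_regKernel (hρ1 : ρ ≤ 1) (hδ1 : δ ≤ 1) (h : IsSym ρ δ m a)
    {U : Set (X × E)} (hUo : IsOpen U) (M : ℕ) (hU : Admissible L u ρ U (m + M)) :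
    ContDiffOn ℝ M (regKernel L a) U := by
  induction M generalizing m a with
  | zero =>
    rw [Nat.cast_zero, contDiffOn_zero]
    exact h.continuousOn_regKernel hρ1 (hU.mono (by simp))
  | succ M ih =>
    have hU1 : Admissible L u ρ U (m + 1) :=
      hU.mono (by push_cast; linarith [(Nat.cast_nonneg M : (0 : ℝ) ≤ M)])
    rw [Nat.cast_succ, contDiffOn_succ_iff_fderiv_of_isOpen hUo]
    refine ⟨fun w hw =>
      (h.hasFDerivAt_regKernel hρ1 hδ1 hUo hU1 hw).differentiableAt.differentiableWithinAt,
      by simp, ?_⟩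
    have hcd : ContDiffOn ℝ M (regKernelFDeriv L a) U := by
      refine ContDiffOn.sum fun j _ => ?_
      exact (ContinuousLinearMap.smulRightL ℝ (X × E) ℂ
        ((Module.finBasis ℝ (X × E)).coord j).toContinuousLinearMap).contDiff.comp_contDiffOn
          (ih (h.isSym_ampDeriv (L := L) hρ1 hδ1 _) (hU.mono (by push_cast; linarith)))
    exact hcd.congr fun w hw => (h.hasFDerivAt_regKernel hρ1 hδ1 hUo hU1 hw).fderiv

/-- Iterated derivatives of kernels are kernels. -/
theorem IsSym.foldr_dirDeriv_regKernel (hρ1 : ρ ≤ 1) (hδ1 : δ ≤ 1) (h : IsSym ρ δ m a)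
    {U : Set (X × E)} (hUo : IsOpen U) (l : List (X × E)) (hU : Admissible L u ρ U (m + l.length)) :
    IsSym ρ δ (m + l.length) (l.foldr (ampDeriv L) a) ∧ ∀ w ∈ U,
      l.foldr dirDeriv (regKernel L a) w = regKernel L (l.foldr (ampDeriv L) a) w := by
  induction l with
  | nil => exact ⟨by simpa using h, fun w _ => rfl⟩
  | cons e l ih =>
    have hlen : m + ((e :: l).length : ℝ) = m + l.length + 1 := by
      simp only [List.length_cons]; push_cast; ring
    rw [hlen] at hU ⊢
    obtain ⟨ih1, ih2⟩ := ih (hU.mono (by linarith))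
    refine ⟨ih1.isSym_ampDeriv hρ1 hδ1 e, fun w hw => ?_⟩
    simp only [List.foldr_cons]
    rw [dirDeriv_congr_of_isOpen hUo ih2 e w hw]
    exact ih1.dirDeriv_regKernel hρ1 hδ1 hUo hU e hw

omit [Fintype J] [FiniteDimensional ℝ X] in
theorem IsSym.exists_bound_regKernel_of_pos [Nontrivial E] [Fintype J] (hρ : 0 < ρ) (hρ1 : ρ ≤ 1)
    (h : IsSym ρ δ m a) (u : J → E) (hm : 0 < m + Module.finrank ℝ E) :
    ∃ C : ℝ, 0 ≤ C ∧ ∀ w, 0 < phaseSize L u w →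
      ‖regKernel L a w‖ ≤ C * phaseSize L u w ^ (-(m + Module.finrank ℝ E) / ρ) := by
  obtain ⟨N, hN⟩ := exists_nat_gt ((m + Module.finrank ℝ E) / ρ)
  have hN' : m - ρ * N + Module.finrank ℝ E < 0 := by
    rw [div_lt_iff₀ hρ] at hN; linarith
  set q : ℝ := m + Module.finrank ℝ E with hq
  obtain ⟨C₁, hC₁0, hC₁⟩ := h.exists_bound_regKernel (L := L) hρ1 u hN'
  obtain ⟨C₂, hC₂0, hC₂⟩ := h.exists_bound_regKernel_sub (L := L) hρ1 u hN'
  obtain ⟨C₃, hC₃0, hC₃⟩ := h.exists_bound_osc_cut_ball (L := L)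
  obtain ⟨C₄, hC₄0, hC₄⟩ := exists_integral_ball_le (E := E) hm
  refine ⟨C₁ + C₂ + C₃ * C₄, by positivity, fun w hw => ?_⟩
  set s := phaseSize L u w with hs
  have hsN : 0 < s ^ N := pow_pos hw N
  have hpow : 0 ≤ s ^ (-q / ρ) := by positivity
  rcases le_total 1 s with h1 | h1
  · have h2 : ‖regKernel L a w‖ ≤ C₁ * (s ^ N)⁻¹ := by
      rw [← div_eq_mul_inv, le_div_iff₀' hsN]
      exact hC₁ w hsN
    have h3 : (s ^ N)⁻¹ ≤ s ^ (-q / ρ) := by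
      rw [← Real.rpow_natCast, ← Real.rpow_neg hw.le]
      apply Real.rpow_le_rpow_of_exponent_le h1
      rw [neg_div]
      linarith
    calc ‖regKernel L a w‖ ≤ C₁ * s ^ (-q / ρ) := h2.trans (by gcongr)
      _ ≤ _ := by gcongr; linarith [mul_nonneg hC₃0 hC₄0]
  · set R : ℝ := s ^ (-1 / ρ) with hR
    have hR1 : 1 ≤ R := Real.one_le_rpow_of_pos_of_le_one_of_nonpos hw h1 (by
      rw [neg_div]; linarith [one_div_pos.2 hρ])
    have hRq : R ^ q = s ^ (-q / ρ) := by
      rw [hR, ← Real.rpow_mul hw.le]; congr 1; ring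
    have h2 : ‖osc L (cut R a) w‖ ≤ C₃ * C₄ * s ^ (-q / ρ) := by
      refine (hC₃ R hR1 w).trans ?_
      rw [mul_assoc, ← hRq]
      gcongr
      exact hC₄ R hR1
    have h3 : ‖regKernel L a w - osc L (cut R a) w‖ ≤ C₂ * s ^ (-q / ρ) := by
      have := hC₂ R hR1 w hsN
      rw [← le_div_iff₀' hsN] at this
      refine this.trans_eq ?_
      rw [mul_div_assoc]
      congr 1
      rw [hR, ← Real.rpow_mul hw.le, ← Real.rpow_natCast, ← Real.rpow_sub hw]
      congr 1
      rw [hq]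
      field_simp
      ring
    calc ‖regKernel L a w‖
        = ‖osc L (cut R a) w + (regKernel L a w - osc L (cut R a) w)‖ := by congr 1; ring
      _ ≤ C₃ * C₄ * s ^ (-q / ρ) + C₂ * s ^ (-q / ρ) :=
        (norm_add_le _ _).trans (add_le_add h2 h3)
      _ ≤ _ := by rw [add_mul, add_mul]; linarith [mul_nonneg hC₁0 hpow]

omit [Fintype J] [FiniteDimensional ℝ X] in
theorem IsSym.exists_bound_regKernel_of_eq_zero [Nontrivial E] [Fintype J] (hρ : 0 < ρ)
    (hρ1 : ρ ≤ 1) (h : IsSym ρ δ m a) (u : J → E) (hm : m + Module.finrank ℝ E = 0) :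
    ∃ C : ℝ, 0 ≤ C ∧ ∀ w, 0 < phaseSize L u w →
      ‖regKernel L a w‖ ≤ C * (1 + |Real.log (phaseSize L u w)|) := by
  have hN' : m - ρ * (1 : ℕ) + Module.finrank ℝ E < 0 := by
    push_cast; linarith
  obtain ⟨C₁, hC₁0, hC₁⟩ := h.exists_bound_regKernel (L := L) hρ1 u hN'
  obtain ⟨C₂, hC₂0, hC₂⟩ := h.exists_bound_regKernel_sub (L := L) hρ1 u hN'
  obtain ⟨C₃, hC₃0, hC₃⟩ := h.exists_bound_osc_cut_ball (L := L)
  obtain ⟨C₄, hC₄0, hC₄⟩ := exists_integral_ball_le_log (E := E) hm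
  refine ⟨C₁ + C₂ + C₃ * C₄ * (1 + 1 / ρ), by positivity, fun w hw => ?_⟩
  set s := phaseSize L u w with hs
  have hsN : 0 < s ^ 1 := pow_pos hw 1
  have hlog : 1 ≤ 1 + |Real.log s| := by linarith [abs_nonneg (Real.log s)]
  have hρi : 0 < 1 / ρ := one_div_pos.2 hρ
  rcases le_total 1 s with h1 | h1
  · have h2 : ‖regKernel L a w‖ ≤ C₁ := by
      have := hC₁ w hsN
      rw [pow_one] at this
      exact (le_mul_of_one_le_left (norm_nonneg _) h1).trans this
    calc ‖regKernel L a w‖ ≤ C₁ + C₂ + C₃ * C₄ * (1 + 1 / ρ) := by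
          have : 0 ≤ C₃ * C₄ * (1 + 1 / ρ) := by positivity
          linarith
      _ ≤ _ := le_mul_of_one_le_right (by positivity) hlog
  · set R : ℝ := s ^ (-1 / ρ) with hR
    have hR1 : 1 ≤ R := Real.one_le_rpow_of_pos_of_le_one_of_nonpos hw h1 (by
      rw [neg_div]; linarith)
    have h2 : ‖osc L (cut R a) w‖ ≤ C₃ * C₄ * (1 + 1 / ρ) * (1 + |Real.log s|) := by
      refine (hC₃ R hR1 w).trans ?_
      rw [mul_assoc, mul_assoc]
      gcongr
      refine (hC₄ R hR1).trans ?_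
      gcongr
      rw [hR, Real.log_rpow hw, abs_of_nonpos (Real.log_nonpos hw.le h1)]
      have : 0 ≤ -Real.log s := by linarith [Real.log_nonpos hw.le h1]
      have e : -1 / ρ * Real.log s = 1 / ρ * (-Real.log s) := by ring
      rw [e]
      nlinarith
    have h3 : ‖regKernel L a w - osc L (cut R a) w‖ ≤ C₂ := by
      have := hC₂ R hR1 w hsN
      rw [← le_div_iff₀' hsN] at this
      refine this.trans_eq ?_
      rw [mul_div_assoc]
      have e : R ^ (m - ρ * (1 : ℕ) + Module.finrank ℝ E) = s := by
        rw [hR, ← Real.rpow_mul hw.le]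
        have : -1 / ρ * (m - ρ * (1 : ℕ) + Module.finrank ℝ E) = 1 := by
          have : m - ρ * (1 : ℕ) + Module.finrank ℝ E = -ρ := by push_cast; linarith
          rw [this]
          field_simp
        rw [this, Real.rpow_one]
      rw [e, pow_one, div_self hw.ne', mul_one]
    calc ‖regKernel L a w‖
        = ‖osc L (cut R a) w + (regKernel L a w - osc L (cut R a) w)‖ := by congr 1; ring
      _ ≤ C₃ * C₄ * (1 + 1 / ρ) * (1 + |Real.log s|) + C₂ :=
        (norm_add_le _ _).trans (add_le_add h2 h3)
      _ ≤ _ := by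
        have t1 : C₂ ≤ C₂ * (1 + |Real.log s|) := le_mul_of_one_le_right hC₂0 hlog
        have t2 : 0 ≤ C₁ * (1 + |Real.log s|) := by positivity
        rw [add_mul, add_mul]
        linarith

end Regularity


/-! ### Tempered distributions vanishing on translates of an approximate identity -/

section Translates

open scoped BoundedContinuousFunction LineDeriv

variable {V : Type*} [NormedAddCommGroup V] [NormedSpace ℝ V]

/-- Translation of Schwartz functions. -/
noncomputable abbrev translate (w : V) (f : 𝓢(V, ℂ)) : 𝓢(V, ℂ) := f.compSubConstCLM ℂ w

theorem iteratedFDeriv_translate (w : V) (f : 𝓢(V, ℂ)) (l : ℕ) (x : V) :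
    iteratedFDeriv ℝ l (translate w f) x = iteratedFDeriv ℝ l f (x - w) :=
  iteratedFDeriv_comp_sub (f := f) l w x

/-- Bounded continuous functions with values in a normed space. -/
abbrev BddFun (V F : Type*) [TopologicalSpace V] [NormedAddCommGroup F] : Type _ := V →ᵇ F

/-- The bounded continuous function `x ↦ ‖x‖ ^ k D ^ l f(x)` attached to a Schwartz function. -/
noncomputable def weightedJet (k l : ℕ) : 𝓢(V, ℂ) →ₗ[ℂ] BddFun V (V [×l]→L[ℝ] ℂ) where
  toFun f := BoundedContinuousFunction.ofNormedAddCommGroup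
    (fun x => ‖x‖ ^ k • iteratedFDeriv ℝ l f x)
    ((continuous_norm.pow k).smul
      ((f.smooth ⊤).continuous_iteratedFDeriv (by exact_mod_cast le_top)))
    (SchwartzMap.seminorm ℝ k l f) fun x => by
      rw [norm_smul, norm_pow, norm_norm]
      exact SchwartzMap.le_seminorm ℝ k l f x
  map_add' f g := by
    ext1 x
    change ‖x‖ ^ k • iteratedFDeriv ℝ l (⇑f + ⇑g) x =
      ‖x‖ ^ k • iteratedFDeriv ℝ l f x + ‖x‖ ^ k • iteratedFDeriv ℝ l g x
    rw [iteratedFDeriv_add_apply ((f.smooth l).contDiffAt) ((g.smooth l).contDiffAt), smul_add]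
  map_smul' c f := by
    ext1 x
    change ‖x‖ ^ k • iteratedFDeriv ℝ l (c • ⇑f) x = c • (‖x‖ ^ k • iteratedFDeriv ℝ l f x)
    rw [iteratedFDeriv_const_smul_apply ((f.smooth l).contDiffAt), smul_comm]

theorem weightedJet_apply (k l : ℕ) (f : 𝓢(V, ℂ)) (x : V) :
    weightedJet k l f x = ‖x‖ ^ k • iteratedFDeriv ℝ l f x := rfl

theorem seminorm_le_norm_weightedJet (k l : ℕ) (f : 𝓢(V, ℂ)) :
    SchwartzMap.seminorm ℂ k l f ≤ ‖weightedJet k l f‖ := by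
  refine SchwartzMap.seminorm_le_bound ℂ k l f (norm_nonneg _) fun x => ?_
  have := (weightedJet k l f).norm_coe_le_norm x
  rwa [weightedJet_apply, norm_smul, norm_pow, norm_norm] at this

theorem exists_one_add_norm_pow_mul_le (f : 𝓢(V, ℂ)) (k l : ℕ) :
    ∃ C : ℝ, 0 ≤ C ∧ ∀ x, (1 + ‖x‖) ^ k * ‖iteratedFDeriv ℝ l f x‖ ≤ C :=
  ⟨_, (by positivity), fun x => SchwartzMap.one_add_le_sup_seminorm_apply (𝕜 := ℂ) (m := (k, l))
    le_rfl le_rfl f x⟩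

omit [NormedSpace ℝ V] in
theorem norm_pow_le_translate (k : ℕ) (x y : V) :
    ‖x‖ ^ k ≤ (1 + ‖x - y‖) ^ k * (1 + ‖y‖) ^ k := by
  rw [← mul_pow]
  gcongr
  have : ‖x‖ ≤ ‖x - y‖ + ‖y‖ := by simpa using norm_add_le (x - y) y
  nlinarith [norm_nonneg (x - y), norm_nonneg y]

theorem norm_weightedJet_translate_le (f : 𝓢(V, ℂ)) (k l : ℕ) :
    ∃ C : ℝ, 0 ≤ C ∧ ∀ w, ‖weightedJet k l (translate w f)‖ ≤ C * (1 + ‖w‖) ^ k := by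
  obtain ⟨C, hC0, hC⟩ := exists_one_add_norm_pow_mul_le f k l
  refine ⟨C, hC0, fun w => ?_⟩
  rw [BoundedContinuousFunction.norm_le (by positivity)]
  intro x
  rw [weightedJet_apply, norm_smul, norm_pow, norm_norm, iteratedFDeriv_translate]
  calc ‖x‖ ^ k * ‖iteratedFDeriv ℝ l f (x - w)‖
      ≤ ((1 + ‖x - w‖) ^ k * (1 + ‖w‖) ^ k) * ‖iteratedFDeriv ℝ l f (x - w)‖ := by
        gcongr
        exact norm_pow_le_translate k x w
    _ = ((1 + ‖x - w‖) ^ k * ‖iteratedFDeriv ℝ l f (x - w)‖) * (1 + ‖w‖) ^ k := by ring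
    _ ≤ _ := by
        gcongr
        exact hC _

theorem norm_weightedJet_translate_sub_le (f : 𝓢(V, ℂ)) (k l : ℕ) :
    ∃ C : ℝ, 0 ≤ C ∧ ∀ w, ‖weightedJet k l (translate w f) - weightedJet k l f‖ ≤
      C * (1 + ‖w‖) ^ k * ‖w‖ := by
  obtain ⟨C, hC0, hC⟩ := exists_one_add_norm_pow_mul_le f k (l + 1)
  refine ⟨C, hC0, fun w => ?_⟩
  rw [BoundedContinuousFunction.norm_le (by positivity)]
  intro x
  have e : (weightedJet k l (translate w f) - weightedJet k l f) x =
      ‖x‖ ^ k • (iteratedFDeriv ℝ l f (x - w) - iteratedFDeriv ℝ l f x) := by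
    rw [smul_sub, ← iteratedFDeriv_translate]
    rfl
  rw [e, norm_smul, norm_pow, norm_norm]
  have hdiff : Differentiable ℝ (iteratedFDeriv ℝ l f) :=
    (f.smooth ⊤).differentiable_iteratedFDeriv (by exact_mod_cast WithTop.coe_lt_top l)
  have hmem : ∀ y ∈ segment ℝ x (x - w), ‖x - y‖ ≤ ‖w‖ := by
    intro y hy
    have h1 := (convex_closedBall x ‖w‖).segment_subset (x := x) (y := x - w)
      (by simp) (by simp) hy
    rw [mem_closedBall_iff_norm, norm_sub_rev] at h1
    exact h1
  by_cases hx : ‖x‖ ^ k = 0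
  · rw [hx, zero_mul]; positivity
  have hxpos : 0 < ‖x‖ ^ k := lt_of_le_of_ne (by positivity) (Ne.symm hx)
  have h2 := Convex.norm_image_sub_le_of_norm_fderiv_le (𝕜 := ℝ) (f := iteratedFDeriv ℝ l f)
    (s := segment ℝ x (x - w)) (C := C * (1 + ‖w‖) ^ k / ‖x‖ ^ k) (x := x) (y := x - w)
    (fun y _ => hdiff y) (fun y hy => by
      rw [norm_fderiv_iteratedFDeriv, le_div_iff₀ hxpos]
      have h3 : ‖x‖ ^ k ≤ (1 + ‖y‖) ^ k * (1 + ‖w‖) ^ k := by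
        have := norm_pow_le_translate k x (x - y)
        rw [sub_sub_cancel] at this
        refine this.trans ?_
        gcongr
        exact hmem y hy
      calc ‖iteratedFDeriv ℝ (l + 1) f y‖ * ‖x‖ ^ k
          ≤ ‖iteratedFDeriv ℝ (l + 1) f y‖ * ((1 + ‖y‖) ^ k * (1 + ‖w‖) ^ k) := by gcongr
        _ = ((1 + ‖y‖) ^ k * ‖iteratedFDeriv ℝ (l + 1) f y‖) * (1 + ‖w‖) ^ k := by ring
        _ ≤ _ := by gcongr; exact hC y)
    (convex_segment _ _) (left_mem_segment ℝ _ _) (right_mem_segment ℝ _ _)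
  rw [sub_sub_cancel_left, norm_neg] at h2
  calc ‖x‖ ^ k * ‖iteratedFDeriv ℝ l f (x - w) - iteratedFDeriv ℝ l f x‖
      ≤ ‖x‖ ^ k * (C * (1 + ‖w‖) ^ k / ‖x‖ ^ k * ‖w‖) := by gcongr
    _ = _ := by field_simp

theorem continuous_weightedJet_translate (f : 𝓢(V, ℂ)) (k l : ℕ) :
    Continuous fun w => weightedJet k l (translate w f) := by
  rw [continuous_iff_continuousAt]
  intro w
  obtain ⟨C, hC0, hC⟩ := norm_weightedJet_translate_sub_le (translate w f) k l
  rw [ContinuousAt, tendsto_iff_norm_sub_tendsto_zero]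
  have hlim : Filter.Tendsto (fun w' : V => C * (1 + ‖w' - w‖) ^ k * ‖w' - w‖) (nhds w)
      (nhds 0) := by
    have hc : Continuous fun w' : V => C * (1 + ‖w' - w‖) ^ k * ‖w' - w‖ := by fun_prop
    simpa using hc.tendsto w
  refine squeeze_zero (fun _ => norm_nonneg _) (fun w' => ?_) hlim
  have := hC (w' - w)
  rwa [translate, translate, SchwartzMap.compSubConstCLM_comp, add_sub_cancel] at this

theorem lineDerivOp_comm (v w : V) (f : 𝓢(V, ℂ)) : ∂_{v} (∂_{w} f) = ∂_{w} (∂_{v} f) := by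
  have h : ∀ (u : V) (g : 𝓢(V, ℂ)), ⇑(∂_{u} g : 𝓢(V, ℂ)) = dirDeriv u g :=
    fun u g => funext fun x => SchwartzMap.lineDerivOp_apply u g x
  ext x
  rw [h, h, h, h, dirDeriv_comm (f.smooth ⊤)]

theorem iteratedLineDerivOp_lineDerivOp (l : ℕ) (m : Fin l → V) (v : V) (f : 𝓢(V, ℂ)) :
    ∂^{m} (∂_{v} f) = ∂_{v} (∂^{m} f) := by
  induction l with
  | zero => rfl
  | succ l ih =>
    rw [LineDeriv.iteratedLineDerivOp_succ_left, ih, LineDeriv.iteratedLineDerivOp_succ_left,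
      lineDerivOp_comm]

variable [FiniteDimensional ℝ V] [MeasureSpace V] [BorelSpace V]
  [(volume : Measure V).IsAddHaarMeasure]

/-- The convolution integral of two Schwartz functions. -/
noncomputable def convInt (f g : 𝓢(V, ℂ)) (x : V) : ℂ := ∫ w, f w * g (x - w)

theorem convInt_comm (f g : 𝓢(V, ℂ)) (x : V) : convInt f g x = convInt g f x := by
  rw [convInt, convInt, ← integral_sub_left_eq_self _ _ x]
  simp only [sub_sub_cancel, mul_comm]

theorem convInt_lineDerivOp (f g : 𝓢(V, ℂ)) (v x : V) :
    convInt f (∂_{v} g) x = convInt (∂_{v} f) g x := by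
  set r : 𝓢(V, ℂ) := translate x
    (SchwartzMap.compCLMOfContinuousLinearEquiv ℂ (ContinuousLinearEquiv.neg ℝ) g) with hr
  have hr1 : ∀ w, r w = g (x - w) := fun w => by
    simp [hr]
  have hr2 : ∀ w, (∂_{v} r) w = -(∂_{v} g) (x - w) := fun w => by
    rw [SchwartzMap.lineDerivOp_apply_eq_fderiv, SchwartzMap.lineDerivOp_apply_eq_fderiv]
    have h1 : HasFDerivAt (fun w => g (x - w)) ((fderiv ℝ g (x - w)).comp (-.id ℝ V)) w :=
      (g.differentiableAt.hasFDerivAt (x := x - w)).comp w ((hasFDerivAt_id w).const_sub x)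
    have h2 : (r : V → ℂ) = fun w => g (x - w) := funext hr1
    rw [h2, h1.fderiv]
    simp
  have key := SchwartzMap.integral_mul_lineDerivOp_right_eq_neg_left (μ := volume) f r v
  simp only [hr1, hr2, mul_neg, integral_neg, neg_inj] at key
  exact key

theorem convInt_iteratedLineDerivOp (f g : 𝓢(V, ℂ)) (l : ℕ) (m : Fin l → V) (x : V) :
    convInt f (∂^{m} g) x = convInt (∂^{m} f) g x := by
  induction l generalizing f with
  | zero => rfl
  | succ l ih =>
    rw [LineDeriv.iteratedLineDerivOp_succ_left, convInt_lineDerivOp, ih,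
      iteratedLineDerivOp_lineDerivOp, LineDeriv.iteratedLineDerivOp_succ_left]

/-- The target space of a finite collection of weighted jets. -/
abbrev JetSpace (V : Type*) [NormedAddCommGroup V] [NormedSpace ℝ V] (s : Finset (ℕ × ℕ)) :
    Type _ :=
  (i : s) → BddFun V (V [×i.1.2]→L[ℝ] ℂ)

/-- A finite collection of weighted jets of a Schwartz function. -/
noncomputable def jets (s : Finset (ℕ × ℕ)) : 𝓢(V, ℂ) →ₗ[ℂ] JetSpace V s :=
  LinearMap.pi fun i => weightedJet i.1.1 i.1.2

theorem integrable_smul_jets_translate (s : Finset (ℕ × ℕ)) (f g : 𝓢(V, ℂ)) :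
    Integrable fun w => f w • jets s (translate w g) := by
  have hcont : Continuous fun w => jets s (translate w g) :=
    continuous_pi fun i => continuous_weightedJet_translate g i.1.1 i.1.2
  choose C hC0 hC using fun i : s => norm_weightedJet_translate_le g i.1.1 i.1.2
  set K := s.sup fun i => i.1 with hK
  have hb : ∀ w, ‖jets s (translate w g)‖ ≤ (∑ i, C i) * (1 + ‖w‖) ^ K := by
    intro w
    have hsum : 0 ≤ ∑ i, C i := Finset.sum_nonneg fun i _ => hC0 i
    refine (pi_norm_le_iff_of_nonneg (by positivity)).2 fun i => (hC i w).trans ?_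
    gcongr
    · exact Finset.single_le_sum (fun i _ => hC0 i) (Finset.mem_univ i)
    · linarith [norm_nonneg w]
    · exact Finset.le_sup (f := fun i : ℕ × ℕ => i.1) i.2
  obtain ⟨A, hA0, hA⟩ := exists_one_add_norm_pow_mul_le f (K + (Module.finrank ℝ V + 1)) 0
  have hint : Integrable fun w : V =>
      (A * ∑ i, C i) * (1 + ‖w‖) ^ (-((Module.finrank ℝ V + 1 : ℕ) : ℝ)) :=
    (integrable_one_add_norm (by exact_mod_cast Nat.lt_succ_self _)).const_mul _
  have : SecondCountableTopologyEither V (JetSpace V s) := secondCountableTopologyEither_of_left _ _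
  refine hint.mono' (f.continuous.smul hcont).aestronglyMeasurable
    (Filter.Eventually.of_forall fun w => ?_)
  have h1 := hA w
  rw [norm_iteratedFDeriv_zero, pow_add] at h1
  have hp : 0 < (1 + ‖w‖) ^ (Module.finrank ℝ V + 1) := by positivity
  rw [norm_smul, Real.rpow_neg (by positivity), Real.rpow_natCast, ← div_eq_mul_inv,
    le_div_iff₀ hp]
  have hsum : 0 ≤ ∑ i, C i := Finset.sum_nonneg fun i _ => hC0 i
  calc ‖f w‖ * ‖jets s (translate w g)‖ * (1 + ‖w‖) ^ (Module.finrank ℝ V + 1)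
      ≤ ‖f w‖ * ((∑ i, C i) * (1 + ‖w‖) ^ K) * (1 + ‖w‖) ^ (Module.finrank ℝ V + 1) := by
        gcongr
        exact hb w
    _ = ((1 + ‖w‖) ^ K * (1 + ‖w‖) ^ (Module.finrank ℝ V + 1) * ‖f w‖) * ∑ i, C i := by ring
    _ ≤ _ := by gcongr

theorem integral_smul_jets_translate_comm (s : Finset (ℕ × ℕ)) (f g : 𝓢(V, ℂ)) :
    ∫ w, f w • jets s (translate w g) = ∫ w, g w • jets s (translate w f) := by
  funext i
  ext x m
  have key : ∀ f g : 𝓢(V, ℂ), (∫ w, f w • jets s (translate w g)) i x m =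
      (‖x‖ ^ i.1.1 : ℝ) • convInt f (∂^{m} g) x := by
    intro f g
    set ev : JetSpace V s →L[ℝ] ℂ :=
      (ContinuousMultilinearMap.apply ℝ (fun _ : Fin i.1.2 => V) ℂ m).comp
        ((BoundedContinuousFunction.evalCLM ℝ x).comp (ContinuousLinearMap.proj i)) with hev
    have h1 := ev.integral_comp_comm (integrable_smul_jets_translate s f g)
    change _ = (∫ w, f w • jets s (translate w g)) i x m at h1
    rw [← h1, convInt, ← integral_smul]
    refine integral_congr_ae (Filter.Eventually.of_forall fun w => ?_)
    change f w • (‖x‖ ^ i.1.1 • iteratedFDeriv ℝ i.1.2 (translate w g) x m) = _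
    rw [iteratedFDeriv_translate, ← SchwartzMap.iteratedLineDerivOp_eq_iteratedFDeriv,
      smul_comm, smul_eq_mul]
  rw [key, key, convInt_iteratedLineDerivOp, convInt_comm]

/-- A linear functional which is bounded by the norm of a linear map factors through it. -/
theorem exists_clm_comp_eq {W B : Type*} [AddCommGroup W] [Module ℂ W] [NormedAddCommGroup B]
    [NormedSpace ℂ B] (j : W →ₗ[ℂ] B) (T : W →ₗ[ℂ] ℂ) (C : ℝ) (h : ∀ f, ‖T f‖ ≤ C * ‖j f‖) :
    ∃ U : B →L[ℂ] ℂ, ∀ f, U (j f) = T f := by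
  have hker : LinearMap.ker j ≤ LinearMap.ker T := by
    intro f hf
    have := h f
    rw [LinearMap.mem_ker] at hf ⊢
    rw [hf, norm_zero, mul_zero] at this
    exact norm_le_zero_iff.1 this
  set e := j.quotKerEquivRange with he
  set φ := ((LinearMap.ker j).liftQ T hker).comp e.symm.toLinearMap with hφ
  have hval : ∀ f, φ (e (Submodule.Quotient.mk f)) = T f := fun f => by simp [hφ]
  have hnorm : ∀ y : LinearMap.range j, ‖φ y‖ ≤ C * ‖y‖ := by
    rintro ⟨_, f, rfl⟩
    exact (congrArg norm (hval f)).trans_le (h f)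
  obtain ⟨U, hU, -⟩ := exists_extension_norm_eq _ (φ.mkContinuous C hnorm)
  exact ⟨U, fun f => (hU ⟨j f, f, rfl⟩).trans (hval f)⟩

omit [FiniteDimensional ℝ V] [MeasureSpace V] [BorelSpace V]
  [(volume : Measure V).IsAddHaarMeasure] in
/-- A tempered distribution is a continuous functional of finitely many weighted jets. -/
theorem exists_jetSpace_functional (T : 𝓢'(V, ℂ)) :
    ∃ (s : Finset (ℕ × ℕ)) (U : JetSpace V s →L[ℂ] ℂ), ∀ f, U (jets s f) = T f := by
  obtain ⟨s, C, hC0, hC⟩ := Seminorm.bound_of_continuous (schwartz_withSeminorms ℂ V ℂ)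
    ((normSeminorm ℂ ℂ).comp T.toLinearMap) (continuous_norm.comp T.continuous)
  refine ⟨s, exists_clm_comp_eq (jets s) T.toLinearMap C fun f => (hC f).trans ?_⟩
  change (C : ℝ) * _ ≤ _
  gcongr
  refine Seminorm.finset_sup_apply_le (norm_nonneg _) fun i hi => ?_
  exact (seminorm_le_norm_weightedJet i.1 i.2 f).trans (norm_le_pi_norm (jets s f) ⟨i, hi⟩)

/-- A tempered distribution which annihilates all translates of the members of a family of
nonnegative test functions concentrating at the origin vanishes. -/
theorem eq_zero_of_translates (T : 𝓢'(V, ℂ))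
    (h : ∀ ε > 0, ∃ (G : 𝓢(V, ℂ)) (g : V → ℝ), (∀ w, G w = (g w : ℂ)) ∧ (∀ w, 0 ≤ g w) ∧
      0 < g 0 ∧ (∀ w, ε ≤ ‖w‖ → g w = 0) ∧ ∀ w, T (translate w G) = 0) : T = 0 := by
  obtain ⟨s, U, hU⟩ := exists_jetSpace_functional T
  ext f
  by_contra hf
  change T f ≠ 0 at hf
  set z := T f with hz
  set F : V → ℝ := fun w => ((starRingEnd ℂ) z * T (translate w f)).re with hF
  have hcont : Continuous fun w => T (translate w f) := by
    simp only [← hU]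
    exact U.continuous.comp
      (continuous_pi fun i => continuous_weightedJet_translate f i.1.1 i.1.2)
  have hFc : Continuous F := Complex.continuous_re.comp (continuous_const.mul hcont)
  have hF0 : 0 < F 0 := by
    have : translate 0 f = f := by simp [translate]
    simp only [hF, this, ← hz]
    rw [mul_comm, Complex.mul_conj, Complex.ofReal_re]
    exact Complex.normSq_pos.2 hf
  obtain ⟨ε, hε, hball⟩ := Metric.eventually_nhds_iff.1
    (hFc.continuousAt.eventually (eventually_gt_nhds hF0))
  obtain ⟨G, g, hGg, hg0, hgpos, hgε, hT⟩ := h ε hε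
  have hint := integrable_smul_jets_translate s G f
  have h0 : ∫ w, G w * T (translate w f) = 0 := by
    have h1 := U.integral_comp_comm hint
    rw [integral_smul_jets_translate_comm, ← U.integral_comp_comm
      (integrable_smul_jets_translate s f G)] at h1
    simp only [map_smul, hU, hT, smul_eq_mul, mul_zero, integral_zero] at h1
    exact h1
  have hint2 : Integrable fun w => (starRingEnd ℂ) z * (G w * T (translate w f)) := by
    have := (U.integrable_comp hint).const_mul ((starRingEnd ℂ) z)
    simpa only [map_smul, hU, smul_eq_mul] using this
  have h2 : ∫ w, g w * F w = 0 := by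
    have h3 := Complex.reCLM.integral_comp_comm hint2
    rw [integral_const_mul, h0, mul_zero, map_zero] at h3
    rw [← h3]
    refine integral_congr_ae (Filter.Eventually.of_forall fun w => ?_)
    simp only [hF, hGg, Complex.reCLM_apply, mul_left_comm _ (g w : ℂ), Complex.re_ofReal_mul]
  have hgc : Continuous g := by
    have : g = fun w => (G w).re := funext fun w => by rw [hGg, Complex.ofReal_re]
    rw [this]
    exact Complex.continuous_re.comp G.continuous
  have hpos := Continuous.integral_pos_of_hasCompactSupport_nonneg_nonzero
    (μ := (volume : Measure V))
    (f := fun w => g w * F w) (x := 0) (hgc.mul hFc)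
    (HasCompactSupport.intro (isCompact_closedBall (0 : V) ε) fun w hw => by
      rw [hgε w (by simpa using (not_le.1 (fun h => hw (mem_closedBall_zero_iff.2 h))).le),
        zero_mul])
    (fun w => by
      rcases lt_or_ge ‖w‖ ε with hw | hw
      · exact mul_nonneg (hg0 w) (hball (by simpa using hw)).le
      · simp [hgε w hw])
    (mul_pos hgpos hF0).ne'
  exact hpos.ne' h2

end Translates


/-! ### Oscillatory distributions -/

section OscDistribution

open scoped LineDeriv

variable {J X E : Type*} [NormedAddCommGroup X] [NormedSpace ℝ X] [FiniteDimensional ℝ X]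
  [NormedAddCommGroup E] [NormedSpace ℝ E] [FiniteDimensional ℝ E]
  [MeasureSpace X] [MeasureSpace E] [BorelSpace E]
  [(volume : Measure E).IsAddHaarMeasure]
  [BorelSpace (X × E)] [(volume : Measure (X × E)).IsAddHaarMeasure]
  {L : X × E →L[ℝ] E →L[ℝ] ℝ} {b : X × E → ℂ}

/-- A bounded continuous function times a Schwartz function is integrable. -/
theorem integrable_mul_schwartz {V : Type*} [NormedAddCommGroup V] [NormedSpace ℝ V]
    [MeasurableSpace V] [BorelSpace V] {μ : Measure V} [μ.HasTemperateGrowth]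
    [SecondCountableTopology V] {F : V → ℂ} {B : ℝ} (hF : Continuous F)
    (hB : ∀ w, ‖F w‖ ≤ B) (Φ : 𝓢(V, ℂ)) : Integrable (fun w => F w * Φ w) μ :=
  Φ.integrable.bdd_mul hF.aestronglyMeasurable (Filter.Eventually.of_forall hB)

omit [FiniteDimensional ℝ X] [MeasureSpace X] [BorelSpace (X × E)]
  [(volume : Measure (X × E)).IsAddHaarMeasure] in
theorem norm_osc_le_of_vanish {B r : ℝ} (hB : ∀ v, ‖b v‖ ≤ B)
    (h : ∀ v : X × E, r < ‖v.2‖ → b v = 0) (w : X × E) :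
    ‖osc L b w‖ ≤ B * ∫ _ in {Ξ : E | r < ‖Ξ‖}ᶜ, (1 : ℝ) := by
  have hc : IsCompact ({Ξ : E | r < ‖Ξ‖}ᶜ) := by
    have : ({Ξ : E | r < ‖Ξ‖}ᶜ) = Metric.closedBall 0 r := by ext; simp
    rw [this]
    exact isCompact_closedBall _ _
  have := norm_osc_le (L := L) (C := B) (r := 0) (isOpen_lt_norm r).measurableSet
    (by simpa using hB) h
    (by simpa using hc.measure_lt_top (μ := volume)) w
  simpa using this

omit [FiniteDimensional ℝ X] [FiniteDimensional ℝ E] [MeasureSpace X]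
  [MeasureSpace E] [BorelSpace E]
  [(volume : Measure E).IsAddHaarMeasure]
  [BorelSpace (X × E)] [(volume : Measure (X × E)).IsAddHaarMeasure] in
theorem ampDeriv_zero_fst (e : E) :
    ampDeriv L ((0, e) : X × E) b = fun v => Complex.I * ((L (0, e) v.2 : ℝ) : ℂ) * b v := by
  funext v
  have : dirDeriv (((0 : X), (0 : E)) : X × E) b v = 0 := by
    simp [dirDeriv, lineDeriv]
  simp only [ampDeriv, this, zero_add]

omit [FiniteDimensional ℝ X] [FiniteDimensional ℝ E] [MeasureSpace X]
  [MeasureSpace E] [BorelSpace E]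
  [(volume : Measure E).IsAddHaarMeasure]
  [BorelSpace (X × E)] [(volume : Measure (X × E)).IsAddHaarMeasure] in
theorem exists_bound_ampDeriv_zero_fst {r : ℝ} (hB : ∃ B, ∀ v, ‖b v‖ ≤ B)
    (h : ∀ v : X × E, r < ‖v.2‖ → b v = 0) (e : E) :
    ∃ B, ∀ v, ‖ampDeriv L ((0, e) : X × E) b v‖ ≤ B := by
  obtain ⟨B, hB⟩ := hB
  refine ⟨‖L ((0, e) : X × E)‖ * |r| * B, fun v => ?_⟩
  have hB0 : 0 ≤ B := (norm_nonneg _).trans (hB v)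
  rcases lt_or_ge r ‖v.2‖ with hv | hv
  · rw [ampDeriv_vanish (isOpen_lt_norm r) h _ v hv, norm_zero]; positivity
  · simp only [ampDeriv_zero_fst, norm_mul, Complex.norm_I, one_mul, Complex.norm_real]
    gcongr
    · exact ((L ((0, e) : X × E)).le_opNorm v.2).trans (by gcongr; exact hv.trans (le_abs_self r))
    · exact hB v

/-- Integration by parts against a Schwartz function, in a direction in which the amplitude is
constant. -/
theorem integral_osc_mul_lineDerivOp {r : ℝ} (hb : ContDiff ℝ ∞ b) (hB : ∃ B, ∀ v, ‖b v‖ ≤ B)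
    (h : ∀ v : X × E, r < ‖v.2‖ → b v = 0) (e : E) (Φ : 𝓢(X × E, ℂ)) :
    ∫ w, osc L b w * (∂_{((0, e) : X × E)} Φ : 𝓢(X × E, ℂ)) w =
      -∫ w, osc L (ampDeriv L ((0, e) : X × E) b) w * Φ w := by
  have hb's := contDiff_ampDeriv (L := L) hb ((0, e) : X × E)
  have hb'v := ampDeriv_vanish (L := L) (isOpen_lt_norm r) h ((0, e) : X × E)
  obtain ⟨B', hb'B⟩ := exists_bound_ampDeriv_zero_fst (L := L) hB h e
  obtain ⟨B, hB⟩ := hB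
  have hc := continuous_osc_of_vanish (L := L) hb h
  have hc' := continuous_osc_of_vanish (L := L) hb's hb'v
  have key := integral_bilinear_hasLineDerivAt_right_eq_neg_left_of_integrable
    (μ := (volume : Measure (X × E))) (B := ContinuousLinearMap.mul ℝ ℂ) (v := ((0, e) : X × E))
    (f := osc L b) (f' := osc L (ampDeriv L ((0, e) : X × E) b)) (g := Φ)
    (g' := (∂_{((0, e) : X × E)} Φ : 𝓢(X × E, ℂ)))
    (integrable_mul_schwartz hc' (norm_osc_le_of_vanish hb'B hb'v) Φ)
    (integrable_mul_schwartz hc (norm_osc_le_of_vanish hB h) (∂_{((0, e) : X × E)} Φ : 𝓢(X × E, ℂ)))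
    (integrable_mul_schwartz hc (norm_osc_le_of_vanish hB h) Φ)
    (fun w _ => by
      obtain ⟨D, hD, hDe⟩ := hasFDerivAt_osc (L := L) hb h w
      have := hD.hasLineDerivAt ((0, e) : X × E)
      rwa [hDe] at this)
    (fun w _ => by
      have := (Φ.differentiableAt (x := w)).hasFDerivAt.hasLineDerivAt ((0, e) : X × E)
      rwa [← SchwartzMap.lineDerivOp_apply_eq_fderiv] at this)
  simpa only [ContinuousLinearMap.mul_apply'] using key

/-- The truncated oscillatory integrals with amplitude `b` converge to the distribution `T`. -/
def IsOscLimit (L : X × E →L[ℝ] E →L[ℝ] ℝ) (b : X × E → ℂ) (T : 𝓢'(X × E, ℂ)) : Prop :=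
  ∀ Φ : 𝓢(X × E, ℂ), Filter.Tendsto (fun k : ℕ => ∫ w, osc L (cut ((k : ℝ) + 1) b) w * Φ w)
    Filter.atTop (nhds (T Φ))

omit [FiniteDimensional ℝ X] [MeasureSpace X] [MeasureSpace E] [BorelSpace E]
  [(volume : Measure E).IsAddHaarMeasure]
  [BorelSpace (X × E)] [(volume : Measure (X × E)).IsAddHaarMeasure] in
theorem exists_bound_cut {C r : ℝ} (hb : ∀ v, ‖b v‖ ≤ C * (1 + ‖v.2‖) ^ r) {R : ℝ} (hR : 0 < R) :
    ∃ B, ∀ v, ‖cut R b v‖ ≤ B := by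
  refine ⟨C * (1 + 2 * R) ^ |r|, fun v => ?_⟩
  have hC : 0 ≤ C := by
    by_contra hC
    have h1 := (norm_nonneg _).trans (hb v)
    have h2 : 0 < (1 + ‖v.2‖) ^ r := by positivity
    nlinarith
  rcases le_total (2 * R) ‖v.2‖ with hv | hv
  · rw [cut, freqCutoff_eq_zero hR hv, zero_mul, norm_zero]; positivity
  · refine (norm_cut_le b R v).trans ((hb v).trans ?_)
    gcongr
    exact (Real.rpow_le_rpow_of_exponent_le (by linarith [norm_nonneg v.2]) (le_abs_self r)).trans
      (by gcongr)

theorem IsOscLimit.base {C r : ℝ} (hr : r + Module.finrank ℝ E < 0) (hbs : ContDiff ℝ ∞ b)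
    (hb : ∀ v, ‖b v‖ ≤ C * (1 + ‖v.2‖) ^ r) : ∃ T, IsOscLimit L b T := by
  have hint : Integrable fun Ξ : E => C * (1 + ‖Ξ‖) ^ r :=
    (integrable_one_add_norm_rpow hr).const_mul C
  have hc : Continuous (osc L b) := continuous_osc hbs.continuous hint hb
  have hbound : ∀ b' : X × E → ℂ, (∀ v, ‖b' v‖ ≤ C * (1 + ‖v.2‖) ^ r) →
      ∀ w, ‖osc L b' w‖ ≤ ∫ Ξ : E, C * (1 + ‖Ξ‖) ^ r := fun b' hb' w =>
    norm_integral_le_of_norm_le hint (Filter.Eventually.of_forall fun Ξ => by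
      rw [norm_mul, norm_phase, mul_one]; exact hb' (w.1, Ξ))
  have hmem : MemLp (osc L b) ⊤ (volume : Measure (X × E)) :=
    memLp_top_of_bound hc.aestronglyMeasurable _ (Filter.Eventually.of_forall (hbound b hb))
  refine ⟨Lp.toTemperedDistribution (hmem.toLp), fun Φ => ?_⟩
  have hval : Lp.toTemperedDistribution (hmem.toLp) Φ = ∫ w, osc L b w * Φ w := by
    rw [Lp.toTemperedDistribution_apply]
    refine integral_congr_ae ?_
    filter_upwards [hmem.coeFn_toLp] with w hw
    rw [hw, smul_eq_mul, mul_comm]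
  rw [hval]
  have hk : ∀ k : ℕ, (0 : ℝ) < (k : ℝ) + 1 := fun k => by positivity
  refine tendsto_integral_of_dominated_convergence
    (fun w => (∫ Ξ : E, C * (1 + ‖Ξ‖) ^ r) * ‖Φ w‖) (fun k => ?_)
    (Φ.integrable.norm.const_mul _)
    (fun k => Filter.Eventually.of_forall fun w => ?_) (Filter.Eventually.of_forall fun w => ?_)
  · exact ((continuous_osc_of_vanish (contDiff_cut hbs _)
      (cut_vanish b (hk k))).mul Φ.continuous).aestronglyMeasurable
  · rw [norm_mul]
    gcongr
    exact hbound _ (fun v => (norm_cut_le b _ v).trans (hb v)) w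
  · refine Filter.Tendsto.mul_const _ ?_
    refine tendsto_integral_of_dominated_convergence (fun Ξ : E => C * (1 + ‖Ξ‖) ^ r)
      (fun k => (integrable_slice (contDiff_cut hbs _).continuous
        (cut_vanish b (hk k)) w).aestronglyMeasurable) hint
      (fun k => Filter.Eventually.of_forall fun Ξ => ?_) (Filter.Eventually.of_forall fun Ξ => ?_)
    · rw [norm_mul, norm_phase, mul_one]
      exact (norm_cut_le b _ _).trans (hb (w.1, Ξ))
    · refine tendsto_const_nhds.congr' ?_
      filter_upwards [Filter.eventually_ge_atTop ⌈‖Ξ‖⌉₊] with k hk'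
      have : ‖Ξ‖ ≤ (k : ℝ) + 1 :=
        (Nat.le_ceil _).trans ((Nat.cast_le.2 hk').trans (by linarith))
      rw [cut, freqCutoff_eq_one (hk k) this, one_mul]

/-- An elliptic polynomial of degree two in the frequency variable. -/
noncomputable def freqWeight [Fintype J] (L : X × E →L[ℝ] E →L[ℝ] ℝ) (e : J → E) (Ξ : E) : ℝ :=
  1 + ∑ j, (L (0, e j) Ξ) ^ 2

theorem IsOscLimit.freqWeight_mul [Fintype J] (e : J → E) {C r : ℝ} (hbs : ContDiff ℝ ∞ b)
    (hb : ∀ v, ‖b v‖ ≤ C * (1 + ‖v.2‖) ^ r) {T : 𝓢'(X × E, ℂ)} (h : IsOscLimit L b T) :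
    ∃ T, IsOscLimit L (fun v => ((freqWeight L e v.2 : ℝ) : ℂ) * b v) T := by
  refine ⟨T - ∑ j, ∂_{((0, e j) : X × E)} (∂_{((0, e j) : X × E)} T), fun Φ => ?_⟩
  have hlim := (h Φ).sub (tendsto_finsetSum Finset.univ fun j _ =>
    h (∂_{((0, e j) : X × E)} (∂_{((0, e j) : X × E)} Φ)))
  have hT : (T - ∑ j, ∂_{((0, e j) : X × E)} (∂_{((0, e j) : X × E)} T)) Φ =
      T Φ - ∑ j, T (∂_{((0, e j) : X × E)} (∂_{((0, e j) : X × E)} Φ)) := by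
    rw [sub_apply, sum_apply]
    congr 1
    refine Finset.sum_congr rfl fun j _ => ?_
    rw [TemperedDistribution.lineDerivOp_apply_apply, TemperedDistribution.lineDerivOp_apply_apply,
      LineDeriv.lineDerivOp_neg, neg_neg]
  rw [hT]
  refine hlim.congr fun k => ?_
  have hk : (0 : ℝ) < (k : ℝ) + 1 := by positivity
  have hcB := exists_bound_cut hb hk
  have hcs : ContDiff ℝ ∞ (cut ((k : ℝ) + 1) b) := contDiff_cut hbs _
  have hcv := cut_vanish b hk
  set c := cut ((k : ℝ) + 1) b with hc
  set c' : J → X × E → ℂ := fun j => ampDeriv L ((0, e j) : X × E) c with hc'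
  have hcs' : ∀ j, ContDiff ℝ ∞ (c' j) := fun j => contDiff_ampDeriv hcs _
  have hcv' := fun j => ampDeriv_vanish (L := L) (isOpen_lt_norm _) hcv ((0, e j) : X × E)
  have hcB' := fun j => exists_bound_ampDeriv_zero_fst (L := L) hcB hcv (e j)
  set c'' : J → X × E → ℂ := fun j => ampDeriv L ((0, e j) : X × E) (c' j) with hc''
  have hcs'' : ∀ j, ContDiff ℝ ∞ (c'' j) := fun j => contDiff_ampDeriv (hcs' j) _
  have hcv'' := fun j => ampDeriv_vanish (L := L) (isOpen_lt_norm _) (hcv' j) ((0, e j) : X × E)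
  have hcB'' := fun j => exists_bound_ampDeriv_zero_fst (L := L) (hcB' j) (hcv' j) (e j)
  have h2 : ∀ j, ∫ w, osc L c w *
      (∂_{((0, e j) : X × E)} (∂_{((0, e j) : X × E)} Φ) : 𝓢(X × E, ℂ)) w =
      ∫ w, osc L (c'' j) w * Φ w := fun j => by
    rw [integral_osc_mul_lineDerivOp hcs hcB hcv,
      integral_osc_mul_lineDerivOp (hcs' j) (hcB' j) (hcv' j), neg_neg]
  have hosc : ∀ w, osc L (cut ((k : ℝ) + 1) fun v => ((freqWeight L e v.2 : ℝ) : ℂ) * b v) w =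
      osc L c w - ∑ j, osc L (c'' j) w := fun w => by
    simp only [osc]
    rw [← integral_finsetSum _ fun j _ => integrable_slice (hcs'' j).continuous (hcv'' j) w,
      ← integral_sub (integrable_slice hcs.continuous hcv w)
        (integrable_finsetSum _ fun j _ => integrable_slice (hcs'' j).continuous (hcv'' j) w)]
    congr 1
    funext Ξ
    rw [← Finset.sum_mul, ← sub_mul]
    congr 1
    simp only [hc'', hc', ampDeriv_zero_fst]
    have : ∀ j, Complex.I * ((L ((0, e j) : X × E) Ξ : ℝ) : ℂ) *
        (Complex.I * ((L ((0, e j) : X × E) Ξ : ℝ) : ℂ) * c (w.1, Ξ)) =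
        -(((L ((0, e j) : X × E) Ξ : ℝ) : ℂ) ^ 2 * c (w.1, Ξ)) := fun j => by
      linear_combination ((L ((0, e j) : X × E) Ξ : ℝ) : ℂ) ^ 2 * c (w.1, Ξ) * Complex.I_sq
    simp only [this, Finset.sum_neg_distrib, ← Finset.sum_mul]
    simp only [hc, cut, freqWeight]
    push_cast
    ring
  have hi : ∀ {c : X × E → ℂ} {r : ℝ}, ContDiff ℝ ∞ c → (∃ B, ∀ v, ‖c v‖ ≤ B) →
      (∀ v : X × E, r < ‖v.2‖ → c v = 0) → Integrable fun w => osc L c w * Φ w := by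
    rintro c r hs ⟨B, hB⟩ hv
    exact integrable_mul_schwartz (continuous_osc_of_vanish hs hv) (norm_osc_le_of_vanish hB hv) Φ
  simp only [h2, hosc, sub_mul, Finset.sum_mul]
  rw [integral_sub (hi hcs hcB hcv)
    (integrable_finsetSum _ fun j _ => hi (hcs'' j) (hcB'' j) (hcv'' j)),
    integral_finsetSum _ fun j _ => hi (hcs'' j) (hcB'' j) (hcv'' j)]

omit [FiniteDimensional ℝ X] [FiniteDimensional ℝ E] [MeasureSpace X]
  [MeasureSpace E] [BorelSpace E]
  [(volume : Measure E).IsAddHaarMeasure]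
  [BorelSpace (X × E)] [(volume : Measure (X × E)).IsAddHaarMeasure] in
theorem freqWeight_pos [Fintype J] (e : J → E) (Ξ : E) : 0 < freqWeight L e Ξ :=
  add_pos_of_pos_of_nonneg one_pos (Finset.sum_nonneg fun _ _ => sq_nonneg _)

/-- Existence of the limit distribution of truncated oscillatory integrals. -/
theorem exists_isOscLimit [Fintype J] (e : J → E) {κ : ℝ} (hκ : 0 < κ)
    (he : ∀ Ξ, κ * (1 + ‖Ξ‖) ^ 2 ≤ freqWeight L e Ξ) {C r : ℝ} (hbs : ContDiff ℝ ∞ b)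
    (hb : ∀ v, ‖b v‖ ≤ C * (1 + ‖v.2‖) ^ r) : ∃ T, IsOscLimit L b T := by
  obtain ⟨N, hN⟩ := exists_nat_gt (r + Module.finrank ℝ E)
  induction N generalizing b C r with
  | zero => exact IsOscLimit.base (by simpa using hN) hbs hb
  | succ N ih =>
    have hC : 0 ≤ C := by
      have := (norm_nonneg _).trans (hb 0)
      simpa using this
    set b' : X × E → ℂ := fun v => (((freqWeight L e v.2)⁻¹ : ℝ) : ℂ) * b v with hb'
    have hw : ContDiff ℝ ∞ fun v : X × E => freqWeight L e v.2 :=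
      contDiff_const.add (ContDiff.sum fun j _ =>
        ((L (0, e j)).contDiff.comp contDiff_snd).pow 2)
    have hbs' : ContDiff ℝ ∞ b' := (Complex.ofRealCLM.contDiff.comp
      (hw.inv fun v => (freqWeight_pos e v.2).ne')).mul hbs
    have hbb' : ∀ v, ‖b' v‖ ≤ (κ⁻¹ * C) * (1 + ‖v.2‖) ^ (r - 2) := fun v => by
      have h1 : 0 < 1 + ‖v.2‖ := by positivity
      rw [hb', norm_mul, Complex.norm_real, Real.norm_of_nonneg (by
        have := freqWeight_pos (L := L) e v.2; positivity), Real.rpow_sub h1, Real.rpow_two]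
      calc (freqWeight L e v.2)⁻¹ * ‖b v‖
          ≤ (κ * (1 + ‖v.2‖) ^ 2)⁻¹ * (C * (1 + ‖v.2‖) ^ r) := by
            gcongr
            · exact he v.2
            · exact hb v
        _ = _ := by rw [mul_inv]; ring
    obtain ⟨T, hT⟩ := ih hbs' hbb' (by push_cast at hN; linarith)
    obtain ⟨T', hT'⟩ := hT.freqWeight_mul e hbs' hbb'
    refine ⟨T', ?_⟩
    convert hT' using 1
    funext v
    rw [hb', ← mul_assoc, ← Complex.ofReal_mul, mul_inv_cancel₀ (freqWeight_pos e v.2).ne',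
      Complex.ofReal_one, one_mul]

/-- Where the truncated oscillatory integrals converge locally uniformly, the limit distribution
is given by their pointwise limit. -/
theorem IsOscLimit.apply_eq_integral {T : 𝓢'(X × E, ℂ)} (h : IsOscLimit L b T)
    (hbs : ContDiff ℝ ∞ b) {U : Set (X × E)}
    (hU : TendstoLocallyUniformlyOn (fun (k : ℕ) w => osc L (cut ((k : ℝ) + 1) b) w)
      (regKernel L b) Filter.atTop U) (Φ : 𝓢(X × E, ℂ)) (hΦ : HasCompactSupport Φ)
    (hΦU : tsupport Φ ⊆ U) : T Φ = ∫ w, regKernel L b w * Φ w := by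
  have hu := (tendstoLocallyUniformlyOn_iff_tendstoUniformlyOn_of_compact hΦ).1 (hU.mono hΦU)
  have hk : ∀ k : ℕ, (0 : ℝ) < (k : ℝ) + 1 := fun k => by positivity
  have hosc : ∀ k : ℕ, Continuous (osc L (cut ((k : ℝ) + 1) b)) := fun k =>
    continuous_osc_of_vanish (contDiff_cut hbs _) (cut_vanish b (hk k))
  have hcont : ContinuousOn (regKernel L b) (tsupport Φ) :=
    hu.continuousOn (Filter.Frequently.of_forall fun k => (hosc k).continuousOn)
  obtain ⟨B, hB⟩ := hΦ.isCompact.exists_bound_of_continuousOn hcont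
  have hzero : ∀ w ∉ tsupport Φ, Φ w = 0 := fun w => image_eq_zero_of_notMem_tsupport
  refine tendsto_nhds_unique (h Φ) ?_
  refine tendsto_integral_filter_of_dominated_convergence (fun w => (B + 1) * ‖Φ w‖)
    (Filter.Eventually.of_forall fun k =>
      ((hosc k).mul Φ.continuous).aestronglyMeasurable) ?_ (Φ.integrable.norm.const_mul _)
    (Filter.Eventually.of_forall fun w => ?_)
  · filter_upwards [Metric.tendstoUniformlyOn_iff.1 hu 1 one_pos] with k hk'
    refine Filter.Eventually.of_forall fun w => ?_
    by_cases hw : w ∈ tsupport Φ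
    · rw [norm_mul]
      gcongr
      have h1 := hk' w hw
      rw [dist_comm, dist_eq_norm] at h1
      have h2 := hB w hw
      have h3 := norm_add_le (osc L (cut ((k : ℝ) + 1) b) w - regKernel L b w) (regKernel L b w)
      rw [sub_add_cancel] at h3
      linarith
    · rw [hzero w hw]; simp
  · by_cases hw : w ∈ tsupport Φ
    · exact (hu.tendsto_at hw).mul_const _
    · rw [hzero w hw]; simp

end OscDistribution


/-! ### The kernel of a bilinear pseudodifferential operator -/

section Kernel

variable {n : ℕ}

instance isAddHaarMeasure_volume_prod {D E : Type*} [NormedAddCommGroup D] [NormedSpace ℝ D]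
    [FiniteDimensional ℝ D] [MeasureSpace D] [BorelSpace D] [(volume : Measure D).IsAddHaarMeasure]
    [NormedAddCommGroup E] [NormedSpace ℝ E] [FiniteDimensional ℝ E] [MeasureSpace E] [BorelSpace E]
    [(volume : Measure E).IsAddHaarMeasure] : (volume : Measure (D × E)).IsAddHaarMeasure :=
  inferInstanceAs ((volume : Measure D).prod (volume : Measure E)).IsAddHaarMeasure

/-- The bilinear form `(x - y) · ξ + (x - z) · η`. -/
noncomputable def phaseForm (n : ℕ) : Rn3 n →L[ℝ] (Rn n × Rn n) →L[ℝ] ℝ :=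
  LinearMap.toContinuousLinearMap (LinearMap.toContinuousLinearMap.toLinearMap ∘ₗ
    LinearMap.mk₂ ℝ (fun (w : Rn3 n) (Ξ : Rn n × Rn n) =>
      inner ℝ (w.1 - w.2.1) Ξ.1 + inner ℝ (w.1 - w.2.2) Ξ.2)
      (fun w w' Ξ => by
        simp only [Prod.fst_add, Prod.snd_add, add_sub_add_comm, inner_add_left]; ring)
      (fun c w Ξ => by
        simp only [Prod.smul_fst, Prod.smul_snd, ← smul_sub, real_inner_smul_left, smul_eq_mul]
        ring)
      (fun w Ξ Ξ' => by simp only [Prod.fst_add, Prod.snd_add, inner_add_right]; ring)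
      (fun c w Ξ => by
        simp only [Prod.smul_fst, Prod.smul_snd, real_inner_smul_right, smul_eq_mul]; ring))

theorem phaseForm_apply (w : Rn3 n) (Ξ : Rn n × Rn n) :
    phaseForm n w Ξ = inner ℝ (w.1 - w.2.1) Ξ.1 + inner ℝ (w.1 - w.2.2) Ξ.2 := rfl

/-- The standard basis of `ℝⁿ × ℝⁿ`. -/
noncomputable def pairBasis (n : ℕ) : Fin n ⊕ Fin n → Rn n × Rn n :=
  Sum.elim (fun i => (unitVec i, 0)) fun i => (0, unitVec i)

theorem inner_unitVec (x : Rn n) (i : Fin n) : inner ℝ x (unitVec i) = x i := by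
  simp [unitVec, EuclideanSpace.inner_single_right]

theorem phaseSize_phaseForm (w : Rn3 n) : phaseSize (phaseForm n) (pairBasis n) w =
    ∑ i, |(w.1 - w.2.1) i| + ∑ i, |(w.1 - w.2.2) i| := by
  simp only [phaseSize, Fintype.sum_sum_type, pairBasis, Sum.elim_inl, Sum.elim_inr,
    phaseForm_apply, inner_zero_right, add_zero, zero_add, inner_unitVec]

theorem norm_le_sum_abs (x : Rn n) : ‖x‖ ≤ ∑ i, |x i| := by
  conv_lhs => rw [eq_sum_smul_unitVec x]
  refine (norm_sum_le _ _).trans (Finset.sum_le_sum fun i _ => ?_)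
  rw [norm_smul, Real.norm_eq_abs]
  simp [unitVec]

theorem sum_abs_le_mul_norm (x : Rn n) : ∑ i, |x i| ≤ n * ‖x‖ := by
  refine (Finset.sum_le_card_nsmul _ _ ‖x‖ fun i _ => ?_).trans (by simp)
  exact PiLp.norm_apply_le x i

theorem sumDist_le_phaseSize (w : Rn3 n) :
    sumDist w.1 w.2.1 w.2.2 ≤ 2 * phaseSize (phaseForm n) (pairBasis n) w := by
  rw [phaseSize_phaseForm, sumDist]
  have h1 := norm_le_sum_abs (w.1 - w.2.1)
  have h2 := norm_le_sum_abs (w.1 - w.2.2)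
  have h3 : ‖w.2.1 - w.2.2‖ ≤ ‖w.1 - w.2.1‖ + ‖w.1 - w.2.2‖ := by
    have := norm_sub_le (w.1 - w.2.2) (w.1 - w.2.1)
    rw [sub_sub_sub_cancel_left] at this
    linarith
  linarith

theorem phaseSize_le_sumDist (w : Rn3 n) :
    phaseSize (phaseForm n) (pairBasis n) w ≤ n * sumDist w.1 w.2.1 w.2.2 := by
  rw [phaseSize_phaseForm, sumDist]
  have h1 := sum_abs_le_mul_norm (w.1 - w.2.1)
  have h2 := sum_abs_le_mul_norm (w.1 - w.2.2)
  have h3 : 0 ≤ n * ‖w.2.1 - w.2.2‖ := by positivity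
  rw [mul_add, mul_add]
  linarith

theorem half_mul_sq_le_freqWeight (Ξ : Rn n × Rn n) :
    1 / 2 * (1 + ‖Ξ‖) ^ 2 ≤ freqWeight (phaseForm n) (pairBasis n) Ξ := by
  have h : freqWeight (phaseForm n) (pairBasis n) Ξ = 1 + (‖Ξ.1‖ ^ 2 + ‖Ξ.2‖ ^ 2) := by
    simp only [freqWeight, Fintype.sum_sum_type, pairBasis, Sum.elim_inl, Sum.elim_inr,
      phaseForm_apply, EuclideanSpace.norm_sq_eq, zero_sub, inner_neg_left, neg_zero,
      real_inner_comm _ (unitVec _), inner_unitVec, inner_zero_left, add_zero, zero_add, neg_sq,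
      Real.norm_eq_abs, sq_abs]
  have h2 : ‖Ξ‖ ^ 2 ≤ ‖Ξ.1‖ ^ 2 + ‖Ξ.2‖ ^ 2 := by
    rcases max_cases ‖Ξ.1‖ ‖Ξ.2‖ with h | h
    · rw [Prod.norm_def, h.1]; exact le_add_of_nonneg_right (by positivity)
    · rw [Prod.norm_def, h.1]; exact le_add_of_nonneg_left (by positivity)
  rw [h]
  nlinarith [sq_nonneg (1 - ‖Ξ‖)]

/-! ### Uniqueness of distributional kernels -/

theorem translate_tensor {D E : Type*} [NormedAddCommGroup D] [NormedSpace ℝ D]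
    [NormedAddCommGroup E] [NormedSpace ℝ E] (f : 𝓢(D, ℂ)) (g : 𝓢(E, ℂ)) (w : D × E) :
    translate w (tensor f g) = tensor (translate w.1 f) (translate w.2 g) := rfl

theorem exists_bump_schwartz (n : ℕ) {ε : ℝ} (hε : 0 < ε) :
    ∃ (G : 𝓢(Rn n, ℂ)) (g : Rn n → ℝ), (∀ x, G x = (g x : ℂ)) ∧ (∀ x, 0 ≤ g x) ∧ 0 < g 0 ∧
      ∀ x, ε ≤ ‖x‖ → g x = 0 := by
  set f : ContDiffBump (0 : Rn n) := ⟨ε / 2, ε, by positivity, by linarith⟩ with hf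
  have hs : ContDiff ℝ ∞ fun x => (f x : ℂ) := Complex.ofRealCLM.contDiff.comp f.contDiff
  have hc : HasCompactSupport fun x => (f x : ℂ) :=
    f.hasCompactSupport.comp_left (g := Complex.ofReal) Complex.ofReal_zero
  refine ⟨hc.toSchwartzMap hs, f, fun x => rfl, fun x => f.nonneg,
    f.pos_of_mem_ball (Metric.mem_ball_self hε), fun x hx => f.zero_of_le_dist ?_⟩
  rwa [dist_zero_right]

/-- A tempered distribution is determined by its values on tensor products. -/
theorem eq_zero_of_tensor (T : 𝓢'(Rn3 n, ℂ))
    (h : ∀ f g h : 𝓢(Rn n, ℂ), T (tensor h (tensor f g)) = 0) : T = 0 := by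
  refine eq_zero_of_translates T fun ε hε => ?_
  obtain ⟨G, g, hG, hg0, hgpos, hgε⟩ := exists_bump_schwartz n hε
  refine ⟨tensor G (tensor G G), fun w => g w.1 * (g w.2.1 * g w.2.2), fun w => ?_,
    fun w => mul_nonneg (hg0 _) (mul_nonneg (hg0 _) (hg0 _)),
    mul_pos hgpos (mul_pos hgpos hgpos), fun w hw => ?_, fun w => ?_⟩
  · change G w.1 * (G w.2.1 * G w.2.2) = _
    simp only [hG, Complex.ofReal_mul]
  · rw [Prod.norm_def, Prod.norm_def, le_max_iff, le_max_iff] at hw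
    rcases hw with hw | hw | hw <;> simp [hgε _ hw]
  · rw [translate_tensor, translate_tensor]
    exact h _ _ _

theorem IsDistribKernel.unique {p : Rn3 n → ℂ} {k k' : 𝓢'(Rn3 n, ℂ)} (h : IsDistribKernel p k)
    (h' : IsDistribKernel p k') : k = k' :=
  sub_eq_zero.1 <| eq_zero_of_tensor _ fun f g φ => by rw [sub_apply, h f g φ, h' f g φ, sub_self]

/-! ### The action on tensor products -/

/-- The Fourier transform `f̂` of a Schwartz function, as a Schwartz function. -/
noncomputable def fhatSchwartz (f : 𝓢(Rn n, ℂ)) : 𝓢(Rn n, ℂ) :=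
  (((2 * Real.pi) ^ n : ℝ) : ℂ)⁻¹ • SchwartzMap.compCLMOfContinuousLinearEquiv ℂ
    (ContinuousLinearEquiv.smulLeft (Units.mk0 ((2 * Real.pi)⁻¹ : ℝ) (by positivity)))
    (FourierTransform.fourier f : 𝓢(Rn n, ℂ))

theorem fhatSchwartz_apply (f : 𝓢(Rn n, ℂ)) (ξ : Rn n) : fhatSchwartz f ξ = fhat f ξ := by
  change (((2 * Real.pi) ^ n : ℝ) : ℂ)⁻¹ *
    (FourierTransform.fourier f : 𝓢(Rn n, ℂ)) ((2 * Real.pi)⁻¹ • ξ) = _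
  rw [SchwartzMap.fourier_coe, Real.fourier_eq', fhat]
  congr 2
  funext x
  rw [smul_eq_mul, real_inner_smul_right]
  congr 2
  push_cast
  field_simp

/-- The integrand of `∫ T_p(f, g) h` on `ℝⁿ × ℝ²ⁿ`. -/
noncomputable def tensorIntegrand (p : Rn3 n → ℂ) (f g h : 𝓢(Rn n, ℂ)) (v : Rn3 n) : ℂ :=
  p v * fhat f v.2.1 * fhat g v.2.2 *
    Complex.exp (Complex.I * ((inner ℝ v.1 (v.2.1 + v.2.2) : ℝ) : ℂ)) * h v.1

theorem tensorIntegrand_eq (p : Rn3 n → ℂ) (f g h : 𝓢(Rn n, ℂ)) (v : Rn3 n) :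
    tensorIntegrand p f g h v = p v * tensor (fhatSchwartz f) (fhatSchwartz g) v.2 *
      Complex.exp (Complex.I * ((inner ℝ v.1 (v.2.1 + v.2.2) : ℝ) : ℂ)) * h v.1 := by
  change _ = p v * (fhatSchwartz f v.2.1 * fhatSchwartz g v.2.2) * _ * _
  rw [fhatSchwartz_apply, fhatSchwartz_apply, tensorIntegrand]
  ring

theorem continuous_tensorIntegrand {p : Rn3 n → ℂ} (hp : Continuous p) (f g h : 𝓢(Rn n, ℂ)) :
    Continuous (tensorIntegrand p f g h) := by
  rw [funext (tensorIntegrand_eq p f g h)]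
  have h1 : Continuous fun v : Rn3 n => (inner ℝ v.1 (v.2.1 + v.2.2) : ℝ) := by fun_prop
  exact ((hp.mul ((tensor (fhatSchwartz f) (fhatSchwartz g)).continuous.comp continuous_snd)).mul
    (Complex.continuous_exp.comp (continuous_const.mul (Complex.continuous_ofReal.comp h1)))).mul
    (h.continuous.comp continuous_fst)

/-- An integrable majorant of a Schwartz function times a power of the variable. -/
theorem exists_integrable_bound_schwartz {E : Type*} [NormedAddCommGroup E] [NormedSpace ℝ E]
    [FiniteDimensional ℝ E] [MeasureSpace E] [BorelSpace E]
    [(volume : Measure E).IsAddHaarMeasure] (G : 𝓢(E, ℂ)) (m : ℝ) :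
    ∃ b : E → ℝ, Integrable b ∧ ∀ Ξ, (1 + ‖Ξ‖) ^ m * ‖G Ξ‖ ≤ b Ξ := by
  obtain ⟨k, hk⟩ := exists_nat_gt (m + Module.finrank ℝ E)
  obtain ⟨A, hA0, hA⟩ := exists_one_add_norm_pow_mul_le G k 0
  refine ⟨fun Ξ => A * (1 + ‖Ξ‖) ^ (m - k),
    (integrable_one_add_norm_rpow (by linarith)).const_mul A, fun Ξ => ?_⟩
  have h1 : 0 < 1 + ‖Ξ‖ := by positivity
  have h2 := hA Ξ
  rw [norm_iteratedFDeriv_zero] at h2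
  change _ ≤ A * (1 + ‖Ξ‖) ^ (m - k)
  rw [Real.rpow_sub h1, Real.rpow_natCast]
  calc (1 + ‖Ξ‖) ^ m * ‖G Ξ‖
      = ((1 + ‖Ξ‖) ^ k * ‖G Ξ‖) * ((1 + ‖Ξ‖) ^ m / (1 + ‖Ξ‖) ^ k) := by field_simp
    _ ≤ _ := by gcongr

theorem integrable_tensorIntegrand {p : Rn3 n → ℂ} (hp : Continuous p) {C m : ℝ}
    (hb : ∀ v : Rn3 n, ‖p v‖ ≤ C * (1 + ‖v.2‖) ^ m) (f g h : 𝓢(Rn n, ℂ)) :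
    Integrable (tensorIntegrand p f g h) ∧
      ∀ x, Integrable fun Ξ => tensorIntegrand p f g h (x, Ξ) := by
  obtain ⟨b, hbi, hbb⟩ := exists_integrable_bound_schwartz
    (tensor (fhatSchwartz f) (fhatSchwartz g)) m
  have hC : 0 ≤ C := by
    have := (norm_nonneg _).trans (hb 0)
    simpa using this
  have hc := continuous_tensorIntegrand hp f g h
  have hle : ∀ v, ‖tensorIntegrand p f g h v‖ ≤ ‖h v.1‖ * (C * b v.2) := by
    intro v
    rw [tensorIntegrand_eq, norm_mul, norm_mul, norm_mul, mul_comm Complex.I,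
      Complex.norm_exp_ofReal_mul_I, mul_one, mul_comm]
    refine mul_le_mul_of_nonneg_left ?_ (norm_nonneg _)
    refine (mul_le_mul_of_nonneg_right (hb v) (norm_nonneg _)).trans ?_
    rw [mul_assoc]
    exact mul_le_mul_of_nonneg_left (hbb v.2) hC
  refine ⟨?_, fun x => ?_⟩
  · exact (h.integrable.norm.mul_prod (hbi.const_mul C)).mono' hc.aestronglyMeasurable
      (Filter.Eventually.of_forall hle)
  · exact ((hbi.const_mul C).const_mul ‖h x‖).mono'
      (hc.comp (Continuous.prodMk_right x)).aestronglyMeasurable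
      (Filter.Eventually.of_forall fun Ξ => hle (x, Ξ))

theorem integral_tensorIntegrand {p : Rn3 n → ℂ} (hp : Continuous p) {C m : ℝ}
    (hb : ∀ v : Rn3 n, ‖p v‖ ≤ C * (1 + ‖v.2‖) ^ m) (f g h : 𝓢(Rn n, ℂ)) :
    ∫ v, tensorIntegrand p f g h v = ∫ x, bilinearOp p f g x * h x := by
  obtain ⟨h1, h2⟩ := integrable_tensorIntegrand hp hb f g h
  refine (integral_prod _ h1).trans (integral_congr_ae (Filter.Eventually.of_forall fun x => ?_))
  refine (integral_prod _ (h2 x)).trans ?_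
  simp only [tensorIntegrand, bilinearOp, integral_mul_const]

/-- The constant `(2π)^{-2n}`. -/
noncomputable def kernelConst (n : ℕ) : ℂ :=
  (((2 * Real.pi) ^ n : ℝ) : ℂ)⁻¹ * (((2 * Real.pi) ^ n : ℝ) : ℂ)⁻¹

theorem integral_phase_mul_tensor (f g : 𝓢(Rn n, ℂ)) (x : Rn n) (Ξ : Rn n × Rn n) :
    kernelConst n * ∫ Y : Rn n × Rn n, phase (phaseForm n) (x, Y) Ξ * tensor f g Y =
      Complex.exp (Complex.I * ((inner ℝ x (Ξ.1 + Ξ.2) : ℝ) : ℂ)) * (fhat f Ξ.1 * fhat g Ξ.2) := by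
  have h1 : ∀ Y : Rn n × Rn n, phase (phaseForm n) (x, Y) Ξ * tensor f g Y =
      Complex.exp (Complex.I * ((inner ℝ x (Ξ.1 + Ξ.2) : ℝ) : ℂ)) *
      ((Complex.exp (-(Complex.I * ((inner ℝ Y.1 Ξ.1 : ℝ) : ℂ))) * f Y.1) *
        (Complex.exp (-(Complex.I * ((inner ℝ Y.2 Ξ.2 : ℝ) : ℂ))) * g Y.2)) := by
    intro Y
    change _ * (f Y.1 * g Y.2) = _
    have : phase (phaseForm n) (x, Y) Ξ =
        Complex.exp (Complex.I * ((inner ℝ x (Ξ.1 + Ξ.2) : ℝ) : ℂ)) *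
        (Complex.exp (-(Complex.I * ((inner ℝ Y.1 Ξ.1 : ℝ) : ℂ))) *
        Complex.exp (-(Complex.I * ((inner ℝ Y.2 Ξ.2 : ℝ) : ℂ)))) := by
      rw [← Complex.exp_add, ← Complex.exp_add, phase, phaseForm_apply]
      congr 1
      simp only [inner_sub_left, inner_add_right]
      push_cast
      ring
    rw [this]
    ring
  simp only [h1]
  rw [integral_const_mul]
  have h2 := integral_prod_mul (μ := (volume : Measure (Rn n))) (ν := (volume : Measure (Rn n)))
    (fun y => Complex.exp (-(Complex.I * ((inner ℝ y Ξ.1 : ℝ) : ℂ))) * f y)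
    (fun z => Complex.exp (-(Complex.I * ((inner ℝ z Ξ.2 : ℝ) : ℂ))) * g z)
  rw [← Measure.volume_eq_prod] at h2
  rw [h2, fhat, fhat, kernelConst]
  ring

theorem continuous_phase_right {X E : Type*} [NormedAddCommGroup X] [NormedSpace ℝ X]
    [NormedAddCommGroup E] [NormedSpace ℝ E] {L : X × E →L[ℝ] E →L[ℝ] ℝ} (x : X) :
    Continuous fun q : E × E => phase L (x, q.1) q.2 := by
  have h : Continuous fun q : E × E => (((x, q.1), q.2) : (X × E) × E) := by fun_prop
  exact contDiff_phase.continuous.comp h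

/-- The action of a truncated kernel on tensor products. -/
theorem integral_osc_mul_tensor {b : Rn3 n → ℂ} (hb : ContDiff ℝ ∞ b) {r : ℝ}
    (hv : ∀ v : Rn3 n, r < ‖v.2‖ → b v = 0) (hB : ∃ B, ∀ v, ‖b v‖ ≤ B) (f g h : 𝓢(Rn n, ℂ)) :
    kernelConst n * ∫ w, osc (phaseForm n) b w * tensor h (tensor f g) w =
      ∫ v, tensorIntegrand b f g h v := by
  obtain ⟨B, hB⟩ := hB
  have hosc := continuous_osc_of_vanish (L := phaseForm n) hb hv
  have := Measure.IsAddHaarMeasure.instHasTemperateGrowth (μ := (volume : Measure (Rn3 n)))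
  have hint := integrable_mul_schwartz (μ := (volume : Measure (Rn3 n))) hosc
    (norm_osc_le_of_vanish hB hv) (tensor h (tensor f g))
  have hQ := (integrable_tensorIntegrand hb.continuous (C := B) (m := 0) (by simpa using hB)
    f g h).1
  have e1 := integral_prod _ hint
  rw [← Measure.volume_eq_prod] at e1
  have e2 := integral_prod _ hQ
  rw [← Measure.volume_eq_prod] at e2
  rw [e1, e2, ← integral_const_mul]
  refine integral_congr_ae (Filter.Eventually.of_forall fun x => ?_)
  change kernelConst n * ∫ Y : Rn n × Rn n,
    (∫ Ξ, b (x, Ξ) * phase (phaseForm n) (x, Y) Ξ) * (h x * tensor f g Y) = _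
  simp only [← integral_mul_const]
  rw [integral_integral_swap, ← integral_const_mul]
  · refine integral_congr_ae (Filter.Eventually.of_forall fun Ξ => ?_)
    change kernelConst n * ∫ Y : Rn n × Rn n,
      b (x, Ξ) * phase (phaseForm n) (x, Y) Ξ * (h x * tensor f g Y) = _
    have e3 : ∀ Y : Rn n × Rn n, b (x, Ξ) * phase (phaseForm n) (x, Y) Ξ * (h x * tensor f g Y) =
        (b (x, Ξ) * h x) * (phase (phaseForm n) (x, Y) Ξ * tensor f g Y) := fun Y => by ring
    simp only [e3]
    rw [integral_const_mul, mul_left_comm, integral_phase_mul_tensor, tensorIntegrand]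
    ring
  · have hbx : Integrable fun Ξ : Rn n × Rn n => b (x, Ξ) :=
      (hb.continuous.comp (Continuous.prodMk_right x)).integrable_of_hasCompactSupport
        (HasCompactSupport.intro (isCompact_closedBall (0 : Rn n × Rn n) r) fun Ξ hΞ =>
          hv (x, Ξ) (by simpa using hΞ))
    refine (((tensor f g).integrable.const_mul (h x)).mul_prod hbx).mono ?_
      (Filter.Eventually.of_forall fun q => ?_)
    · have hph : Continuous fun q : (Rn n × Rn n) × (Rn n × Rn n) =>
          phase (phaseForm n) (x, q.1) q.2 :=
        continuous_phase_right x
      exact (((hb.continuous.comp (continuous_const.prodMk continuous_snd)).mul hph).mul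
        (continuous_const.mul ((tensor f g).continuous.comp continuous_fst))).aestronglyMeasurable
    · change ‖b (x, q.2) * phase (phaseForm n) (x, q.1) q.2 * (h x * tensor f g q.1)‖ ≤
        ‖h x * tensor f g q.1 * b (x, q.2)‖
      rw [norm_mul, norm_mul, norm_phase, mul_one, norm_mul (_ * _) (b _), mul_comm]

/-- The limit of the truncated kernels is a distributional kernel. -/
theorem IsOscLimit.isDistribKernel {p : Rn3 n → ℂ} (hp : ContDiff ℝ ∞ p) {C m : ℝ}
    (hb : ∀ v : Rn3 n, ‖p v‖ ≤ C * (1 + ‖v.2‖) ^ m) {T : 𝓢'(Rn3 n, ℂ)}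
    (hT : IsOscLimit (phaseForm n) (fun v => kernelConst n * p v) T) : IsDistribKernel p T := by
  intro f g h
  have hk : ∀ k : ℕ, (0 : ℝ) < (k : ℝ) + 1 := fun k => by positivity
  have hosc : ∀ (k : ℕ) w, osc (phaseForm n) (cut ((k : ℝ) + 1) fun v => kernelConst n * p v) w =
      kernelConst n * osc (phaseForm n) (cut ((k : ℝ) + 1) p) w := fun k w => by
    rw [osc, osc, ← integral_const_mul]
    congr 1
    funext Ξ
    simp only [cut]
    ring
  have h1 : ∀ k : ℕ, ∫ w, osc (phaseForm n) (cut ((k : ℝ) + 1) fun v => kernelConst n * p v) w *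
      tensor h (tensor f g) w = ∫ v, tensorIntegrand (cut ((k : ℝ) + 1) p) f g h v := fun k => by
    rw [← integral_osc_mul_tensor (contDiff_cut hp _) (cut_vanish p (hk k))
      (exists_bound_cut hb (hk k)), ← integral_const_mul]
    simp only [hosc, mul_assoc]
  have hcut : ∀ (k : ℕ) v, tensorIntegrand (cut ((k : ℝ) + 1) p) f g h v =
      freqCutoff ((k : ℝ) + 1) v.2 * tensorIntegrand p f g h v := fun k v => by
    simp only [tensorIntegrand, cut]
    ring
  rw [← integral_tensorIntegrand hp.continuous hb]
  refine tendsto_nhds_unique (hT _) ?_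
  simp only [h1]
  refine tendsto_integral_of_dominated_convergence (fun v => ‖tensorIntegrand p f g h v‖)
    (fun k =>
      (continuous_tensorIntegrand (contDiff_cut hp _).continuous f g h).aestronglyMeasurable)
    (integrable_tensorIntegrand hp.continuous hb f g h).1.norm
    (fun k => Filter.Eventually.of_forall fun v => ?_) (Filter.Eventually.of_forall fun v => ?_)
  · rw [hcut, norm_mul]
    exact mul_le_of_le_one_left (norm_nonneg _) (norm_freqCutoff_le_one _ _)
  · refine tendsto_const_nhds.congr' ?_
    filter_upwards [Filter.eventually_ge_atTop ⌈‖v.2‖⌉₊] with k hk'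
    have : ‖v.2‖ ≤ (k : ℝ) + 1 :=
      (Nat.le_ceil _).trans ((Nat.cast_le.2 hk').trans (by linarith))
    rw [hcut, freqCutoff_eq_one (hk k) this, one_mul]

end Kernel


/-! ### Pointwise estimates -/

section Estimates

variable {n : ℕ} {ρ δ m : ℝ} {a : Rn3 n → ℂ}

/-- The list of directions in which `multiDeriv v α` differentiates. -/
def dirList {V : Type*} (v : Fin n → V) (α : Fin n → ℕ) : List V :=
  (List.finRange n).flatMap fun i => List.replicate (α i) (v i)

theorem length_dirList {V : Type*} (v : Fin n → V) (α : Fin n → ℕ) :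
    (dirList v α).length = len α := by
  simp only [dirList, List.length_flatMap, List.length_replicate, len]
  rw [← List.ofFn_eq_map, List.sum_ofFn]

theorem multiDeriv_eq_foldr {V : Type*} [NormedAddCommGroup V] [NormedSpace ℝ V] (v : Fin n → V)
    (α : Fin n → ℕ) (F : V → ℂ) : multiDeriv v α F = (dirList v α).foldr dirDeriv F := by
  unfold multiDeriv dirList
  induction List.finRange n with
  | nil => rfl
  | cons i l ih =>
    rw [List.foldr_cons, ih, List.flatMap_cons, List.foldr_append]
    generalize List.foldr dirDeriv F _ = G
    induction α i with
    | zero => rfl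
    | succ k ihk => rw [Function.iterate_succ_apply', ihk, List.replicate_succ, List.foldr_cons]

theorem exists_list_mixedDeriv (α β γ : Fin n → ℕ) : ∃ l : List (Rn3 n),
    l.length = len α + len β + len γ ∧ ∀ F, mixedDeriv α β γ F = l.foldr dirDeriv F := by
  refine ⟨dirList (fun i => ((unitVec i, 0, 0) : Rn3 n)) α ++
    (dirList (fun i => ((0, unitVec i, 0) : Rn3 n)) β ++
      dirList (fun i => ((0, 0, unitVec i) : Rn3 n)) γ), ?_, fun F => ?_⟩
  · simp only [List.length_append, length_dirList, add_assoc]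
  · rw [mixedDeriv, multiDeriv_eq_foldr, multiDeriv_eq_foldr, multiDeriv_eq_foldr,
      List.foldr_append, List.foldr_append]

theorem IsSym.exists_mixedDeriv_regKernel (hρ1 : ρ ≤ 1) (hδ1 : δ ≤ 1) (h : IsSym ρ δ m a)
    {U : Set (Rn3 n)} (hUo : IsOpen U) (α β γ : Fin n → ℕ)
    (hU : Admissible (phaseForm n) (pairBasis n) ρ U (m + (len α + len β + len γ : ℕ))) :
    ∃ a', IsSym ρ δ (m + (len α + len β + len γ : ℕ)) a' ∧ ∀ w ∈ U,
      mixedDeriv α β γ (regKernel (phaseForm n) a) w = regKernel (phaseForm n) a' w := by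
  obtain ⟨l, hl, hF⟩ := exists_list_mixedDeriv α β γ
  rw [← hl] at hU ⊢
  obtain ⟨h1, h2⟩ := h.foldr_dirDeriv_regKernel hρ1 hδ1 hUo l hU
  exact ⟨_, h1, fun w hw => by rw [hF]; exact h2 w hw⟩

theorem finrank_pair (n : ℕ) : ((Module.finrank ℝ (Rn n × Rn n) : ℕ) : ℝ) = 2 * n := by
  rw [Module.finrank_prod, finrank_euclideanSpace_fin]
  push_cast
  ring

theorem isOpen_offDiag (n : ℕ) : IsOpen (offDiag n) := by
  refine isOpen_lt continuous_const ?_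
  unfold sumDist
  fun_prop

theorem phaseSize_pos {w : Rn3 n} (hw : 0 < sumDist w.1 w.2.1 w.2.2) :
    0 < phaseSize (phaseForm n) (pairBasis n) w := by
  linarith [sumDist_le_phaseSize w]

theorem admissible_offDiag (hρ : 0 < ρ) (r : ℝ) :
    Admissible (phaseForm n) (pairBasis n) ρ (offDiag n) r :=
  admissible_of_pos hρ (fun _ hw => phaseSize_pos hw) r

theorem sumDist_nonneg (x y z : Rn n) : 0 ≤ sumDist x y z := by
  unfold sumDist; positivity

/-- Rapid decay of the derivatives of the kernel. -/
theorem IsSym.exists_bound_sumDist_pow_mul (hρ1 : ρ ≤ 1) (hδ1 : δ ≤ 1) (h : IsSym ρ δ m a)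
    {U : Set (Rn3 n)} (hUo : IsOpen U) (α β γ : Fin n → ℕ)
    (hU : Admissible (phaseForm n) (pairBasis n) ρ U (m + (len α + len β + len γ : ℕ)))
    {N : ℕ} (hN : m + (len α + len β + len γ : ℕ) - ρ * N + 2 * n < 0)
    (hUN : ∀ w ∈ U, 0 < phaseSize (phaseForm n) (pairBasis n) w ^ N) :
    ∃ C : ℝ, ∀ w ∈ U, sumDist w.1 w.2.1 w.2.2 ^ N *
      ‖mixedDeriv α β γ (regKernel (phaseForm n) a) w‖ ≤ C := by
  obtain ⟨a', ha', he⟩ := h.exists_mixedDeriv_regKernel hρ1 hδ1 hUo α β γ hU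
  rw [← finrank_pair] at hN
  obtain ⟨C, hC0, hC⟩ := ha'.exists_bound_regKernel (L := phaseForm n) hρ1 (pairBasis n) hN
  refine ⟨2 ^ N * C, fun w hw => ?_⟩
  rw [he w hw]
  have h1 := sumDist_nonneg w.1 w.2.1 w.2.2
  calc _ ≤ (2 * phaseSize (phaseForm n) (pairBasis n) w) ^ N *
        ‖regKernel (phaseForm n) a' w‖ := by
        gcongr
        exact sumDist_le_phaseSize w
    _ = 2 ^ N * (phaseSize (phaseForm n) (pairBasis n) w ^ N *
        ‖regKernel (phaseForm n) a' w‖) := by rw [mul_pow]; ring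
    _ ≤ _ := by gcongr; exact hC w (hUN w hw)

/-- Symbols of compact frequency support have every order. -/
theorem IsSym.of_vanish {R : ℝ} (h : IsSym ρ δ m a) (hR : ∀ v : Rn3 n, R < ‖v.2‖ → a v = 0)
    (m' : ℝ) : IsSym ρ δ m' a := by
  refine ⟨h.1, fun l => ?_⟩
  replace h := h.bound l
  have key : ∀ {m m' : ℝ} {a : Rn3 n → ℂ}, (∀ v : Rn3 n, R < ‖v.2‖ → a v = 0) →
      (∃ C : ℝ, 0 ≤ C ∧ ∀ (i : Unit) v, ‖a v‖ ≤ C * (1 + ‖v.2‖) ^ m) →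
      ∃ C : ℝ, ∀ (i : Unit) v, ‖a v‖ ≤ C * (1 + ‖v.2‖) ^ m' := by
    rintro m m' a hR ⟨C, hC0, hC⟩
    refine ⟨C * (1 + |R|) ^ |m - m'|, fun i v => ?_⟩
    rcases lt_or_ge R ‖v.2‖ with hv | hv
    · rw [hR v hv, norm_zero]; positivity
    · refine (hC i v).trans ?_
      have h1 : 0 < 1 + ‖v.2‖ := by positivity
      have h2 : (1 + ‖v.2‖) ^ m = (1 + ‖v.2‖) ^ (m - m') * (1 + ‖v.2‖) ^ m' := by
        rw [← Real.rpow_add h1, sub_add_cancel]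
      rw [h2, mul_assoc]
      gcongr
      exact (Real.rpow_le_rpow_of_exponent_le (by linarith [norm_nonneg v.2])
        (le_abs_self _)).trans (by gcongr; exact hv.trans (le_abs_self R))
  induction l generalizing m m' a with
  | zero => exact key hR h.base
  | succ l ih =>
    exact ⟨key hR h.base, fun e => ih (dirDeriv_vanish (isOpen_lt_norm R) hR _) _ (h.2.1 e),
      fun u => ih (dirDeriv_vanish (isOpen_lt_norm R) hR _) _ (h.2.2 u)⟩

theorem nontrivial_pair {w : Rn3 n} (hw : 0 < sumDist w.1 w.2.1 w.2.2) :
    n ≠ 0 ∧ Nontrivial (Rn n × Rn n) := by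
  have hn : n ≠ 0 := by
    rintro rfl
    rw [sumDist, Subsingleton.elim w.1 0, Subsingleton.elim w.2.1 0,
      Subsingleton.elim w.2.2 0] at hw
    simp at hw
  have : NeZero n := ⟨hn⟩
  exact ⟨hn, inferInstance⟩

/-- A bound for the kernel off the diagonal of a symbol of positive excess. -/
theorem IsSym.exists_bound_sumDist_of_pos (hρ : 0 < ρ) (hρ1 : ρ ≤ 1) (h : IsSym ρ δ m a)
    (hm : 0 < m + 2 * n) :
    ∃ C : ℝ, 0 ≤ C ∧ ∀ w : Rn3 n, 0 < sumDist w.1 w.2.1 w.2.2 →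
      ‖regKernel (phaseForm n) a w‖ ≤ C * sumDist w.1 w.2.1 w.2.2 ^ (-(m + 2 * n) / ρ) := by
  by_cases hne : ∃ w : Rn3 n, 0 < sumDist w.1 w.2.1 w.2.2
  swap
  · exact ⟨0, le_rfl, fun w hw => absurd ⟨w, hw⟩ hne⟩
  obtain ⟨w₀, hw₀⟩ := hne
  have := (nontrivial_pair hw₀).2
  rw [← finrank_pair] at hm ⊢
  obtain ⟨C, hC0, hC⟩ := h.exists_bound_regKernel_of_pos (L := phaseForm n) hρ hρ1 (pairBasis n) hm
  set q : ℝ := -(m + (Module.finrank ℝ (Rn n × Rn n) : ℕ)) / ρ with hq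
  have hq0 : q ≤ 0 := div_nonpos_of_nonpos_of_nonneg (by linarith) hρ.le
  refine ⟨C * (1 / 2 : ℝ) ^ q, by positivity, fun w hw => (hC w (phaseSize_pos hw)).trans ?_⟩
  rw [mul_assoc, ← Real.mul_rpow (by positivity) hw.le]
  gcongr ?_ * ?_
  exact Real.rpow_le_rpow_of_nonpos (by positivity) (by linarith [sumDist_le_phaseSize w]) hq0

/-- A bound for the kernel off the diagonal of a symbol of critical order. -/
theorem IsSym.exists_bound_sumDist_of_eq_zero (hρ : 0 < ρ) (hρ1 : ρ ≤ 1) (h : IsSym ρ δ m a)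
    (hm : m + 2 * n = 0) :
    ∃ C : ℝ, 0 ≤ C ∧ ∀ w : Rn3 n, 0 < sumDist w.1 w.2.1 w.2.2 →
      ‖regKernel (phaseForm n) a w‖ ≤ C * (1 + |Real.log (sumDist w.1 w.2.1 w.2.2)|) := by
  by_cases hne : ∃ w : Rn3 n, 0 < sumDist w.1 w.2.1 w.2.2
  swap
  · exact ⟨0, le_rfl, fun w hw => absurd ⟨w, hw⟩ hne⟩
  obtain ⟨w₀, hw₀⟩ := hne
  obtain ⟨hn, this⟩ := nontrivial_pair hw₀
  have hn1 : (1 : ℝ) ≤ n := by exact_mod_cast Nat.one_le_iff_ne_zero.2 hn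
  rw [← finrank_pair] at hm
  obtain ⟨C, hC0, hC⟩ :=
    h.exists_bound_regKernel_of_eq_zero (L := phaseForm n) hρ hρ1 (pairBasis n) hm
  have hl2 : 0 ≤ Real.log 2 := Real.log_nonneg (by norm_num)
  have hln : 0 ≤ Real.log n := Real.log_nonneg hn1
  refine ⟨C * (1 + Real.log 2 + Real.log n), by positivity, fun w hw =>
    (hC w (phaseSize_pos hw)).trans ?_⟩
  rw [mul_assoc]
  gcongr
  have hp := phaseSize_pos hw
  have h1 := Real.log_le_log hw (sumDist_le_phaseSize w)
  have h2 := Real.log_le_log hp (phaseSize_le_sumDist w)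
  rw [Real.log_mul (by norm_num) hp.ne'] at h1
  rw [Real.log_mul (by positivity) hw.ne'] at h2
  set s := Real.log (sumDist w.1 w.2.1 w.2.2)
  have h3 : |Real.log (phaseSize (phaseForm n) (pairBasis n) w)| ≤
      Real.log 2 + Real.log n + |s| :=
    abs_le.2 ⟨by linarith [neg_abs_le s], by linarith [le_abs_self s]⟩
  nlinarith [abs_nonneg s]

theorem le_len (α : Fin n → ℕ) (i : Fin n) : α i ≤ len α :=
  Finset.single_le_sum (fun _ _ => Nat.zero_le _) (Finset.mem_univ i)

/-- A bound which holds for every multi-index of a given length holds uniformly. -/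
theorem exists_uniform_bound (M : ℕ) {P : (Fin n → ℕ) → (Fin n → ℕ) → (Fin n → ℕ) → ℝ → Prop}
    (hP : ∀ α β γ C C', C ≤ C' → P α β γ C → P α β γ C')
    (h : ∀ α β γ, len α + len β + len γ = M → ∃ C, P α β γ C) :
    ∃ C : ℝ, 0 < C ∧ ∀ α β γ, len α + len β + len γ = M → P α β γ C := by
  have h' : ∀ t : (Fin n → ℕ) × (Fin n → ℕ) × (Fin n → ℕ), ∃ C,
      len t.1 + len t.2.1 + len t.2.2 = M → P t.1 t.2.1 t.2.2 C := fun t => by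
    by_cases ht : len t.1 + len t.2.1 + len t.2.2 = M
    · exact (h _ _ _ ht).imp fun C hC _ => hC
    · exact ⟨0, fun h => absurd h ht⟩
  choose K hK using h'
  have hfin := Set.finite_Iic (fun _ : Fin n => M)
  obtain ⟨B, hB⟩ := ((hfin.prod (hfin.prod hfin)).image K).bddAbove
  refine ⟨max B 1, by positivity, fun α β γ ht => hP α β γ _ _ ?_ (hK (α, β, γ) ht)⟩
  refine (hB ⟨(α, β, γ), ⟨fun i => ?_, fun i => ?_, fun i => ?_⟩, rfl⟩).trans (le_max_left _ _)
  · exact (le_len α i).trans (by dsimp only; omega)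
  · exact (le_len β i).trans (by dsimp only; omega)
  · exact (le_len γ i).trans (by dsimp only; omega)

theorem IsSym.isGivenOn {T : 𝓢'(Rn3 n, ℂ)} (hT : IsOscLimit (phaseForm n) a T) (hρ1 : ρ ≤ 1)
    (h : IsSym ρ δ m a) {U : Set (Rn3 n)} (hUo : IsOpen U)
    (hU : Admissible (phaseForm n) (pairBasis n) ρ U m) :
    IsGivenOn T U (regKernel (phaseForm n) a) :=
  ⟨(h.continuousOn_regKernel hρ1 hU).locallyIntegrableOn hUo.measurableSet,
    hT.apply_eq_integral h.smooth (h.tendstoLocallyUniformlyOn_regKernel hρ1 hU)⟩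

end Estimates

end BilinearPDO

theorem mainTheorem6 (n : ℕ) (m ρ δ : ℝ) (hρ : 0 < ρ) (hρ1 : ρ ≤ 1) (hδ : 0 ≤ δ) (hδ1 : δ < 1)
    (p : Rn3 n → ℂ) (hp : IsBSSymbol m ρ δ p) :
    -- `T_p` has one and only one distributional kernel
    (∃! k : 𝓢'(Rn3 n, ℂ), IsDistribKernel p k) ∧
    ∀ k : 𝓢'(Rn3 n, ℂ), IsDistribKernel p k →
      -- off the diagonal the kernel is a smooth function, whose values are denoted by `κ`
      ∃ κ : Rn3 n → ℂ,
        IsGivenOn k (offDiag n) κ ∧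
        ContDiffOn ℝ ∞ κ (offDiag n) ∧
        -- (i)
        (∀ α β γ : Fin n → ℕ, ∃ N₀ : ℕ, ∀ N : ℕ, N₀ ≤ N →
          ∃ C : ℝ, ∀ x y z : Rn n, 0 < sumDist x y z →
            sumDist x y z ^ N * ‖mixedDeriv α β γ κ (x, y, z)‖ ≤ C) ∧
        -- (ii)
        (HasUniformCompactFreqSupport p →
          IsGivenOn k Set.univ κ ∧ ContDiff ℝ ∞ κ ∧
          ∀ (α β γ : Fin n → ℕ) (N : ℕ), ∃ C : ℝ, 0 < C ∧
            ∀ x y z : Rn n, 0 < sumDist x y z →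
              ‖mixedDeriv α β γ κ (x, y, z)‖ ≤
                C * ((1 + sumDist x y z) ^ N)⁻¹) ∧
        -- (iii)
        (∀ M : ℕ, m + M + 2 * n < 0 →
          IsGivenOn k Set.univ κ ∧ ContDiff ℝ M κ ∧
          ∀ α β γ : Fin n → ℕ,
            len α + len β + len γ ≤ M →
            ∃ C : ℝ, ∀ x y z : Rn n,
              ‖mixedDeriv α β γ κ (x, y, z)‖ ≤ C) ∧
        -- (iv)
        (∀ M : ℕ, m + M + 2 * n = 0 →
          ∃ C : ℝ, 0 < C ∧ ∀ α β γ : Fin n → ℕ,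
            len α + len β + len γ = M →
            ∀ x y z : Rn n, 0 < sumDist x y z →
              ‖mixedDeriv α β γ κ (x, y, z)‖ ≤
                C * (1 + |Real.log (sumDist x y z)|)) ∧
        -- (v)
        (∀ M : ℕ, 0 < m + M + 2 * n →
          ∃ C : ℝ, 0 < C ∧ ∀ α β γ : Fin n → ℕ,
            len α + len β + len γ = M →
            ∀ x y z : Rn n, 0 < sumDist x y z →
              ‖mixedDeriv α β γ κ (x, y, z)‖ ≤
                C * sumDist x y z ^ (-(m + M + 2 * n) / ρ)) := by
  have hδ1' : δ ≤ 1 := hδ1.le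
  set a : Rn3 n → ℂ := fun v => kernelConst n * p v with ha_def
  have ha : IsSym ρ δ m a := IsSymFamily.const_mul (kernelConst n) hp.isSymFamily
  obtain ⟨C₀, hC₀, hp0⟩ := (hp.isSymFamily.bound 0).base
  obtain ⟨C₁, hC₁, ha0⟩ := (IsSymFamily.bound ha 0).base
  obtain ⟨T, hT⟩ := exists_isOscLimit (L := phaseForm n) (pairBasis n) one_half_pos
    half_mul_sq_le_freqWeight ha.smooth (ha0 ())
  have hTk : IsDistribKernel p T := hT.isDistribKernel hp.1 (hp0 ())
  refine ⟨⟨T, hTk, fun k hk => hk.unique hTk⟩, fun k hk => ?_⟩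
  obtain rfl := hk.unique hTk
  refine ⟨regKernel (phaseForm n) a, IsSym.isGivenOn hT hρ1 ha (isOpen_offDiag n)
    (admissible_offDiag hρ m), ?_, ?_, ?_, ?_, ?_, ?_⟩
  · exact contDiffOn_infty.2 fun M => ha.contDiffOn_regKernel hρ1 hδ1' (isOpen_offDiag n) M
      (admissible_offDiag hρ _)
  · intro α β γ
    obtain ⟨N₀, hN₀⟩ := exists_nat_gt ((m + (len α + len β + len γ : ℕ) + 2 * n) / ρ)
    rw [div_lt_iff₀ hρ] at hN₀
    refine ⟨N₀, fun N hN => ?_⟩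
    have hN' : (N₀ : ℝ) * ρ ≤ N * ρ := by gcongr
    obtain ⟨C, hC⟩ := ha.exists_bound_sumDist_pow_mul hρ1 hδ1' (isOpen_offDiag n) α β γ
      (admissible_offDiag hρ _) (N := N) (by linarith)
      (fun w hw => pow_pos (phaseSize_pos hw) N)
    exact ⟨C, fun x y z hw => hC (x, y, z) hw⟩
  · rintro ⟨K, hK, hpK⟩
    obtain ⟨R, hR⟩ := hK.isBounded.subset_closedBall 0
    have hv : ∀ v : Rn3 n, R < ‖v.2‖ → a v = 0 := fun v hv => by
      have : v.2 ∉ K := fun h => hv.not_ge (by simpa using hR h)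
      rw [ha_def]
      exact mul_eq_zero_of_right _ (hpK v.1 v.2.1 v.2.2 this)
    have hany := fun m' => ha.of_vanish hv m'
    have hadm : ∀ l : ℕ, Admissible (phaseForm n) (pairBasis n) ρ Set.univ
        ((-2 * n - l - 1) + l) := fun l => admissible_univ (by
      rw [finrank_pair]; linarith) _
    refine ⟨IsSym.isGivenOn hT hρ1 (hany _) isOpen_univ (by simpa using hadm 0), ?_, ?_⟩
    · exact contDiff_infty.2 fun M => contDiffOn_univ.1 <|
        (hany _).contDiffOn_regKernel hρ1 hδ1' isOpen_univ M (hadm M)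
    · intro α β γ N
      set l := len α + len β + len γ
      have key : ∀ N, (∀ w ∈ offDiag n, 0 < phaseSize (phaseForm n) (pairBasis n) w ^ N) →
          ∃ C : ℝ, ∀ w ∈ offDiag n, sumDist w.1 w.2.1 w.2.2 ^ N *
            ‖mixedDeriv α β γ (regKernel (phaseForm n) a) w‖ ≤ C := fun N hN =>
        (hany (-2 * n - l - 1)).exists_bound_sumDist_pow_mul hρ1 hδ1' (isOpen_offDiag n) α β γ
          (admissible_offDiag hρ _) (N := N)
          (by
            have : 0 ≤ ρ * N := by positivity
            linarith) hN
      obtain ⟨A, hA⟩ := key 0 fun w hw => by simp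
      obtain ⟨B, hB⟩ := key N fun w hw => pow_pos (phaseSize_pos hw) N
      refine ⟨2 ^ N * (|A| + |B| + 1), by positivity, fun x y z hw => ?_⟩
      have h1 := hA (x, y, z) hw
      have h2 := hB (x, y, z) hw
      rw [pow_zero, one_mul] at h1
      simp only at h1 h2
      set s := sumDist x y z
      set d := ‖mixedDeriv α β γ (regKernel (phaseForm n) a) (x, y, z)‖
      rw [← div_eq_mul_inv, le_div_iff₀ (by positivity)]
      have hd : 0 ≤ d := norm_nonneg _
      have h3 : (1 + s) ^ N ≤ 2 ^ N * (1 + s ^ N) := by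
        rw [mul_add, ← mul_pow]
        rcases le_total 1 s with h | h
        · have : (1 + s) ^ N ≤ (2 * s) ^ N := by gcongr; linarith
          linarith [show (0 : ℝ) ≤ 2 ^ N * 1 by positivity]
        · have : (1 + s) ^ N ≤ 2 ^ N := by gcongr; linarith
          linarith [show (0 : ℝ) ≤ (2 * s) ^ N by positivity]
      calc d * (1 + s) ^ N ≤ d * (2 ^ N * (1 + s ^ N)) := by gcongr
        _ = 2 ^ N * (d + s ^ N * d) := by ring
        _ ≤ _ := by
          refine mul_le_mul_of_nonneg_left ?_ (by positivity)
          linarith [le_abs_self A, le_abs_self B]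
  · intro M hM
    have hadm : ∀ l : ℕ, l ≤ M → Admissible (phaseForm n) (pairBasis n) ρ Set.univ (m + l) :=
      fun l hl => admissible_univ (by
        have : (l : ℝ) ≤ M := by exact_mod_cast hl
        rw [finrank_pair]
        linarith) _
    refine ⟨IsSym.isGivenOn hT hρ1 ha isOpen_univ (by simpa using hadm 0 (Nat.zero_le _)),
      contDiffOn_univ.1 (ha.contDiffOn_regKernel hρ1 hδ1' isOpen_univ M (hadm M le_rfl)),
      fun α β γ hl => ?_⟩
    obtain ⟨C, hC⟩ := ha.exists_bound_sumDist_pow_mul hρ1 hδ1' isOpen_univ α β γ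
      (hadm _ hl) (N := 0) (by
        have : ((len α + len β + len γ : ℕ) : ℝ) ≤ M := by exact_mod_cast hl
        rw [Nat.cast_zero, mul_zero]
        linarith) (fun w _ => by simp)
    exact ⟨C, fun x y z => by simpa using hC (x, y, z) (Set.mem_univ _)⟩
  · intro M hM
    refine exists_uniform_bound M (P := fun α β γ C => ∀ x y z : Rn n, 0 < sumDist x y z →
      ‖mixedDeriv α β γ (regKernel (phaseForm n) a) (x, y, z)‖ ≤
        C * (1 + |Real.log (sumDist x y z)|))
      (fun α β γ C C' hCC' h x y z hw => (h x y z hw).trans (by gcongr)) fun α β γ hl => ?_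
    obtain ⟨a', ha', he⟩ := ha.exists_mixedDeriv_regKernel hρ1 hδ1' (isOpen_offDiag n) α β γ
      (admissible_offDiag hρ _)
    rw [hl] at ha'
    obtain ⟨C, -, hC⟩ := ha'.exists_bound_sumDist_of_eq_zero hρ hρ1 hM
    exact ⟨C, fun x y z hw => by rw [he (x, y, z) hw]; exact hC (x, y, z) hw⟩
  · intro M hM
    refine exists_uniform_bound M (P := fun α β γ C => ∀ x y z : Rn n, 0 < sumDist x y z →
      ‖mixedDeriv α β γ (regKernel (phaseForm n) a) (x, y, z)‖ ≤
        C * sumDist x y z ^ (-(m + M + 2 * n) / ρ))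
      (fun α β γ C C' hCC' h x y z hw => (h x y z hw).trans (by gcongr)) fun α β γ hl => ?_
    obtain ⟨a', ha', he⟩ := ha.exists_mixedDeriv_regKernel hρ1 hδ1' (isOpen_offDiag n) α β γ
      (admissible_offDiag hρ _)
    rw [hl] at ha'
    obtain ⟨C, -, hC⟩ := ha'.exists_bound_sumDist_of_pos hρ hρ1 hM
    exact ⟨C, fun x y z hw => by rw [he (x, y, z) hw]; exact hC (x, y, z) hw⟩
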